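/- Let $P$ be a finite set of $n\ge 3$ points in the plane, no three on a line; let $h$ be the number of its extreme points (vertices of $\mathrm{conv}\,P$), and call the other points inner points. Graphs on $P$ are drawn with straight-line edges; a graph is plane if no two of its edges meet except possibly in a common endpoint. The regions of a plane graph are the bounded connected components of the complement of the union of its edges, and its inner edges are the edges that are not edges of $\mathrm{conv}\,P$. A full triangulation of $P$ is a maximal plane graph with vertex set $P$. A full subdivision of $P$ is a connected plane graph with vertex set $P$ that contains all edges of $\mathrm{conv}\,P$ and all of whose regions are convex. For full subdivisions, $S_1\preceq S_2$ means that the edge set of $S_1$ contains the edge set of $S_2$. The slack of a region that is a $k$-gon is $k-3$ and its refined slack is $\lceil (k-3)/2\rceil$; the slack $D(S)$ and the refined slack $D^*(S)$ of $S$ are the sums of these numbers over all regions of $S$. An edge $e$ is locked at its endpoint $p$ if after removal of $e$ the angle at $p$ between the two edges adjacent to $e$ in radial order around $p$ is at least $\pi$ (in particular, if $p$ has degree $1$ or $2$); $e$ is locked if it is locked at one of its endpoints. In a partially oriented subdivision some of the edges are oriented to one of their endpoints. (1) Let a full subdivision $S$ be partially oriented such that no inner edge is directed to an extreme point, and let $C_i$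 be the number of inner points of indegree $i$. If $C_i=0$ for all $i\ge 4$, then the number of unoriented inner edges equals $$n-3-C_3-D(S)+(C_1+2C_0)\ \ge\ n-3-C_3-D(S)\ \ge\ h-3-D(S).$$ (2) Let a full subdivision $S$ be partially oriented such that no edge is directed to an extreme point and any two edges directed to a common point are consecutive in the radial order around that point. Then the number of unoriented inner edges is at least $$\frac n2-2-\frac{D(S)+D^*(S)}2\ \ge\ \frac n2-2-D(S).$$ (3) A full subdivision is $\preceq$-maximal if and only if all of its inner edges are locked, and every $\preceq$-maximal full subdivision $S$ satisfies $D(S)\ge\max\{\frac n2-2,\,h-3\}$. (4) Call an inner edge $e$ of a full triangulation $T$ flippable in $T$ if removing $e$ from $T$ creates a convex quadrilateral region, and then let $T[e]$ be $T$ with $e$ replaced by the other diagonal of that quadrilateral. Two distinct flippable edges $e,f$ of $T$ are compatible in $T$ if each remains flippable after the other one is flipped (whether or not $T[e][f]=T[f][e]$). Every full triangulation of $P$ has at least $\max\{\frac n2-2,\,h-3\}$ flippable edges, and for every flippable edge $e$ of a full triangulation $T$ there are at least $\max\{\frac n2-3,\,h-4\}$ edges of $T$ that are compatible with $e$ in $T$.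 -/

import Mathlib

namespace PlanarSubdivision

noncomputable section

/-! The plane is `ℂ`.  A point set is a `Finset ℂ`, and a graph on all of `P` is a
`SimpleGraph P`, whose edges are identified with straight line segments. -/

/-- No three distinct points of `P` lie on a common line. -/
def GeneralPosition (P : Finset ℂ) : Prop :=
  ∀ a ∈ P, ∀ b ∈ P, ∀ c ∈ P, a ≠ b → a ≠ c → b ≠ c → ¬ Collinear ℝ ({a, b, c} : Set ℂ)

/-- The extreme points of `P`: the vertices of the convex hull of `P`. -/
def extPts (P : Finset ℂ) : Set P :=
  {p | (p : ℂ) ∈ Set.extremePoints ℝ (convexHull ℝ (P : Set ℂ))}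

/-- The number `h` of extreme points of `P`. -/
def extNum (P : Finset ℂ) : ℕ := (extPts P).ncard

variable {P : Finset ℂ}

/-- The straight line segment of a (potential) edge. -/
def edgeSeg : Sym2 P → Set ℂ :=
  Sym2.lift ⟨fun p q => segment ℝ (p : ℂ) (q : ℂ), fun p q => segment_symm ℝ (p : ℂ) (q : ℂ)⟩

/-- The edges of the convex hull of `P`: pairs of distinct points whose segment is contained in
the boundary of the convex hull. -/
def hullEdges (P : Finset ℂ) : Set (Sym2 P) :=
  {e | ¬ e.IsDiag ∧ edgeSeg e ⊆ frontier (convexHull ℝ (P : Set ℂ))}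

/-- The inner edges of a graph on `P`: those that are not edges of the convex hull. -/
def innerEdges (G : SimpleGraph P) : Set (Sym2 P) := G.edgeSet \ hullEdges P

/-- A graph is plane if any two of its edges are disjoint except for a common endpoint. -/
def IsPlane (G : SimpleGraph P) : Prop :=
  ∀ e ∈ G.edgeSet, ∀ f ∈ G.edgeSet, e ≠ f →
    edgeSeg e ∩ edgeSeg f ⊆ {x | ∃ p : P, p ∈ e ∧ p ∈ f ∧ (p : ℂ) = x}

/-- The union of all (closed) edges. -/
def edgeUnion (G : SimpleGraph P) : Set ℂ := ⋃ e ∈ G.edgeSet, edgeSeg e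

/-- The regions: the bounded connected components of the complement of the union of the edges. -/
def regions (G : SimpleGraph P) : Set (Set ℂ) :=
  {r | Bornology.IsBounded r ∧
    ∃ x ∈ (edgeUnion G)ᶜ, r = connectedComponentIn (edgeUnion G)ᶜ x}

/-- A full triangulation of `P`: a maximal plane graph on `P`. -/
def IsFullTriangulation (T : SimpleGraph P) : Prop := Maximal IsPlane T

/-- A full subdivision of `P`: a connected plane graph on all of `P` that contains all edges of
the convex hull and all of whose regions are convex. -/
structure IsFullSubdivision (S : SimpleGraph P) : Prop where
  plane : IsPlane S
  connected : S.Connected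
  hull : hullEdges P ⊆ S.edgeSet
  convex : ∀ r ∈ regions S, Convex ℝ r

/-- `S₁` refines `S₂` (and `S₂` coarsens `S₁`), written `S₁ ⪯ S₂`. -/
def Refines (S₁ S₂ : SimpleGraph P) : Prop := S₂.edgeSet ⊆ S₁.edgeSet

/-- `S` is a full subdivision that is maximal with respect to `⪯`. -/
def IsMaximalSubdivision (S : SimpleGraph P) : Prop :=
  IsFullSubdivision S ∧ ∀ S' : SimpleGraph P, IsFullSubdivision S' → Refines S S' → S' = S

/-! ### Slack -/

/-- The number of corners of (the polygon bounding) a convex region. -/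
def corners (r : Set ℂ) : ℕ := (Set.extremePoints ℝ (closure r)).ncard

/-- The slack `k - 3` of a convex region bounded by a `k`-gon. -/
def regionSlack (r : Set ℂ) : ℤ := (corners r : ℤ) - 3

/-- The refined slack `⌈(k - 3) / 2⌉` of a convex region bounded by a `k`-gon. -/
def regionRefinedSlack (r : Set ℂ) : ℤ := ⌈(regionSlack r : ℚ) / 2⌉

/-- The slack of a subdivision: the sum of the slacks of its (finitely many) regions. -/
def slack (S : SimpleGraph P) : ℤ := ∑ᶠ r ∈ regions S, regionSlack r

/-- The refined slack of a subdivision: the sum of the refined slacks of its regions. -/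
def refinedSlack (S : SimpleGraph P) : ℤ := ∑ᶠ r ∈ regions S, regionRefinedSlack r

/-! ### Radial order, locked edges -/

/-- The angle in `(0, 2π]` by which one has to rotate the ray from `p` through `a`
counterclockwise until it reaches the ray from `p` through `b`
(a full turn if the rays coincide). -/
def ccwAngle (p a b : ℂ) : ℝ :=
  toIocMod Real.two_pi_pos 0 (Complex.arg ((b - p) / (a - p)))

/-- The edge `pb` is the counterclockwise successor of the edge `pa` in the radial order of the
edges around `p` (the successor of `pa` is `pa` itself if and only if `p` has degree `1`). -/
def IsNext (G : SimpleGraph P) (p a b : P) : Prop :=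
  G.Adj p a ∧ G.Adj p b ∧ ∀ x, G.Adj p x → ccwAngle p a b ≤ ccwAngle p a x

/-- The edges `pa` and `pb` are consecutive in the radial order around `p`. -/
def Consecutive (G : SimpleGraph P) (p a b : P) : Prop := IsNext G p a b ∨ IsNext G p b a

/-- The edge `pq` is locked at its endpoint `p`: the angle that appears at `p` when `pq` is
removed, between the predecessor `pa` and the successor `pb` of `pq` in the radial order around
`p`, is at least `π`.  (If `p` has degree `1` or `2`, the condition holds automatically.) -/
def LockedAt (G : SimpleGraph P) (p q : P) : Prop :=
  G.Adj p q ∧ ∃ a b, IsNext G p a q ∧ IsNext G p q b ∧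
    Real.pi ≤ ccwAngle p a q + ccwAngle p q b

/-- The edge `e` is locked at one (or both) of its endpoints. -/
def Locked (G : SimpleGraph P) (e : Sym2 P) : Prop := ∃ p q, e = s(p, q) ∧ LockedAt G p q

/-! ### Partially oriented graphs -/

/-- A partial orientation of `G`: some of the edges are oriented to one of their endpoints.
`dir q p` says that `pq` is an edge directed to `p`. -/
structure PartialOrientation (G : SimpleGraph P) where
  dir : P → P → Prop
  adj : ∀ q p, dir q p → G.Adj q p
  asymm : ∀ q p, dir q p → ¬ dir p q

namespace PartialOrientation

variable {G : SimpleGraph P}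

/-- The number of edges directed to `p`. -/
def indegree (O : PartialOrientation G) (p : P) : ℕ := {q | O.dir q p}.ncard

/-- `C_i`: the number of inner (non-extreme) points of indegree `i`. -/
def innerCount (O : PartialOrientation G) (i : ℕ) : ℕ :=
  {p | p ∉ extPts P ∧ O.indegree p = i}.ncard

/-- The unoriented inner edges. -/
def unorientedInner (O : PartialOrientation G) : Set (Sym2 P) :=
  {e | e ∈ innerEdges G ∧ ∀ p q, e = s(p, q) → ¬ O.dir p q}

/-- No edge is directed to an extreme point, and any two edges directed to a common point `p` are
consecutive in the radial order around `p`. -/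
def WellOriented (O : PartialOrientation G) : Prop :=
  (∀ q p, O.dir q p → p ∉ extPts P) ∧
  (∀ p a b, a ≠ b → O.dir a p → O.dir b p → Consecutive G p a b)

end PartialOrientation

/-! ### Flips -/

/-- `e` is an inner edge of `T`, and removing it creates the convex quadrilateral region `Q`. -/
def IsFlipQuad (T : SimpleGraph P) (e : Sym2 P) (Q : Set ℂ) : Prop :=
  e ∈ innerEdges T ∧ Q ∈ regions (T.deleteEdges {e}) ∧ Q ∉ regions T ∧
    Convex ℝ Q ∧ corners Q = 4

/-- `e` is flippable in `T`. -/
def Flippable (T : SimpleGraph P) (e : Sym2 P) : Prop := ∃ Q, IsFlipQuad T e Q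

/-- `e` is flippable in `T` and `T' = T[e]`, i.e. `T'` is obtained from `T` by replacing the
diagonal `e = pq` of the quadrilateral by its other diagonal `ab`. -/
def IsFlip (T : SimpleGraph P) (e : Sym2 P) (T' : SimpleGraph P) : Prop :=
  ∃ Q, IsFlipQuad T e Q ∧ ∃ p q a b : P, e = s(p, q) ∧
    Set.extremePoints ℝ (closure Q) = {(p : ℂ), (q : ℂ), (a : ℂ), (b : ℂ)} ∧
    T'.edgeSet = T.edgeSet \ {e} ∪ {s(a, b)}

/-- `e` and `f` are independently flippable in `T`: `T[e,f]` and `T[f,e]` exist and are equal. -/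
def IndependentlyFlippable (T : SimpleGraph P) (e f : Sym2 P) : Prop :=
  e ≠ f ∧ ∃ Te Tf Tef Tfe, IsFlip T e Te ∧ IsFlip T f Tf ∧ IsFlip Te f Tef ∧ IsFlip Tf e Tfe ∧
    Tef = Tfe

/-- `e` and `f` are weakly independently flippable in `T`: `T[e,f]` and `T[f,e]` exist and are
distinct. -/
def WeaklyIndependentlyFlippable (T : SimpleGraph P) (e f : Sym2 P) : Prop :=
  e ≠ f ∧ ∃ Te Tf Tef Tfe, IsFlip T e Te ∧ IsFlip T f Tf ∧ IsFlip Te f Tef ∧ IsFlip Tf e Tfe ∧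
    Tef ≠ Tfe

/-- `e` and `f` are compatible in `T`. -/
def Compatible (T : SimpleGraph P) (e f : Sym2 P) : Prop :=
  IndependentlyFlippable T e f ∨ WeaklyIndependentlyFlippable T e f

end

end PlanarSubdivision

open PlanarSubdivision

open scoped Topology
open Filter

/-! Counting. A sweep with a generic linear functional gives Euler's formula in the form regions + n
= edges + 1. Direct every edge so that the functional increases. Each such dart is either the
counterclockwise last one at its origin, which happens once for every point except the maximum, or
it has a region on its left whose minimal corner is its origin, which happens once for every region.
The darts bounding a region are all darts but the h hull darts, so summing k - 3 over the regions
gives D + edges + h = 3n - 3 (`slack_add_edges`), hence 3n - 3 - 2h - D inner edges. Counting the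
oriented ones at their heads and substituting n = h + C_0 + C_1 + C_2 + C_3 yields (1).

For (2), indegrees are at most 3, because four edges at a point cannot be pairwise consecutive. Call
a corner of a region good if both its sides are directed to it. An inner point of indegree 3 has
three good corners, one of indegree 2 has one. Adjacent corners of a region are never both good, as
the side between them would be directed both ways; so a k-gon has at most k/2 of them, that is, at
most 1 plus its refined slack. Hence C_2 + 3 C_3 is at most regions + D^*, and this bound on C_3
turns the identity of (1) into (2).

Coarsening. If an inner edge is locked at neither end, the convex regions on its two sides merge to
a convex region and the graph stays connected, so the edge can be deleted. Conversely, an edge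
missing from a coarsening is a diagonal of one of its convex regions, so it is unlocked there, and
being unlocked passes to larger graphs. Thus the maximal subdivisions are those with all inner edges
locked. Two edges locked at a common point are consecutive, and no inner edge is locked at an
extreme point, so orienting each locked inner edge to an end where it is locked satisfies the
hypotheses of (1) and (2). The edges left unoriented are unlocked: there are at least max(n/2 - 2 -
D, h - 3 - D) unlocked edges (`le_ncard_unlockedEdges`). In a maximal subdivision there are none,
which is (3).

Flips. A full triangulation is a full subdivision with D = 0, and its flippable edges are its
unlocked ones. Deleting a flippable e leaves a subdivision with D = 1, each of whose unlocked edges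
is compatible with e. This gives (4).

Geometry. Everything is expressed by signs of determinants. Regions are tied to the edges around a
point by germs: the component seen from a point in a direction, and the component along one side of
an edge. That maximal plane graphs have only triangles as regions is a visibility argument: the
first edge seen from p in some direction forces neighbors of p on both sides of that direction. -/

namespace PlanarSubdivision

noncomputable section

section

variable {P : Finset ℂ}

/-! ### Orientation of vectors and points -/

/-- The cross product of two plane vectors. -/
def cr (u v : ℂ) : ℝ := u.re * v.im - u.im * v.re

/-- Twice the signed area of the triangle `p a b`. -/
def orient (p a b : ℂ) : ℝ := cr (a - p) (b - p)

theorem cr_add_left (u v w : ℂ) : cr (u + v) w = cr u w + cr v w := by simp [cr]; ring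
theorem cr_add_right (u v w : ℂ) : cr u (v + w) = cr u v + cr u w := by simp [cr]; ring
theorem cr_sub_right (u v w : ℂ) : cr u (v - w) = cr u v - cr u w := by simp [cr]; ring
theorem cr_smul_left (t : ℝ) (u v : ℂ) : cr (t • u) v = t * cr u v := by simp [cr]; ring
theorem cr_smul_right (t : ℝ) (u v : ℂ) : cr u (t • v) = t * cr u v := by simp [cr]; ring
theorem cr_neg_left (u v : ℂ) : cr (-u) v = -cr u v := by simp [cr]; ring
theorem cr_neg_right (u v : ℂ) : cr u (-v) = -cr u v := by simp [cr]; ring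
@[simp] theorem cr_self (u : ℂ) : cr u u = 0 := by simp [cr]; ring
@[simp] theorem cr_zero_left (u : ℂ) : cr 0 u = 0 := by simp [cr]
@[simp] theorem cr_zero_right (u : ℂ) : cr u 0 = 0 := by simp [cr]
theorem cr_comm (u v : ℂ) : cr u v = -cr v u := by simp [cr]; ring

theorem cr_I_mul_pos {u : ℂ} (hu : u ≠ 0) : 0 < cr u (Complex.I * u) := by
  have : 0 < Complex.normSq u := Complex.normSq_pos.2 hu
  rw [Complex.normSq_apply] at this
  simp [cr]; linarith

theorem orient_rotate (p a b : ℂ) : orient p a b = orient a b p := by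
  simp [orient, cr]; ring
theorem orient_swap (p a b : ℂ) : orient p a b = -orient p b a := by
  simp [orient, cr]; ring
theorem orient_swap_left (p a b : ℂ) : orient p a b = -orient a p b := by
  simp [orient, cr]; ring
@[simp] theorem orient_self_left (p b : ℂ) : orient p p b = 0 := by simp [orient]
@[simp] theorem orient_self_right (p b : ℂ) : orient p b b = 0 := by simp [orient]
@[simp] theorem orient_self_outer (p b : ℂ) : orient p b p = 0 := by simp [orient]

/-- Cramer's rule without division. -/
theorem cr_mul_vec (a b w : ℂ) : cr a b • w = cr w b • a + cr a w • b := by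
  apply Complex.ext <;> simp [cr] <;> ring

theorem eq_combination_of_cr_ne_zero {u v : ℂ} (h : cr u v ≠ 0) (w : ℂ) :
    w = (cr w v / cr u v) • u + (cr u w / cr u v) • v := by
  rw [div_eq_inv_mul, div_eq_inv_mul, mul_smul, mul_smul, ← smul_add, ← cr_mul_vec, smul_smul,
    inv_mul_cancel₀ h, one_smul]

theorem eq_smul_of_cr_eq_zero {u w : ℂ} (hu : u ≠ 0) (h : cr u w = 0) : ∃ t : ℝ, w = t • u := by
  -- The coefficient of the orthogonal projection of `w` to the line of `u`.
  refine ⟨(u.re * w.re + u.im * w.im) / Complex.normSq u, ?_⟩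
  have hn : 0 < Complex.normSq u := Complex.normSq_pos.2 hu
  rw [cr] at h
  apply Complex.ext
  · simp only [Complex.smul_re, smul_eq_mul]
    rw [div_mul_eq_mul_div, eq_div_iff hn.ne', Complex.normSq_apply]
    linear_combination (-u.im) * h
  · simp only [Complex.smul_im, smul_eq_mul]
    rw [div_mul_eq_mul_div, eq_div_iff hn.ne', Complex.normSq_apply]
    linear_combination u.re * h

/-- The clockwise first vector of a finite set in an open half plane. -/
theorem exists_first {ι : Type*} (A : Finset ι) (hA : A.Nonempty) (f : ι → ℂ) (c : ℂ)
    (h : ∀ x ∈ A, 0 < cr c (f x)) : ∃ b ∈ A, ∀ x ∈ A, 0 ≤ cr (f b) (f x) := by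
  -- The maximized quotient is the cotangent of the angle from `c` to `f x`; these angles lie in
  -- `(0, π)`, where the cotangent decreases.
  obtain ⟨b, hb, hm⟩ := A.exists_max_image
    (fun x => (c.re * (f x).re + c.im * (f x).im) / cr c (f x)) hA
  refine ⟨b, hb, fun x hx => ?_⟩
  have h1 := hm x hx
  rw [div_le_div_iff₀ (h x hx) (h b hb)] at h1
  have hc : 0 < Complex.normSq c := by
    apply Complex.normSq_pos.2
    rintro rfl
    simpa using h b hb
  have key : cr (f b) (f x) * Complex.normSq c =
      (c.re * (f b).re + c.im * (f b).im) * cr c (f x) -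
      (c.re * (f x).re + c.im * (f x).im) * cr c (f b) := by
    rw [Complex.normSq_apply]; simp only [cr]; ring
  by_contra hneg
  push Not at hneg
  nlinarith

theorem exists_last {ι : Type*} (A : Finset ι) (hA : A.Nonempty) (f : ι → ℂ) (c : ℂ)
    (h : ∀ x ∈ A, 0 < cr c (f x)) : ∃ b ∈ A, ∀ x ∈ A, 0 ≤ cr (f x) (f b) := by
  obtain ⟨b, hb, hm⟩ := A.exists_min_image
    (fun x => (c.re * (f x).re + c.im * (f x).im) / cr c (f x)) hA
  refine ⟨b, hb, fun x hx => ?_⟩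
  have h1 := hm x hx
  rw [div_le_div_iff₀ (h b hb) (h x hx)] at h1
  have hc : 0 < Complex.normSq c := by
    apply Complex.normSq_pos.2
    rintro rfl
    simpa using h b hb
  have key : cr (f x) (f b) * Complex.normSq c =
      (c.re * (f x).re + c.im * (f x).im) * cr c (f b) -
      (c.re * (f b).re + c.im * (f b).im) * cr c (f x) := by
    rw [Complex.normSq_apply]; simp only [cr]; ring
  by_contra hneg
  push Not at hneg
  nlinarith

theorem orient_ne_zero (hP : GeneralPosition P) {p a b : P} (h1 : p ≠ a) (h2 : p ≠ b)
    (h3 : a ≠ b) : orient (p : ℂ) a b ≠ 0 := by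
  intro h
  have hne : ((a : ℂ) - p) ≠ 0 := sub_ne_zero.2 (fun h => h1 (Subtype.ext h.symm))
  obtain ⟨t, ht⟩ := eq_smul_of_cr_eq_zero hne h
  refine hP p p.2 a a.2 b b.2 (fun h => h1 (Subtype.ext h)) (fun h => h2 (Subtype.ext h))
    (fun h => h3 (Subtype.ext h)) ?_
  rw [collinear_iff_of_mem (p₀ := (p : ℂ)) (by simp)]
  refine ⟨(a : ℂ) - p, ?_⟩
  rintro x (rfl | rfl | rfl)
  · exact ⟨0, by simp⟩
  · exact ⟨1, by simp⟩
  · exact ⟨t, by rw [← ht]; simp⟩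

theorem eq_of_orient_eq_zero (hP : GeneralPosition P) {p a b : P} (h1 : p ≠ a) (h2 : p ≠ b)
    (h : orient (p : ℂ) a b = 0) : a = b := by
  by_contra h3
  exact orient_ne_zero hP h1 h2 h3 h

theorem coe_sub_ne_zero {p a : P} (h : p ≠ a) : (a : ℂ) - p ≠ 0 :=
  sub_ne_zero.2 (fun h' => h (Subtype.ext h'.symm))

/-! ### Counterclockwise angles -/

theorem ccwAngle_pos (p a b : ℂ) : 0 < ccwAngle p a b :=
  (toIocMod_mem_Ioc Real.two_pi_pos 0 _).1

theorem ccwAngle_le (p a b : ℂ) : ccwAngle p a b ≤ 2 * Real.pi := by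
  have := (toIocMod_mem_Ioc Real.two_pi_pos 0 (Complex.arg ((b - p) / (a - p)))).2
  rw [zero_add] at this
  exact this

theorem coe_ccwAngle (p a b : ℂ) :
    (ccwAngle p a b : Real.Angle) = (Complex.arg ((b - p) / (a - p)) : Real.Angle) := by
  rw [ccwAngle, toIocMod, Real.Angle.angle_eq_iff_two_pi_dvd_sub]
  refine ⟨-toIocDiv Real.two_pi_pos 0 (Complex.arg ((b - p) / (a - p))), ?_⟩
  push_cast
  rw [zsmul_eq_mul]; ring

theorem sin_ccwAngle (p a b : ℂ) :
    Real.sin (ccwAngle p a b) = Real.sin (Complex.arg ((b - p) / (a - p))) := by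
  rw [← Real.Angle.sin_coe, coe_ccwAngle, Real.Angle.sin_coe]

theorem orient_eq_sin {p a b : ℂ} (ha : a ≠ p) (hb : b ≠ p) :
    ∃ k : ℝ, 0 < k ∧ orient p a b = k * Real.sin (ccwAngle p a b) := by
  have ha' := sub_ne_zero.2 ha
  have hb' := sub_ne_zero.2 hb
  have hz : (b - p) / (a - p) ≠ 0 := div_ne_zero hb' ha'
  refine ⟨Complex.normSq (a - p) * ‖(b - p) / (a - p)‖,
    mul_pos (Complex.normSq_pos.2 ha') (norm_pos_iff.2 hz), ?_⟩
  rw [sin_ccwAngle, mul_assoc, Complex.norm_mul_sin_arg, Complex.div_im, orient, cr]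
  have := (Complex.normSq_pos.2 ha').ne'
  field_simp

theorem orient_pos_iff {p a b : ℂ} (ha : a ≠ p) (hb : b ≠ p) :
    0 < orient p a b ↔ ccwAngle p a b < Real.pi := by
  obtain ⟨k, hk, h⟩ := orient_eq_sin ha hb
  rw [h, mul_pos_iff_of_pos_left hk]
  have h0 := ccwAngle_pos p a b
  have h2 := ccwAngle_le p a b
  constructor
  · intro hs
    by_contra hge
    push Not at hge
    have : Real.sin (ccwAngle p a b - Real.pi) ≥ 0 :=
      Real.sin_nonneg_of_nonneg_of_le_pi (by linarith) (by linarith)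
    rw [Real.sin_sub_pi] at this
    linarith
  · exact fun hl => Real.sin_pos_of_pos_of_lt_pi h0 hl

theorem orient_eq_zero_of_ccwAngle {p a b : ℂ} (ha : a ≠ p) (hb : b ≠ p)
    (h : ccwAngle p a b = Real.pi ∨ ccwAngle p a b = 2 * Real.pi) : orient p a b = 0 := by
  obtain ⟨k, hk, h'⟩ := orient_eq_sin ha hb
  rcases h with h | h <;> rw [h', h] <;> simp

/-- Arguments add up only modulo `2π`. Size estimates and `int_eq_zero_of_bounds` turn this
congruence into the equalities used below. -/
theorem ccwAngle_add {p a b c : ℂ} (ha : a ≠ p) (hb : b ≠ p) (hc : c ≠ p) :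
    ∃ n : ℤ, ccwAngle p a b + ccwAngle p b c - ccwAngle p a c = 2 * Real.pi * n := by
  have ha' := sub_ne_zero.2 ha
  have hb' := sub_ne_zero.2 hb
  have hc' := sub_ne_zero.2 hc
  rw [← Real.Angle.angle_eq_iff_two_pi_dvd_sub, Real.Angle.coe_add, coe_ccwAngle, coe_ccwAngle,
    coe_ccwAngle, ← Complex.arg_mul_coe_angle (div_ne_zero hb' ha') (div_ne_zero hc' hb')]
  congr 2
  field_simp

theorem int_eq_zero_of_bounds {x : ℝ} {n : ℤ} (h : x = 2 * Real.pi * n) (h1 : -(2 * Real.pi) < x)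
    (h2 : x < 2 * Real.pi) : x = 0 := by
  have hpi := Real.pi_pos
  have h3 : (n : ℝ) < 1 := by
    by_contra hc; push Not at hc; nlinarith
  have h4 : (-1 : ℝ) < n := by
    by_contra hc; push Not at hc; nlinarith
  have h5 : n < 1 := by exact_mod_cast h3
  have h6 : -1 < n := by exact_mod_cast h4
  have : n = 0 := by omega
  rw [h, this]; simp

theorem ccwAngle_self {p a : ℂ} (ha : a ≠ p) : ccwAngle p a a = 2 * Real.pi := by
  obtain ⟨n, hn⟩ := ccwAngle_add ha ha ha
  have h0 := ccwAngle_pos p a a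
  have h2 := ccwAngle_le p a a
  by_contra hne
  have := int_eq_zero_of_bounds (x := ccwAngle p a a) (n := n) (by linarith) (by linarith)
    (lt_of_le_of_ne h2 hne)
  linarith

theorem ccwAngle_split {p a x q : ℂ} (ha : a ≠ p) (hx : x ≠ p) (hq : q ≠ p)
    (h : ccwAngle p a x < ccwAngle p a q) :
    ccwAngle p a x + ccwAngle p x q = ccwAngle p a q := by
  obtain ⟨n, hn⟩ := ccwAngle_add ha hx hq
  have := int_eq_zero_of_bounds hn
    (by linarith [ccwAngle_pos p a x, ccwAngle_pos p x q, ccwAngle_le p a q])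
    (by linarith [ccwAngle_le p x q])
  linarith

theorem ccwAngle_add_eq {p a x q : ℂ} (ha : a ≠ p) (hx : x ≠ p) (hq : q ≠ p)
    (h : ccwAngle p a x + ccwAngle p x q ≤ 2 * Real.pi) :
    ccwAngle p a x + ccwAngle p x q = ccwAngle p a q := by
  obtain ⟨n, hn⟩ := ccwAngle_add ha hx hq
  have := int_eq_zero_of_bounds hn
    (by linarith [ccwAngle_pos p a x, ccwAngle_pos p x q, ccwAngle_le p a q])
    (by linarith [ccwAngle_pos p a q])
  linarith

theorem ccwAngle_add_swap (hP : GeneralPosition P) {p a b : P} (ha : p ≠ a) (hb : p ≠ b)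
    (hab : a ≠ b) : ccwAngle (p : ℂ) a b + ccwAngle (p : ℂ) b a = 2 * Real.pi := by
  have ha' : (a : ℂ) ≠ p := fun h => ha (Subtype.ext h.symm)
  have hb' : (b : ℂ) ≠ p := fun h => hb (Subtype.ext h.symm)
  obtain ⟨n, hn⟩ := ccwAngle_add ha' hb' ha'
  rw [ccwAngle_self ha'] at hn
  have h1 : ccwAngle (p : ℂ) a b < 2 * Real.pi :=
    lt_of_le_of_ne (ccwAngle_le _ _ _) fun h =>
      orient_ne_zero hP ha hb hab (orient_eq_zero_of_ccwAngle ha' hb' (Or.inr h))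
  have := int_eq_zero_of_bounds hn
    (by linarith [ccwAngle_pos (p : ℂ) a b, ccwAngle_pos (p : ℂ) b a])
    (by linarith [ccwAngle_le (p : ℂ) b a])
  linarith

/-! ### Wedges and locked edges -/

/-- `b` is the counterclockwise successor of `a` around `p`, at an angle less than `π`. -/
structure Wedge (G : SimpleGraph P) (p a b : P) : Prop where
  left : G.Adj p a
  right : G.Adj p b
  pos : 0 < orient (p : ℂ) a b
  empty : ∀ x, G.Adj p x → 0 < orient (p : ℂ) a x → ¬ 0 < orient (p : ℂ) x b

/-- The edge `pq` lies strictly inside an angle less than `π` between two other edges at `p`. -/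
def Unlocked (G : SimpleGraph P) (p q : P) : Prop :=
  ∃ y x, G.Adj p y ∧ G.Adj p x ∧ 0 < orient (p : ℂ) y q ∧ 0 < orient (p : ℂ) q x ∧
    0 < orient (p : ℂ) y x

variable {G : SimpleGraph P}

theorem coe_ne_of_adj {p a : P} (h : G.Adj p a) : (a : ℂ) ≠ p :=
  fun h' => h.ne (Subtype.ext h'.symm)

theorem IsNext.wedge {p a b : P} (h : IsNext G p a b)
    (hx : ∃ x, G.Adj p x ∧ 0 < orient (p : ℂ) a x) : Wedge G p a b := by
  obtain ⟨ha, hb, hmin⟩ := h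
  have ha' := coe_ne_of_adj ha
  have hb' := coe_ne_of_adj hb
  obtain ⟨x, hx, hxo⟩ := hx
  refine ⟨ha, hb, (orient_pos_iff ha' hb').2 ((hmin x hx).trans_lt
    ((orient_pos_iff ha' (coe_ne_of_adj hx)).1 hxo)), fun y hy h1 h2 => ?_⟩
  have hy' := coe_ne_of_adj hy
  rw [orient_pos_iff ha' hy'] at h1
  rw [orient_pos_iff hy' hb'] at h2
  have := ccwAngle_add_eq ha' hy' hb' (by linarith)
  linarith [hmin y hy, ccwAngle_pos (p : ℂ) y b]

theorem IsNext.ccwAngle_le {p a q y : P} (h : IsNext G p a q) (hy : G.Adj p y) :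
    ccwAngle (p : ℂ) a q ≤ ccwAngle (p : ℂ) y q := by
  obtain ⟨ha, hq, hmin⟩ := h
  by_contra hlt
  push Not at hlt
  obtain ⟨n, hn⟩ := ccwAngle_add (coe_ne_of_adj ha) (coe_ne_of_adj hy) (coe_ne_of_adj hq)
  have h1 := hmin y hy
  have h2 := PlanarSubdivision.ccwAngle_le (p : ℂ) a y
  have h3 := ccwAngle_pos (p : ℂ) y q
  have := int_eq_zero_of_bounds hn (by linarith [Real.pi_pos]) (by linarith)
  linarith

/-- The predecessor and the successor of `q` form the smallest angles with it, so some two neighbors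
enclose `q` in an angle below `π` exactly if these two do. The determinant form makes the low
degrees unexceptional and is visibly monotone in the graph. -/
theorem lockedAt_iff {p q : P} (hq : G.Adj p q) : LockedAt G p q ↔ ¬ Unlocked G p q := by
  classical
  have hq' := coe_ne_of_adj hq
  constructor
  · rintro ⟨-, a, b, ha, hb, hab⟩ ⟨y, x, hy, hx, h1, h2, h3⟩
    have hy' := coe_ne_of_adj hy
    have hx' := coe_ne_of_adj hx
    rw [orient_pos_iff hy' hq'] at h1
    rw [orient_pos_iff hq' hx'] at h2
    rw [orient_pos_iff hy' hx'] at h3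
    have := ccwAngle_add_eq hy' hq' hx' (by linarith)
    linarith [ha.ccwAngle_le hy, hb.2.2 x hx]
  · intro h
    have hne : (Finset.univ.filter fun x => G.Adj p x).Nonempty := ⟨q, by simpa using hq⟩
    obtain ⟨a, ha, hamin⟩ := Finset.exists_min_image _ (fun x : P => ccwAngle (p : ℂ) x q) hne
    obtain ⟨b, hb, hbmin⟩ := Finset.exists_min_image _ (fun x : P => ccwAngle (p : ℂ) q x) hne
    simp only [Finset.mem_filter, Finset.mem_univ, true_and] at ha hb hamin hbmin
    have ha' := coe_ne_of_adj ha
    have hb' := coe_ne_of_adj hb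
    refine ⟨hq, a, b, ⟨ha, hq, fun x hx => ?_⟩, ⟨hq, hb, hbmin⟩, ?_⟩
    · by_contra hlt
      push Not at hlt
      have := ccwAngle_split ha' (coe_ne_of_adj hx) hq' hlt
      linarith [hamin x hx, ccwAngle_pos (p : ℂ) a x]
    · by_contra hlt
      push Not at hlt
      have hs := ccwAngle_add_eq ha' hq' hb' (by linarith [Real.pi_pos])
      have h1 := ccwAngle_pos (p : ℂ) a q
      have h2 := ccwAngle_pos (p : ℂ) q b
      exact h ⟨a, b, ha, hb, (orient_pos_iff ha' hq').2 (by linarith),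
        (orient_pos_iff hq' hb').2 (by linarith), (orient_pos_iff ha' hb').2 (by linarith)⟩

theorem Unlocked.mono {G' : SimpleGraph P} (hle : G ≤ G') {p q : P} (h : Unlocked G p q) :
    Unlocked G' p q := by
  obtain ⟨y, x, hy, hx, h⟩ := h
  exact ⟨y, x, hle hy, hle hx, h⟩

/-- If `a` and `b` are not consecutive, the gaps around them fit into one full turn without overlap.
Each has size at least `π`, so both are exactly `π`; then `a₁` and `a₂` are collinear with `p`,
hence equal by general position, and the gap would be a full turn. -/
theorem LockedAt.consecutive (hP : GeneralPosition P) {p a b : P} (hab : a ≠ b)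
    (ha : LockedAt G p a) (hb : LockedAt G p b) : Consecutive G p a b := by
  obtain ⟨hpa, a₁, a₂, h1, h2, hsa⟩ := ha
  obtain ⟨hpb, b₁, b₂, h3, h4, hsb⟩ := hb
  by_contra hcon
  have hna : a₂ ≠ b := by rintro rfl; exact hcon (Or.inl h2)
  have hnb : b₂ ≠ a := by rintro rfl; exact hcon (Or.inr h4)
  have ca := coe_ne_of_adj hpa
  have cb := coe_ne_of_adj hpb
  have ca1 := coe_ne_of_adj h1.1
  have ca2 := coe_ne_of_adj h2.2.1
  have cb2 := coe_ne_of_adj h4.2.1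
  have strict : ∀ {a a₂ b : P}, G.Adj p a → IsNext G p a a₂ → G.Adj p b → a₂ ≠ b →
      ccwAngle (p : ℂ) a a₂ < ccwAngle (p : ℂ) a b := by
    intro a a₂ b ha h hb hne
    refine lt_of_le_of_ne (h.2.2 b hb) fun he => ?_
    obtain ⟨n, hn⟩ := ccwAngle_add (coe_ne_of_adj ha) (coe_ne_of_adj h.2.1) (coe_ne_of_adj hb)
    have h2 : ccwAngle (p : ℂ) a₂ b = 2 * Real.pi := by
      by_contra hne
      have h3 := PlanarSubdivision.ccwAngle_le (p : ℂ) a₂ b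
      have h4 := ccwAngle_pos (p : ℂ) a₂ b
      have := int_eq_zero_of_bounds (x := ccwAngle (p : ℂ) a₂ b) (n := n) (by linarith)
        (by linarith) (lt_of_le_of_ne h3 hne)
      linarith
    exact orient_ne_zero hP h.2.1.ne hb.ne hne (orient_eq_zero_of_ccwAngle
      (coe_ne_of_adj h.2.1) (coe_ne_of_adj hb) (Or.inr h2))
  have e1 := ccwAngle_split ca ca2 cb (strict hpa h2 hpb hna)
  have e2 := ccwAngle_split cb cb2 ca (strict hpb h4 hpa hnb)
  have e3 := h3.ccwAngle_le h2.2.1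
  have e4 := h1.ccwAngle_le h4.2.1
  have e5 := ccwAngle_add_swap hP hpa.ne hpb.ne hab
  have e6 : ccwAngle (p : ℂ) a₁ a + ccwAngle (p : ℂ) a a₂ = Real.pi := by linarith
  have e7 := ccwAngle_add_eq ca1 ca ca2 (by linarith [Real.pi_pos])
  have e8 : a₁ = a₂ := eq_of_orient_eq_zero hP h1.1.ne h2.2.1.ne
    (orient_eq_zero_of_ccwAngle ca1 ca2 (Or.inl (by linarith)))
  subst e8
  rw [ccwAngle_self ca1] at e7
  linarith [Real.pi_pos]

theorem Wedge.right_unique (hP : GeneralPosition P) {p a b b' : P} (h : Wedge G p a b)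
    (h' : Wedge G p a b') : b = b' := by
  refine eq_of_orient_eq_zero hP h.right.ne h'.right.ne (le_antisymm ?_ ?_)
  · exact not_lt.1 (h'.empty b h.right h.pos)
  · rw [orient_swap]; linarith [not_lt.1 (h.empty b' h'.right h'.pos)]

theorem Wedge.left_unique (hP : GeneralPosition P) {p a a' b : P} (h : Wedge G p a b)
    (h' : Wedge G p a' b) : a = a' := by
  refine eq_of_orient_eq_zero hP h.left.ne h'.left.ne (le_antisymm ?_ ?_)
  · by_contra hc; exact h.empty a' h'.left (not_le.1 hc) h'.pos
  · by_contra hc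
    exact h'.empty a h.left (by rw [orient_swap]; linarith) h.pos

theorem exists_wedge_left {p a x : P} (ha : G.Adj p a) (hx : G.Adj p x)
    (h : 0 < orient (p : ℂ) a x) : ∃ b, Wedge G p a b := by
  classical
  obtain ⟨b, hb, hmin⟩ := exists_first
    (Finset.univ.filter fun x : P => G.Adj p x ∧ 0 < orient (p : ℂ) a x) ⟨x, by simp [hx, h]⟩
    (fun x => (x : ℂ) - p) ((a : ℂ) - p) (by
      intro y hy
      simp only [Finset.mem_filter, Finset.mem_univ, true_and] at hy
      exact hy.2)
  simp only [Finset.mem_filter, Finset.mem_univ, true_and] at hb hmin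
  refine ⟨b, ha, hb.1, hb.2, fun y hy h1 h2 => ?_⟩
  have h3 : 0 ≤ orient (p : ℂ) b y := hmin y ⟨hy, h1⟩
  rw [orient_swap] at h3
  linarith

theorem exists_wedge_right {p b x : P} (hb : G.Adj p b) (hx : G.Adj p x)
    (h : 0 < orient (p : ℂ) x b) : ∃ a, Wedge G p a b := by
  classical
  obtain ⟨a, ha, hmin⟩ := exists_last
    (Finset.univ.filter fun x : P => G.Adj p x ∧ 0 < orient (p : ℂ) x b) ⟨x, by simp [hx, h]⟩
    (fun x => (x : ℂ) - p) (-((b : ℂ) - p)) (by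
      intro y hy
      simp only [Finset.mem_filter, Finset.mem_univ, true_and] at hy
      rw [cr_neg_left, ← cr_comm]; exact hy.2)
  simp only [Finset.mem_filter, Finset.mem_univ, true_and] at ha hmin
  refine ⟨a, ha.1, hb, ha.2, fun y hy h1 h2 => ?_⟩
  have h3 : 0 ≤ orient (p : ℂ) y a := hmin y ⟨hy, h2⟩
  rw [orient_swap] at h3
  linarith

end

section

variable {P : Finset ℂ} {G : SimpleGraph P}

/-! ### Edges as segments -/

@[simp] theorem edgeSeg_mk (p q : P) : edgeSeg s(p, q) = segment ℝ (p : ℂ) q := rfl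

theorem isCompact_segment_complex (x y : ℂ) : IsCompact (segment ℝ x y) := by
  rw [segment_eq_image_lineMap]
  exact isCompact_Icc.image (by fun_prop)

theorem isCompact_edgeSeg (e : Sym2 P) : IsCompact (edgeSeg e) := by
  induction e using Sym2.ind with
  | _ p q => exact isCompact_segment_complex _ _

theorem isClosed_biUnion_edgeSeg (E : Set (Sym2 P)) : IsClosed (⋃ e ∈ E, edgeSeg e) :=
  (Set.toFinite E).isClosed_biUnion fun e _ => (isCompact_edgeSeg e).isClosed

theorem isOpen_compl_edgeUnion (G : SimpleGraph P) : IsOpen (edgeUnion G)ᶜ :=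
  (isClosed_biUnion_edgeSeg G.edgeSet).isOpen_compl

theorem mem_edgeUnion {z : ℂ} : z ∈ edgeUnion G ↔ ∃ e ∈ G.edgeSet, z ∈ edgeSeg e := by
  simp [edgeUnion]

theorem cr_eq_zero_of_mem_segment {p a z : ℂ} (h : z ∈ segment ℝ p a) : cr (a - p) (z - p) = 0 := by
  rw [segment_eq_image'] at h
  obtain ⟨t, -, rfl⟩ := h
  rw [add_sub_cancel_left, cr_smul_right, cr_self, mul_zero]

theorem mem_of_mem_edgeSeg (hP : GeneralPosition P) {p : P} {e : Sym2 P} (he : ¬ e.IsDiag)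
    (h : (p : ℂ) ∈ edgeSeg e) : p ∈ e := by
  induction e using Sym2.ind with
  | _ a b =>
    rw [Sym2.mem_iff]
    by_contra hne
    push Not at hne
    exact orient_ne_zero hP he (Ne.symm hne.1) (Ne.symm hne.2) (cr_eq_zero_of_mem_segment h)

theorem mem_edge_of_mem_edgeSeg (hP : GeneralPosition P) {p : P} {e : Sym2 P} (he : e ∈ G.edgeSet)
    (h : (p : ℂ) ∈ edgeSeg e) : p ∈ e :=
  mem_of_mem_edgeSeg hP (G.not_isDiag_of_mem_edgeSet he) h

theorem ne_of_mem_openSegment {p a z : ℂ} (h : p ≠ a) (hz : z ∈ openSegment ℝ p a) :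
    z ≠ p ∧ z ≠ a := by
  constructor
  · rintro rfl; exact h (left_mem_openSegment_iff.1 hz)
  · rintro rfl; exact h (right_mem_openSegment_iff.1 hz)

theorem notMem_of_mem_openSegment (hG : IsPlane G) {p a : P} (h : G.Adj p a) {z : ℂ}
    (hz : z ∈ openSegment ℝ (p : ℂ) a) {f : Sym2 P} (hf : f ∈ G.edgeSet) (hne : f ≠ s(p, a)) :
    z ∉ edgeSeg f := by
  intro hzf
  obtain ⟨q, hq, -, rfl⟩ := hG s(p, a) h f hf hne.symm ⟨openSegment_subset_segment _ _ _ hz, hzf⟩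
  obtain ⟨h1, h2⟩ := ne_of_mem_openSegment (coe_ne_of_adj h).symm hz
  rcases Sym2.mem_iff.1 hq with rfl | rfl
  · exact h1 rfl
  · exact h2 rfl

theorem exists_of_mem_edgeSeg {p : P} {e : Sym2 P} (he : e ∈ G.edgeSet) (hp : p ∈ e) {w : ℂ}
    (hw : w ∈ edgeSeg e) : ∃ x, e = s(p, x) ∧ G.Adj p x ∧
      ∃ c : ℝ, 0 ≤ c ∧ c ≤ 1 ∧ w - p = c • ((x : ℂ) - p) := by
  obtain ⟨x, rfl⟩ := hp
  rw [edgeSeg_mk, segment_eq_image'] at hw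
  obtain ⟨c, hc, rfl⟩ := hw
  exact ⟨x, rfl, he, c, hc.1, hc.2, by simp⟩

/-! ### Connected components of the complement of the edges -/

/-- `r` is a (possibly unbounded) connected component of the complement of the edges. -/
def IsComp (G : SimpleGraph P) (r : Set ℂ) : Prop :=
  ∃ x ∈ (edgeUnion G)ᶜ, r = connectedComponentIn (edgeUnion G)ᶜ x

namespace IsComp

variable {r r' : Set ℂ}

theorem subset (h : IsComp G r) : r ⊆ (edgeUnion G)ᶜ := by
  obtain ⟨x, hx, rfl⟩ := h; exact connectedComponentIn_subset _ _

theorem isOpen (h : IsComp G r) : IsOpen r := by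
  obtain ⟨x, hx, rfl⟩ := h; exact (isOpen_compl_edgeUnion G).connectedComponentIn

theorem nonempty (h : IsComp G r) : r.Nonempty := by
  obtain ⟨x, hx, rfl⟩ := h; exact ⟨x, mem_connectedComponentIn hx⟩

theorem isPreconnected (h : IsComp G r) : IsPreconnected r := by
  obtain ⟨x, hx, rfl⟩ := h; exact isPreconnected_connectedComponentIn

theorem subset_of_isPreconnected (h : IsComp G r) {N : Set ℂ} (hN : IsPreconnected N)
    (hU : N ⊆ (edgeUnion G)ᶜ) {z : ℂ} (hz : z ∈ N) (hzr : z ∈ r) : N ⊆ r := by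
  obtain ⟨x, hx, rfl⟩ := h
  rw [connectedComponentIn_eq hzr]
  exact hN.subset_connectedComponentIn hz hU

theorem eq_of_mem (h : IsComp G r) (h' : IsComp G r') {z : ℂ} (hz : z ∈ r) (hz' : z ∈ r') :
    r = r' :=
  (h'.subset_of_isPreconnected h.isPreconnected h.subset hz hz').antisymm
    (h.subset_of_isPreconnected h'.isPreconnected h'.subset hz' hz)

theorem closure_inter_subset (h : IsComp G r) : closure r ∩ (edgeUnion G)ᶜ ⊆ r := by
  rintro z ⟨hz, hzU⟩
  have hc : IsComp G (connectedComponentIn (edgeUnion G)ᶜ z) := ⟨z, hzU, rfl⟩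
  have hzc := mem_connectedComponentIn hzU
  obtain ⟨y, hy, hyr⟩ := mem_closure_iff.1 hz _ hc.isOpen hzc
  rw [h.eq_of_mem hc hyr hy]
  exact hzc

end IsComp

theorem exists_isComp_superset {N : Set ℂ} (hN : IsPreconnected N) (hne : N.Nonempty)
    (hU : N ⊆ (edgeUnion G)ᶜ) : ∃ r, IsComp G r ∧ N ⊆ r := by
  obtain ⟨z, hz⟩ := hne
  exact ⟨_, ⟨z, hU hz, rfl⟩, hN.subset_connectedComponentIn hz hU⟩

theorem isComp_of_isOpen {M : Set ℂ} (ho : IsOpen M) (hM : IsPreconnected M) (hne : M.Nonempty)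
    (hU : M ⊆ (edgeUnion G)ᶜ) (hc : closure M ∩ (edgeUnion G)ᶜ ⊆ M) : IsComp G M := by
  obtain ⟨z, hz⟩ := hne
  refine ⟨z, hU hz, (hM.subset_connectedComponentIn hz hU).antisymm ?_⟩
  refine isPreconnected_connectedComponentIn.subset_left_of_subset_union ho
    (isClosed_closure (s := M)).isOpen_compl ?_ ?_ ⟨z, mem_connectedComponentIn (hU hz), hz⟩
  · exact Set.disjoint_compl_right_iff_subset.2 subset_closure
  · intro w hw
    by_cases hwc : w ∈ closure M
    · exact Or.inl (hc ⟨hwc, connectedComponentIn_subset _ _ hw⟩)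
    · exact Or.inr hwc

/-! ### Germs of components at points -/

/-- The points near `p` in direction `u` belong to `r`. -/
def Ger (r : Set ℂ) (p u : ℂ) : Prop := ∀ᶠ ε : ℝ in 𝓝[>] 0, p + ε • u ∈ r

/-- `r` lies on one side (the left side for `σ > 0`) of the edge `pa` along the whole edge. -/
def IsSide (σ : ℝ) (r : Set ℂ) (p a : ℂ) : Prop :=
  ∀ z ∈ openSegment ℝ p a, ∀ᶠ w in 𝓝 z, 0 < σ * cr (a - p) (w - z) → w ∈ r

theorem tendsto_ray (p u : ℂ) : Tendsto (fun ε : ℝ => p + ε • u) (𝓝[>] 0) (𝓝 p) := by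
  have : Continuous (fun ε : ℝ => p + ε • u) := by fun_prop
  have h := this.tendsto 0
  rw [zero_smul, add_zero] at h
  exact h.mono_left nhdsWithin_le_nhds

theorem Ger.mem_closure {r : Set ℂ} {p u : ℂ} (h : Ger r p u) : p ∈ closure r :=
  mem_closure_of_tendsto (tendsto_ray p u) h

theorem Ger.exists {r : Set ℂ} {p u : ℂ} (h : Ger r p u) : ∃ ε : ℝ, 0 < ε ∧ p + ε • u ∈ r := by
  obtain ⟨ε, h1, h2⟩ := (h.and self_mem_nhdsWithin).exists
  exact ⟨ε, h2, h1⟩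

theorem ger_of_convex {r : Set ℂ} (hr : IsOpen r) (hc : Convex ℝ r) {p z : ℂ}
    (hp : p ∈ closure r) (hz : z ∈ r) : Ger r p (z - p) := by
  have h1 : ∀ᶠ ε : ℝ in 𝓝[>] 0, ε < 1 := nhdsWithin_le_nhds (Iio_mem_nhds one_pos)
  filter_upwards [h1, self_mem_nhdsWithin] with ε hε hε0
  have := hc.openSegment_closure_interior_subset_interior hp (by rwa [hr.interior_eq])
  rw [hr.interior_eq] at this
  apply this
  rw [openSegment_eq_image']
  exact ⟨ε, ⟨hε0, hε⟩, rfl⟩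

theorem IsSide.ger {σ : ℝ} {r : Set ℂ} {p a z v : ℂ} (h : IsSide σ r p a)
    (hz : z ∈ openSegment ℝ p a) (hv : 0 < σ * cr (a - p) v) : Ger r z v := by
  filter_upwards [(tendsto_ray z v).eventually (h z hz), self_mem_nhdsWithin] with ε h1 h2
  apply h1
  rw [add_sub_cancel_left, cr_smul_right]
  have := mul_pos (Set.mem_Ioi.1 h2) hv
  linarith

theorem IsSide.swap {σ : ℝ} {r : Set ℂ} {p a : ℂ} (h : IsSide σ r p a) : IsSide (-σ) r a p := by
  intro z hz
  rw [openSegment_symm] at hz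
  filter_upwards [h z hz] with w hw hpos
  apply hw
  rw [← neg_sub a p, cr_neg_left] at hpos
  linarith

theorem isSide_swap_iff {σ : ℝ} {r : Set ℂ} {p a : ℂ} : IsSide σ r p a ↔ IsSide (-σ) r a p :=
  ⟨fun h => h.swap, fun h => by simpa using h.swap⟩

theorem convex_cr_pos (σ : ℝ) (c p : ℂ) : Convex ℝ {w : ℂ | 0 < σ * cr c (w - p)} := by
  intro x hx y hy s t hs ht hst
  simp only [Set.mem_ofPred_eq] at *
  have : σ * cr c (s • x + t • y - p) = s * (σ * cr c (x - p)) + t * (σ * cr c (y - p)) := by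
    obtain rfl : t = 1 - s := by linarith
    simp [cr]; ring
  rw [this]
  rcases hs.eq_or_lt with rfl | hs
  · have : t = 1 := by linarith
    subst this; simpa using hy
  · exact add_pos_of_pos_of_nonneg (mul_pos hs hx) (mul_nonneg ht hy.le)

theorem convex_cr_nonneg (σ : ℝ) (c p : ℂ) : Convex ℝ {w : ℂ | 0 ≤ σ * cr c (w - p)} := by
  intro x hx y hy s t hs ht hst
  simp only [Set.mem_ofPred_eq] at *
  have : σ * cr c (s • x + t • y - p) = s * (σ * cr c (x - p)) + t * (σ * cr c (y - p)) := by
    obtain rfl : t = 1 - s := by linarith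
    simp [cr]; ring
  rw [this]
  positivity

theorem continuous_cr (c p : ℂ) : Continuous fun w : ℂ => cr c (w - p) := by
  unfold cr; fun_prop

theorem cr_sub_of_mem_segment {p a z : ℂ} (hz : z ∈ segment ℝ p a) (w : ℂ) :
    cr (a - p) (w - z) = cr (a - p) (w - p) := by
  have : w - z = (w - p) - (z - p) := by ring
  rw [this, cr_sub_right, cr_eq_zero_of_mem_segment hz, sub_zero]

/-- A compact piece of an open edge has positive distance from all other edges. One half of a thin
neighborhood of it is therefore convex and free of edges, and it joins the same side of the edge at
`z₀` and at `z₁`. -/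
theorem exists_strip (hG : IsPlane G) {p a : P} (h : G.Adj p a) (σ : ℝ) {z₀ z₁ : ℂ}
    (h0 : z₀ ∈ openSegment ℝ (p : ℂ) a) (h1 : z₁ ∈ openSegment ℝ (p : ℂ) a) :
    ∃ N : Set ℂ, Convex ℝ N ∧ N ⊆ (edgeUnion G)ᶜ ∧
      (∀ᶠ w in 𝓝 z₀, 0 < σ * cr ((a : ℂ) - p) (w - z₀) → w ∈ N) ∧
      (∀ᶠ w in 𝓝 z₁, 0 < σ * cr ((a : ℂ) - p) (w - z₁) → w ∈ N) := by
  set F := ⋃ e ∈ G.edgeSet \ {s(p, a)}, edgeSeg e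
  have hK : segment ℝ z₀ z₁ ⊆ openSegment ℝ (p : ℂ) a :=
    (convex_openSegment (p : ℂ) (a : ℂ)).segment_subset h0 h1
  obtain ⟨δ, hδ, hsub⟩ := (isCompact_segment_complex z₀ z₁).exists_thickening_subset_open
    (isClosed_biUnion_edgeSeg (G.edgeSet \ {s(p, a)})).isOpen_compl (by
      intro z hz hzF
      simp only [Set.mem_iUnion] at hzF
      obtain ⟨e, he, hze⟩ := hzF
      exact notMem_of_mem_openSegment hG h (hK hz) he.1 he.2 hze)
  refine ⟨Metric.thickening δ (segment ℝ z₀ z₁) ∩ {w | 0 < σ * cr ((a : ℂ) - p) (w - p)},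
    ((convex_segment z₀ z₁).thickening δ).inter (convex_cr_pos _ _ _), ?_, ?_, ?_⟩
  · rintro w ⟨hw1, hw2⟩ hwU
    obtain ⟨e, he, hwe⟩ := mem_edgeUnion.1 hwU
    by_cases hep : e = s(p, a)
    · subst hep
      have := cr_eq_zero_of_mem_segment hwe
      simp [this] at hw2
    · apply hsub hw1
      simp only [Set.mem_iUnion]
      exact ⟨e, ⟨he, hep⟩, hwe⟩
  · filter_upwards [Metric.isOpen_thickening.mem_nhds
      (Metric.self_subset_thickening hδ _ (left_mem_segment ℝ z₀ z₁))] with w hw hpos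
    rw [cr_sub_of_mem_segment (openSegment_subset_segment _ _ _ h0)] at hpos
    exact ⟨hw, hpos⟩
  · filter_upwards [Metric.isOpen_thickening.mem_nhds
      (Metric.self_subset_thickening hδ _ (right_mem_segment ℝ z₀ z₁))] with w hw hpos
    rw [cr_sub_of_mem_segment (openSegment_subset_segment _ _ _ h1)] at hpos
    exact ⟨hw, hpos⟩

theorem eventually_ray_of_side {σ : ℝ} {p a z v : ℂ} {N : Set ℂ}
    (h : ∀ᶠ w in 𝓝 z, 0 < σ * cr (a - p) (w - z) → w ∈ N) (hv : 0 < σ * cr (a - p) v) :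
    Ger N z v := by
  filter_upwards [(tendsto_ray z v).eventually h, self_mem_nhdsWithin] with ε h1 h2
  apply h1
  rw [add_sub_cancel_left, cr_smul_right]
  have := mul_pos (Set.mem_Ioi.1 h2) hv
  linarith

/-- The component beside an edge does not change along the edge, so one germ determines it
everywhere. -/
theorem IsComp.isSide_of_ger {r : Set ℂ} (hr : IsComp G r) (hG : IsPlane G) {p a : P}
    (h : G.Adj p a) {σ : ℝ} {z v : ℂ} (hz : z ∈ openSegment ℝ (p : ℂ) a)
    (hv : 0 < σ * cr ((a : ℂ) - p) v) (hg : Ger r z v) : IsSide σ r p a := by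
  intro z₁ hz₁
  obtain ⟨N, hc, hU, h0, h1⟩ := exists_strip hG h σ hz hz₁
  obtain ⟨ε, h3, h4⟩ := ((eventually_ray_of_side h0 hv).and hg).exists
  have := hr.subset_of_isPreconnected hc.isPreconnected hU h3 h4
  filter_upwards [h1] with w hw hpos using this (hw hpos)

theorem half_mem_openSegment (p a : ℂ) : p + (1 / 2 : ℝ) • (a - p) ∈ openSegment ℝ p a := by
  rw [openSegment_eq_image']
  exact ⟨1 / 2, by norm_num, rfl⟩

theorem exists_isSide (hG : IsPlane G) {p a : P} (h : G.Adj p a) {σ : ℝ} (hσ : σ ≠ 0) :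
    ∃ r, IsComp G r ∧ IsSide σ r p a := by
  have hm := half_mem_openSegment (p : ℂ) a
  obtain ⟨N, hc, hU, h0, -⟩ := exists_strip hG h σ hm hm
  have hv : 0 < σ * cr ((a : ℂ) - p) (σ • (Complex.I * ((a : ℂ) - p))) := by
    rw [cr_smul_right, ← mul_assoc]
    exact mul_pos (mul_self_pos.2 hσ) (cr_I_mul_pos (coe_sub_ne_zero h.ne))
  have hg := eventually_ray_of_side h0 hv
  obtain ⟨ε, -, h3⟩ := hg.exists
  obtain ⟨r, hr, hNr⟩ := exists_isComp_superset hc.isPreconnected ⟨_, h3⟩ hU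
  exact ⟨r, hr, hr.isSide_of_ger hG h hm hv (hg.mono fun ε h => hNr h)⟩

theorem exists_side_vector {u : ℂ} (hu : u ≠ 0) {σ : ℝ} (hσ : σ ≠ 0) : ∃ v, 0 < σ * cr u v := by
  refine ⟨σ • (Complex.I * u), ?_⟩
  rw [cr_smul_right, ← mul_assoc]
  exact mul_pos (mul_self_pos.2 hσ) (cr_I_mul_pos hu)

theorem IsSide.mem_closure {σ : ℝ} (hσ : σ ≠ 0) {r : Set ℂ} {p a : ℂ} (hpa : p ≠ a)
    (h : IsSide σ r p a) {z : ℂ} (hz : z ∈ openSegment ℝ p a) : z ∈ closure r := by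
  obtain ⟨v, hv⟩ := exists_side_vector (sub_ne_zero.2 hpa.symm) hσ
  exact (h.ger hz hv).mem_closure

theorem IsSide.segment_subset_closure {σ : ℝ} (hσ : σ ≠ 0) {r : Set ℂ} {p a : ℂ} (hpa : p ≠ a)
    (h : IsSide σ r p a) : segment ℝ p a ⊆ closure r := by
  rw [← closure_openSegment]
  exact closure_minimal (fun z hz => h.mem_closure hσ hpa hz) isClosed_closure

theorem IsSide.unique {σ : ℝ} (hσ : σ ≠ 0) {r r' : Set ℂ} (hr : IsComp G r) (hr' : IsComp G r')
    {p a : ℂ} (hpa : p ≠ a) (h : IsSide σ r p a) (h' : IsSide σ r' p a) : r = r' := by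
  obtain ⟨v, hv⟩ := exists_side_vector (sub_ne_zero.2 hpa.symm) hσ
  have hm := half_mem_openSegment p a
  obtain ⟨ε, h1, h2⟩ := ((h.ger hm hv).and (h'.ger hm hv)).exists
  exact hr.eq_of_mem hr' h1 h2

/-- Links the view from the vertex `p` with the view from the middle of the edge `pa`. By `hno`, the
neighbors on the relevant side of `pa` all lie beyond `u`, so the part of a thin neighborhood of
half the edge that lies between the directions `a` and `u` meets no edge. -/
theorem exists_sector (hP : GeneralPosition P) (hG : IsPlane G) {p a : P} (h : G.Adj p a) {σ : ℝ}
    {u : ℂ} (hu : 0 < σ * cr ((a : ℂ) - p) u)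
    (hno : ∀ x, G.Adj p x → 0 < σ * cr ((a : ℂ) - p) ((x : ℂ) - p) →
      σ * cr ((x : ℂ) - p) u < 0) :
    ∃ N : Set ℂ, Convex ℝ N ∧ N ⊆ (edgeUnion G)ᶜ ∧ Ger N p u ∧
      Ger N ((p : ℂ) + (1 / 2 : ℝ) • ((a : ℂ) - p)) u := by
  set m := (p : ℂ) + (1 / 2 : ℝ) • ((a : ℂ) - p) with hm
  set E : Set (Sym2 P) := {e ∈ G.edgeSet | p ∉ e}
  have hms := half_mem_openSegment (p : ℂ) a
  obtain ⟨δ, hδ, hsub⟩ := (isCompact_segment_complex (p : ℂ) m).exists_thickening_subset_open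
    (isClosed_biUnion_edgeSeg E).isOpen_compl (by
      intro z hz hzF
      simp only [Set.mem_iUnion] at hzF
      obtain ⟨e, he, hze⟩ := hzF
      by_cases hzp : z = p
      · subst hzp
        exact he.2 (mem_edge_of_mem_edgeSeg hP he.1 hze)
      · have hz' : z ∈ openSegment ℝ (p : ℂ) a := by
          rw [segment_eq_image'] at hz
          obtain ⟨t, ht, rfl⟩ := hz
          rw [openSegment_eq_image']
          refine ⟨t * (1 / 2), ⟨?_, by linarith [ht.2]⟩, by simp [hm, mul_assoc]⟩
          have : t ≠ 0 := by rintro rfl; simp at hzp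
          have := lt_of_le_of_ne ht.1 this.symm
          linarith
        refine notMem_of_mem_openSegment hG h hz' he.1 ?_ hze
        rintro rfl
        exact he.2 (Sym2.mem_mk_left _ _))
  refine ⟨Metric.thickening δ (segment ℝ (p : ℂ) m) ∩ ({w | 0 < σ * cr ((a : ℂ) - p) (w - p)} ∩
    {w | 0 ≤ (-σ) * cr u (w - p)}), ((convex_segment _ _).thickening δ).inter
      ((convex_cr_pos _ _ _).inter (convex_cr_nonneg _ _ _)), ?_, ?_, ?_⟩
  · rintro w ⟨hw1, hw2, hw3⟩ hwU
    simp only [Set.mem_ofPred_eq] at hw2 hw3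
    obtain ⟨e, he, hwe⟩ := mem_edgeUnion.1 hwU
    by_cases hep : p ∈ e
    · obtain ⟨x, rfl, hx, c, hc0, hc1, hc⟩ := exists_of_mem_edgeSeg he hep hwe
      rw [hc, cr_smul_right] at hw2 hw3
      have hc' : 0 < c := by
        rcases hc0.eq_or_lt with rfl | h
        · simp at hw2
        · exact h
      have h1 : 0 < σ * cr ((a : ℂ) - p) ((x : ℂ) - p) := by
        have : 0 < c * (σ * cr ((a : ℂ) - p) ((x : ℂ) - p)) := by linarith
        exact (mul_pos_iff_of_pos_left hc').1 this
      have h2 := hno x hx h1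
      rw [cr_comm] at h2
      nlinarith
    · apply hsub hw1
      simp only [Set.mem_iUnion]
      exact ⟨e, ⟨he, hep⟩, hwe⟩
  · filter_upwards [(tendsto_ray (p : ℂ) u).eventually (Metric.isOpen_thickening.mem_nhds
      (Metric.self_subset_thickening hδ _ (left_mem_segment ℝ (p : ℂ) m))),
      self_mem_nhdsWithin] with ε hε hε0
    refine ⟨hε, ?_, ?_⟩
    · simp only [Set.mem_ofPred_eq, add_sub_cancel_left, cr_smul_right]
      have := mul_pos (Set.mem_Ioi.1 hε0) hu
      linarith
    · simp only [Set.mem_ofPred_eq, add_sub_cancel_left, cr_smul_right, cr_self, mul_zero,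
        le_refl]
  · filter_upwards [(tendsto_ray m u).eventually (Metric.isOpen_thickening.mem_nhds
      (Metric.self_subset_thickening hδ _ (right_mem_segment ℝ (p : ℂ) m))),
      self_mem_nhdsWithin] with ε hε hε0
    have e1 : m + ε • u - p = (1 / 2 : ℝ) • ((a : ℂ) - p) + ε • u := by rw [hm]; ring
    refine ⟨hε, ?_, ?_⟩
    · simp only [Set.mem_ofPred_eq, e1, cr_add_right, cr_smul_right, cr_self]
      have := mul_pos (Set.mem_Ioi.1 hε0) hu
      linarith
    · simp only [Set.mem_ofPred_eq, e1, cr_add_right, cr_smul_right, cr_self]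
      rw [cr_comm u]
      linarith

/-- A component adjacent to an edge at `p` is the component in direction `u`, if there is no edge
in between. -/
theorem IsComp.isSide_iff_ger {r : Set ℂ} (hr : IsComp G r) (hP : GeneralPosition P)
    (hG : IsPlane G) {p a : P} (h : G.Adj p a) {σ : ℝ} {u : ℂ}
    (hu : 0 < σ * cr ((a : ℂ) - p) u)
    (hno : ∀ x, G.Adj p x → 0 < σ * cr ((a : ℂ) - p) ((x : ℂ) - p) →
      σ * cr ((x : ℂ) - p) u < 0) : IsSide σ r p a ↔ Ger r p u := by
  obtain ⟨N, hc, hU, h1, h2⟩ := exists_sector hP hG h hu hno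
  have hm := half_mem_openSegment (p : ℂ) a
  constructor
  · intro hs
    obtain ⟨ε, h3, h4⟩ := (h2.and (hs.ger hm hu)).exists
    have := hr.subset_of_isPreconnected hc.isPreconnected hU h3 h4
    exact h1.mono fun ε h => this h
  · intro hg
    obtain ⟨ε, h3, h4⟩ := (h1.and hg).exists
    have := hr.subset_of_isPreconnected hc.isPreconnected hU h3 h4
    exact hr.isSide_of_ger hG h hm hu (h2.mono fun ε h => this h)

theorem exists_ball_avoiding (hP : GeneralPosition P) (G : SimpleGraph P) (p : P) : ∃ δ > 0,
    ∀ w ∈ Metric.ball (p : ℂ) δ, ∀ e ∈ G.edgeSet, w ∈ edgeSeg e → p ∈ e := by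
  set E : Set (Sym2 P) := {e ∈ G.edgeSet | p ∉ e}
  obtain ⟨δ, hδ, hsub⟩ := Metric.isOpen_iff.1 (isClosed_biUnion_edgeSeg E).isOpen_compl (p : ℂ) (by
    intro hzF
    simp only [Set.mem_iUnion] at hzF
    obtain ⟨e, he, hze⟩ := hzF
    exact he.2 (mem_edge_of_mem_edgeSeg hP he.1 hze))
  refine ⟨δ, hδ, fun w hw e he hwe => ?_⟩
  by_contra hp
  apply hsub hw
  simp only [Set.mem_iUnion]
  exact ⟨e, ⟨he, hp⟩, hwe⟩

/-- Turning the direction of view from `u` to `v` does not change the component if no neighbor lies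
in the closed cone between them: close to `p` only edges at `p` could cut the segment from `p + ε u`
to `p + ε v`. -/
theorem IsComp.ger_of_ger {r : Set ℂ} (hr : IsComp G r) (hP : GeneralPosition P) {p : P} {σ : ℝ}
    {u v : ℂ} (huv : 0 < σ * cr u v)
    (hno : ∀ x, G.Adj p x → ¬ (0 ≤ σ * cr u ((x : ℂ) - p) ∧ 0 ≤ σ * cr ((x : ℂ) - p) v))
    (hg : Ger r p u) : Ger r p v := by
  obtain ⟨δ, hδ, hb⟩ := exists_ball_avoiding hP G p
  have hball := Metric.ball_mem_nhds (p : ℂ) hδ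
  filter_upwards [hg, (tendsto_ray (p : ℂ) u).eventually hball,
    (tendsto_ray (p : ℂ) v).eventually hball, self_mem_nhdsWithin] with ε h1 h2 h3 h4
  have hε : 0 < ε := h4
  refine hr.subset_of_isPreconnected (convex_segment _ _).isPreconnected ?_
    (left_mem_segment ℝ ((p : ℂ) + ε • u) ((p : ℂ) + ε • v)) h1 (right_mem_segment ℝ _ _)
  intro w hw hwU
  obtain ⟨e, he, hwe⟩ := mem_edgeUnion.1 hwU
  have hpe := hb w ((convex_ball _ _).segment_subset h2 h3 hw) e he hwe
  obtain ⟨x, rfl, hx, c, hc0, hc1, hc⟩ := exists_of_mem_edgeSeg he hpe hwe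
  obtain ⟨s, t, hs, ht, hst, rfl⟩ := hw
  have e1 : s • ((p : ℂ) + ε • u) + t • ((p : ℂ) + ε • v) - p = (s * ε) • u + (t * ε) • v := by
    obtain rfl : t = 1 - s := by linarith
    module
  rw [e1] at hc
  have a1 : c * (σ * cr u ((x : ℂ) - p)) = (t * ε) * (σ * cr u v) := by
    have := congrArg (fun z => σ * cr u z) hc
    simp only [cr_add_right, cr_smul_right, cr_self] at this
    linarith
  have a2 : c * (σ * cr ((x : ℂ) - p) v) = (s * ε) * (σ * cr u v) := by
    have := congrArg (fun z => σ * cr z v) hc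
    simp only [cr_add_left, cr_smul_left, cr_self] at this
    linarith
  -- `c = 0` would mean that the point is `p`; since `u` and `v` are independent, this forces `s = t
  -- = 0`.
  rcases hc0.eq_or_lt with rfl | hc0
  · have b1 : t = 0 := by
      have : (t * ε) * (σ * cr u v) = 0 := by linarith
      rcases mul_eq_zero.1 this with h | h
      · exact (mul_eq_zero.1 h).resolve_right hε.ne'
      · exact absurd h huv.ne'
    have b2 : s = 0 := by
      have : (s * ε) * (σ * cr u v) = 0 := by linarith
      rcases mul_eq_zero.1 this with h | h
      · exact (mul_eq_zero.1 h).resolve_right hε.ne'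
      · exact absurd h huv.ne'
    linarith
  · refine hno x hx ⟨?_, ?_⟩
    · refine nonneg_of_mul_nonneg_right (b := _) ?_ hc0
      rw [a1]; positivity
    · refine nonneg_of_mul_nonneg_right (b := _) ?_ hc0
      rw [a2]; positivity

end

section

variable {P : Finset ℂ} {G : SimpleGraph P}

/-! ### The convex hull -/

/-- All points lie weakly to the right of the directed edge from `p` to `a`. -/
def IsHullDart (p a : P) : Prop := p ≠ a ∧ ∀ x : P, orient (p : ℂ) a x ≤ 0

/-- The convex hull of the point set. -/
def hull (P : Finset ℂ) : Set ℂ := convexHull ℝ (P : Set ℂ)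

theorem convex_hull : Convex ℝ (hull P) := convex_convexHull ℝ _

theorem mem_hull (p : P) : (p : ℂ) ∈ hull P := subset_convexHull ℝ _ p.2

theorem isClosed_hull : IsClosed (hull P) := P.finite_toSet.isClosed_convexHull ℝ

/-- Ratios of signed areas are barycentric coordinates. -/
theorem mem_of_orient_nonneg {s : Set ℂ} (hs : Convex ℝ s) {p a x z : ℂ} (hp : p ∈ s)
    (ha : a ∈ s) (hx : x ∈ s) (h : 0 < orient p a x) (h1 : 0 ≤ orient p a z)
    (h2 : 0 ≤ orient a x z) (h3 : 0 ≤ orient x p z) : z ∈ s := by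
  have hsum : orient a x z + orient x p z + orient p a z = orient p a x := by
    simp [orient, cr]; ring
  have hz : z = (orient a x z / orient p a x) • p + (orient x p z / orient p a x) • a +
      (orient p a z / orient p a x) • x := by
    rw [div_eq_inv_mul, div_eq_inv_mul, div_eq_inv_mul, mul_smul, mul_smul, mul_smul, ← smul_add,
      ← smul_add, eq_inv_smul_iff₀ h.ne']
    apply Complex.ext <;> simp [orient, cr] <;> ring
  have := hs.sum_mem (t := (Finset.univ : Finset (Fin 3)))
    (w := ![orient a x z / orient p a x, orient x p z / orient p a x, orient p a z / orient p a x])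
    (z := ![p, a, x]) (by
      intro i _; fin_cases i
      · exact div_nonneg h2 h.le
      · exact div_nonneg h3 h.le
      · exact div_nonneg h1 h.le) (by
      rw [Fin.sum_univ_three]
      simp only [Matrix.cons_val]
      rw [← add_div, ← add_div, hsum, div_self h.ne']) (by
      intro i _; fin_cases i
      · exact hp
      · exact ha
      · exact hx)
  rw [Fin.sum_univ_three] at this
  simp only [Matrix.cons_val] at this
  rw [hz]
  exact this

theorem continuous_orient (p a : ℂ) : Continuous fun z => orient p a z := continuous_cr _ _

theorem isOpen_triangle (p a x : ℂ) :
    IsOpen {z | 0 < orient p a z ∧ 0 < orient a x z ∧ 0 < orient x p z} :=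
  (isOpen_lt continuous_const (continuous_orient p a)).inter
    ((isOpen_lt continuous_const (continuous_orient a x)).inter
      (isOpen_lt continuous_const (continuous_orient x p)))

/-- Near an inner point of its side `pa`, the triangle `p a x` fills a half disc. -/
theorem eventually_mem_interior {s : Set ℂ} (hs : Convex ℝ s) {p a x z : ℂ} (hp : p ∈ s)
    (ha : a ∈ s) (hx : x ∈ s) (h : 0 < orient p a x) (hz : z ∈ openSegment ℝ p a) :
    ∀ᶠ w in 𝓝 z, 0 < cr (a - p) (w - z) → w ∈ interior s := by
  have hsub : {z | 0 < orient p a z ∧ 0 < orient a x z ∧ 0 < orient x p z} ⊆ interior s :=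
    interior_maximal (fun w hw => mem_of_orient_nonneg hs hp ha hx h hw.1.le hw.2.1.le hw.2.2.le)
      (isOpen_triangle p a x)
  have hz' := openSegment_subset_segment _ _ _ hz
  rw [openSegment_eq_image'] at hz
  obtain ⟨t, ht, rfl⟩ := hz
  have e1 : orient a x (p + t • (a - p)) = (1 - t) * orient p a x := by
    simp [orient, cr]; ring
  have e2 : orient x p (p + t • (a - p)) = t * orient p a x := by
    simp [orient, cr]; ring
  filter_upwards [(isOpen_lt continuous_const (continuous_orient a x)).mem_nhds
        (show p + t • (a - p) ∈ {z | 0 < orient a x z} by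
          rw [Set.mem_ofPred_eq, e1]; exact mul_pos (by linarith [ht.2]) h),
      (isOpen_lt continuous_const (continuous_orient x p)).mem_nhds
        (show p + t • (a - p) ∈ {z | 0 < orient x p z} by
          rw [Set.mem_ofPred_eq, e2]; exact mul_pos ht.1 h)] with w h1 h2 h3
  rw [cr_sub_of_mem_segment hz'] at h3
  exact hsub ⟨h3, h1, h2⟩

/-- With points of the set on both sides of `pa`, each `z` on the open segment is the midpoint of
two interior points of the hull. -/
theorem openSegment_subset_interior_hull {p a x y : P} (hx : 0 < orient (p : ℂ) a x)
    (hy : orient (p : ℂ) a y < 0) : openSegment ℝ (p : ℂ) a ⊆ interior (hull P) := by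
  intro z hz
  have h1 := eventually_mem_interior convex_hull (mem_hull p) (mem_hull a) (mem_hull x) hx hz
  have h2 := eventually_mem_interior convex_hull (mem_hull a) (mem_hull p) (mem_hull y)
    (by rw [orient_swap_left]; linarith) (by rwa [openSegment_symm])
  have hv : 0 < cr ((a : ℂ) - p) (x - p) := hx
  obtain ⟨ε, ⟨h3, h4⟩, hε⟩ := (((tendsto_ray z ((x : ℂ) - p)).eventually h1).and
    ((tendsto_ray z (-((x : ℂ) - p))).eventually h2) |>.and self_mem_nhdsWithin).exists
  have hε : 0 < ε := hε
  rw [add_sub_cancel_left, cr_smul_right] at h3 h4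
  rw [← neg_sub (a : ℂ) p, cr_neg_left, cr_neg_right, neg_neg] at h4
  have h5 := (convex_hull (P := P)).interior.midpoint_mem (h3 (mul_pos hε hv))
    (h4 (mul_pos hε hv))
  convert h5 using 1
  rw [midpoint_eq_smul_add, invOf_eq_inv]
  module

theorem hull_subset_of_forall {s : Set ℂ} (hs : Convex ℝ s) (h : ∀ p : P, (p : ℂ) ∈ s) :
    hull P ⊆ s := convexHull_min (fun p hp => h ⟨p, hp⟩) hs

theorem IsHullDart.orient_le {p a : P} (h : IsHullDart p a) {z : ℂ} (hz : z ∈ hull P) :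
    orient (p : ℂ) a z ≤ 0 := by
  have := hull_subset_of_forall (convex_cr_nonneg (-1) ((a : ℂ) - p) p)
    (fun x => by have := h.2 x; simp only [Set.mem_ofPred_eq, orient] at *; linarith) hz
  simp only [Set.mem_ofPred_eq] at this
  rw [orient]; linarith

theorem IsHullDart.segment_subset_frontier {p a : P} (h : IsHullDart p a) :
    segment ℝ (p : ℂ) a ⊆ frontier (hull P) := by
  intro z hz
  refine ⟨subset_closure (convex_hull.segment_subset (mem_hull p) (mem_hull a) hz), fun hi => ?_⟩
  have hu := coe_sub_ne_zero h.1
  obtain ⟨ε, hε, hε0⟩ := (((tendsto_ray z (Complex.I * ((a : ℂ) - p))).eventually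
    (isOpen_interior.mem_nhds hi)).and self_mem_nhdsWithin).exists
  have h1 := h.orient_le (interior_subset hε)
  have h2 := cr_sub_of_mem_segment hz (z + ε • (Complex.I * ((a : ℂ) - p)))
  rw [orient, ← h2, add_sub_cancel_left, cr_smul_right] at h1
  have := mul_pos (Set.mem_Ioi.1 hε0) (cr_I_mul_pos hu)
  linarith

theorem mem_hullEdges_iff {p a : P} :
    s(p, a) ∈ hullEdges P ↔ IsHullDart p a ∨ IsHullDart a p := by
  constructor
  · rintro ⟨h1, h2⟩
    have hne : p ≠ a := h1
    by_contra hcon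
    push Not at hcon
    simp only [IsHullDart, not_and, not_forall, not_le] at hcon
    obtain ⟨x, hx⟩ := hcon.1 hne
    obtain ⟨y, hy⟩ := hcon.2 hne.symm
    rw [orient_swap_left] at hy
    have hm := half_mem_openSegment (p : ℂ) a
    exact (h2 (openSegment_subset_segment _ _ _ hm)).2
      (openSegment_subset_interior_hull hx (by linarith) hm)
  · rintro (h | h)
    · exact ⟨h.1, h.segment_subset_frontier⟩
    · rw [Sym2.eq_swap]
      exact ⟨h.1, h.segment_subset_frontier⟩

/-- If all points of `P` lie in a half plane, this convex set contains the hull as soon as it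
contains `P`. So the hull meets the boundary line only in the hull of the points on that line. -/
theorem convex_union_halfplane {Z : Set ℂ} (hZ : Convex ℝ Z) {c z : ℂ}
    (h : ∀ w ∈ Z, cr c (w - z) = 0) : Convex ℝ (Z ∪ {w | 0 < cr c (w - z)}) := by
  have hnn : ∀ w ∈ Z ∪ {w | 0 < cr c (w - z)}, 0 ≤ cr c (w - z) := by
    rintro w (hw | hw)
    · exact (h w hw).ge
    · exact le_of_lt hw
  have hzero : ∀ w ∈ Z ∪ {w | 0 < cr c (w - z)}, cr c (w - z) = 0 → w ∈ Z := by
    rintro w (hw | hw) h0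
    · exact hw
    · exact absurd h0 (ne_of_gt hw)
  intro x hx y hy s t hs ht hst
  have e : cr c (s • x + t • y - z) = s * cr c (x - z) + t * cr c (y - z) := by
    obtain rfl : t = 1 - s := by linarith
    simp [cr]; ring
  have hx0 := hnn x hx
  have hy0 := hnn y hy
  rcases hs.eq_or_lt with rfl | hs
  · obtain rfl : t = 1 := by linarith
    simpa using hy
  rcases ht.eq_or_lt with rfl | ht
  · obtain rfl : s = 1 := by linarith
    simpa using hx
  by_cases hpos : 0 < cr c (s • x + t • y - z)
  · exact Or.inr hpos
  · have h1 := mul_nonneg hs.le hx0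
    have h2 := mul_nonneg ht.le hy0
    have h3 : s * cr c (x - z) = 0 := by linarith
    have h4 : t * cr c (y - z) = 0 := by linarith
    exact Or.inl (hZ (hzero x hx ((mul_eq_zero.1 h3).resolve_left hs.ne'))
      (hzero y hy ((mul_eq_zero.1 h4).resolve_left ht.ne')) hs.le ht.le hst)

theorem exists_cr_eq (f : ℂ →L[ℝ] ℝ) : ∃ c : ℂ, ∀ z, f z = cr c z := by
  refine ⟨⟨f Complex.I, -f 1⟩, fun z => ?_⟩
  have : z = z.re • (1 : ℂ) + z.im • Complex.I := by
    apply Complex.ext <;> simp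
  conv_lhs => rw [this]
  rw [map_add, map_smul, map_smul, smul_eq_mul, smul_eq_mul, cr]
  ring

/-- Seen from `p`, all other points lie in an open half plane; the first and the last direction
among them are the hull edges at `p`. -/
theorem exists_hullDarts_of_support (hn : 3 ≤ P.card) {p : P} {c : ℂ}
    (h : ∀ x : P, x ≠ p → 0 < cr c ((x : ℂ) - p)) :
    (∃ a, IsHullDart p a) ∧ ∃ a, IsHullDart a p := by
  classical
  have hne : (Finset.univ.erase p).Nonempty := by
    rw [← Finset.card_pos, Finset.card_erase_of_mem (Finset.mem_univ p), Finset.card_univ,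
      Fintype.card_coe]
    omega
  have h' : ∀ x ∈ Finset.univ.erase p, 0 < cr c ((x : ℂ) - p) := fun x hx =>
    h x (Finset.ne_of_mem_erase hx)
  constructor
  · obtain ⟨a, ha, hm⟩ := exists_last _ hne _ c h'
    refine ⟨a, (Finset.ne_of_mem_erase ha).symm, fun x => ?_⟩
    by_cases hx : x = p
    · simp [hx]
    · have := hm x (by simp [hx])
      rw [orient_swap]
      exact neg_nonpos.2 this
  · obtain ⟨a, ha, hm⟩ := exists_first _ hne _ c h'
    refine ⟨a, Finset.ne_of_mem_erase ha, fun x => ?_⟩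
    by_cases hx : x = p
    · simp [hx]
    · have := hm x (by simp [hx])
      rw [orient_swap_left]
      exact neg_nonpos.2 this

theorem mem_extPts_of_support {p : P} {c : ℂ} (h : ∀ x : P, x ≠ p → 0 < cr c ((x : ℂ) - p)) :
    p ∈ extPts P := by
  have hsub : hull P ⊆ {(p : ℂ)} ∪ {w | 0 < cr c (w - p)} :=
    hull_subset_of_forall (convex_union_halfplane (convex_singleton _) (by simp)) fun x => by
      by_cases hx : x = p
      · left; rw [hx]; rfl
      · right; exact h x hx
  have hnn : ∀ w ∈ hull P, 0 ≤ cr c (w - p) ∧ (cr c (w - p) = 0 → w = p) := by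
    intro w hw
    rcases hsub hw with h1 | h1
    · rw [Set.mem_singleton_iff.1 h1]; simp
    · exact ⟨le_of_lt h1, fun h0 => absurd h0 (ne_of_gt h1)⟩
  refine ⟨mem_hull p, fun x hx y hy hp => ?_⟩
  obtain ⟨s, t, hs, ht, hst, hp⟩ := hp
  have e : s * cr c (x - p) + t * cr c (y - p) = 0 := by
    have : cr c (s • x + t • y - p) = s * cr c (x - p) + t * cr c (y - p) := by
      obtain rfl : t = 1 - s := by linarith
      simp [cr]; ring
    rw [← this, hp]; simp
  have h1 := mul_nonneg hs.le (hnn x hx).1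
  have h2 := mul_nonneg ht.le (hnn y hy).1
  exact (hnn x hx).2 ((mul_eq_zero.1 (by linarith : s * cr c (x - p) = 0)).resolve_left hs.ne')

/-- An extreme point is not in the hull of the other points, so a line separates it strictly from
them. -/
theorem exists_support_of_mem_extPts {p : P} (hp : p ∈ extPts P) :
    ∃ c, ∀ x : P, x ≠ p → 0 < cr c ((x : ℂ) - p) := by
  have hnot : (p : ℂ) ∉ convexHull ℝ ((P : Set ℂ) \ {(p : ℂ)}) := by
    intro hmem
    have := inter_extremePoints_subset_extremePoints_of_subset (𝕜 := ℝ)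
      (convexHull_mono (𝕜 := ℝ) (Set.sdiff_subset (s := (P : Set ℂ)) (t := {(p : ℂ)}))) ⟨hmem, hp⟩
    exact (extremePoints_convexHull_subset this).2 rfl
  obtain ⟨f, u, h1, h2⟩ := geometric_hahn_banach_point_closed (convex_convexHull ℝ _)
    ((P.finite_toSet.subset Set.sdiff_subset).isClosed_convexHull ℝ) hnot
  obtain ⟨c, hc⟩ := exists_cr_eq f
  refine ⟨c, fun x hx => ?_⟩
  have := h2 x (subset_convexHull ℝ _ ⟨x.2, fun h => hx (Subtype.ext h)⟩)
  rw [cr_sub_right, ← hc, ← hc]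
  linarith

/-- The line `pa` supports the hull and touches it in `a` too; a sufficiently small turn around `p`
makes the inequality at `a` strict and, there being finitely many points, keeps the other ones. -/
theorem exists_support_of_orient (hP : GeneralPosition P) {p a : P} (hne : p ≠ a) {τ : ℝ}
    (hτ : τ ≠ 0) (h : ∀ x : P, 0 ≤ τ * orient (p : ℂ) a x) :
    ∃ c, ∀ x : P, x ≠ p → 0 < cr c ((x : ℂ) - p) := by
  set u := (a : ℂ) - p
  have hev : ∀ᶠ δ : ℝ in 𝓝[>] 0, ∀ x : P, x ≠ p →
      0 < cr (τ • u + δ • (-(Complex.I * u))) ((x : ℂ) - p) := by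
    rw [eventually_all]
    intro x
    by_cases hx : x = p
    · simp [hx]
    by_cases hxa : x = a
    · filter_upwards [self_mem_nhdsWithin] with δ hδ _
      subst hxa
      have := mul_pos (Set.mem_Ioi.1 hδ) (cr_I_mul_pos (coe_sub_ne_zero hne))
      rw [cr_add_left, cr_smul_left, cr_smul_left, cr_neg_left, cr_self,
        cr_comm (Complex.I * u)]
      linarith
    · have h1 : 0 < τ * orient (p : ℂ) a x := lt_of_le_of_ne (h x)
        (mul_ne_zero hτ (orient_ne_zero hP hne (Ne.symm hx) (Ne.symm hxa))).symm
      have hc : Continuous fun δ : ℝ => cr (τ • u + δ • (-(Complex.I * u))) ((x : ℂ) - p) := by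
        unfold cr; fun_prop
      have := hc.tendsto 0
      rw [zero_smul, add_zero, cr_smul_left] at this
      have h2 : ∀ᶠ δ : ℝ in 𝓝 0, 0 < cr (τ • u + δ • (-(Complex.I * u))) ((x : ℂ) - p) :=
        this.eventually_const_lt h1
      filter_upwards [nhdsWithin_le_nhds h2] with δ h _ using h
  obtain ⟨δ, hδ⟩ := hev.exists
  exact ⟨_, hδ⟩

theorem mem_extPts_iff (hP : GeneralPosition P) (hn : 3 ≤ P.card) {p : P} :
    p ∈ extPts P ↔ ∃ a, IsHullDart p a := by
  refine ⟨fun h => (exists_hullDarts_of_support hn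
    (exists_support_of_mem_extPts h).choose_spec).1, fun ⟨a, h⟩ => ?_⟩
  obtain ⟨c, hc⟩ := exists_support_of_orient hP h.1 (τ := -1) (by norm_num)
    (fun x => by linarith [h.2 x])
  exact mem_extPts_of_support hc

theorem mem_extPts_iff' (hP : GeneralPosition P) (hn : 3 ≤ P.card) {p : P} :
    p ∈ extPts P ↔ ∃ a, IsHullDart a p := by
  refine ⟨fun h => (exists_hullDarts_of_support hn
    (exists_support_of_mem_extPts h).choose_spec).2, fun ⟨a, h⟩ => ?_⟩
  obtain ⟨c, hc⟩ := exists_support_of_orient hP h.1.symm (τ := 1) one_ne_zero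
    (fun x => by have := h.2 x; rw [orient_swap_left] at this; linarith)
  exact mem_extPts_of_support hc

theorem IsHullDart.unique (hP : GeneralPosition P) {p a b : P} (ha : IsHullDart p a)
    (hb : IsHullDart p b) : a = b := by
  refine eq_of_orient_eq_zero hP ha.1 hb.1 (le_antisymm (ha.2 b) ?_)
  have := hb.2 a
  rw [orient_swap] at this
  linarith

theorem exists_third (hn : 3 ≤ P.card) (p a : P) : ∃ x : P, x ≠ p ∧ x ≠ a := by
  classical
  have : ((Finset.univ.erase p).erase a).Nonempty := by
    rw [← Finset.card_pos]
    have h1 := Finset.pred_card_le_card_erase (s := Finset.univ.erase p) (a := a)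
    have h2 := Finset.pred_card_le_card_erase (s := (Finset.univ : Finset P)) (a := p)
    rw [Finset.card_univ, Fintype.card_coe] at h2
    omega
  obtain ⟨x, hx⟩ := this
  simp only [Finset.mem_erase, Finset.mem_univ, and_true] at hx
  exact ⟨x, hx.2, hx.1⟩

theorem IsHullDart.not_swap (hP : GeneralPosition P) (hn : 3 ≤ P.card) {p a : P}
    (h : IsHullDart p a) : ¬ IsHullDart a p := by
  intro h'
  obtain ⟨x, h1, h2⟩ := exists_third hn p a
  have h3 := h'.2 x
  rw [orient_swap_left] at h3
  exact orient_ne_zero hP h.1 h1.symm h2.symm (le_antisymm (h.2 x) (by linarith))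

theorem interior_hull_nonempty (hP : GeneralPosition P) (hn : 3 ≤ P.card) :
    (interior (hull P)).Nonempty := by
  obtain ⟨p, hp⟩ : P.Nonempty := Finset.card_pos.1 (by omega)
  obtain ⟨a, ha, -⟩ := exists_third hn ⟨p, hp⟩ ⟨p, hp⟩
  obtain ⟨x, hx, hxa⟩ := exists_third hn ⟨p, hp⟩ a
  have key : ∀ p a x : P, 0 < orient (p : ℂ) a x → (interior (hull P)).Nonempty := by
    intro p a x h
    have := eventually_mem_interior convex_hull (mem_hull p) (mem_hull a) (mem_hull x) h
      (half_mem_openSegment _ _)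
    obtain ⟨ε, h1, hε⟩ := (((tendsto_ray _ ((x : ℂ) - p)).eventually this).and
      self_mem_nhdsWithin).exists
    rw [add_sub_cancel_left, cr_smul_right] at h1
    exact ⟨_, h1 (mul_pos hε h)⟩
  rcases lt_or_gt_of_ne (orient_ne_zero hP ha.symm hx.symm hxa.symm) with h | h
  · rw [orient_swap] at h
    exact key _ x a (by linarith)
  · exact key _ a x h

/-- A supporting line at `z` carries at most two points of `P`, and `z` is in their hull. If there
are two, they form a hull edge containing `z`; if there is one, it is `z` itself, an extreme point,
at which a hull edge starts. -/
theorem exists_hullDart_of_mem_frontier (hP : GeneralPosition P) (hn : 3 ≤ P.card) {z : ℂ}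
    (hz : z ∈ frontier (hull P)) : ∃ p a : P, IsHullDart p a ∧ z ∈ segment ℝ (p : ℂ) a := by
  have hint := interior_hull_nonempty hP hn
  have hzH : z ∈ hull P := isClosed_hull.closure_eq ▸ hz.1
  obtain ⟨f, hf⟩ := geometric_hahn_banach_open_point convex_hull.interior isOpen_interior hz.2
  obtain ⟨c, hc⟩ := exists_cr_eq (-f)
  have hcz : ∀ w, cr c (w - z) = f z - f w := fun w => by
    rw [cr_sub_right, ← hc, ← hc]; simp; ring
  have hc0 : c ≠ 0 := by
    rintro rfl
    obtain ⟨w, hw⟩ := hint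
    have := hf w hw
    have h2 := hcz w
    simp at h2
    linarith
  have hnn : ∀ w ∈ hull P, 0 ≤ cr c (w - z) := by
    intro w hw
    have h1 : w ∈ closure (interior (hull P)) := by
      rw [convex_hull.closure_interior_eq_closure_of_nonempty_interior hint]
      exact subset_closure hw
    have h2 : closure (interior (hull P)) ⊆ {w | 0 ≤ cr c (w - z)} :=
      closure_minimal (fun w hw => by
        have := hf w hw
        simp only [Set.mem_ofPred_eq, hcz]; linarith)
        (isClosed_le continuous_const (continuous_cr c z))
    exact h2 h1
  set Z : Set ℂ := {x | x ∈ P ∧ cr c (x - z) = 0}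
  have hZ : ∀ w ∈ convexHull ℝ Z, cr c (w - z) = 0 := by
    intro w hw
    refine le_antisymm ?_ ?_
    · have := convexHull_min (s := Z) (fun x hx => by simp [hx.2]) (convex_cr_nonneg (-1) c z) hw
      simp only [Set.mem_ofPred_eq] at this
      linarith
    · have := convexHull_min (s := Z) (fun x hx => by simp [hx.2]) (convex_cr_nonneg 1 c z) hw
      simp only [Set.mem_ofPred_eq] at this
      linarith
  have hzZ : z ∈ convexHull ℝ Z := by
    have := hull_subset_of_forall (convex_union_halfplane (convex_convexHull ℝ Z) hZ) (fun x => by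
      rcases (hnn x (mem_hull x)).eq_or_lt with h | h
      · exact Or.inl (subset_convexHull ℝ _ ⟨x.2, h.symm⟩)
      · exact Or.inr h) hzH
    rcases this with h | h
    · exact h
    · simp at h
  obtain ⟨p, hpZ⟩ : Z.Nonempty := convexHull_nonempty_iff.1 ⟨z, hzZ⟩
  have hp : p ∈ P ∧ cr c (p - z) = 0 := hpZ
  have hpz : ∀ x : ℂ, cr c (x - p) = cr c (x - z) := fun x => by
    have : x - p = (x - z) - (p - z) := by ring
    rw [this, cr_sub_right, hp.2, sub_zero]
  by_cases hone : ∀ x ∈ Z, x = p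
  · have hZp : Z ⊆ {p} := fun x hx => hone x hx
    have hzp : z = p := by simpa using convexHull_mono hZp hzZ
    obtain ⟨a, ha⟩ := (exists_hullDarts_of_support hn (p := ⟨p, hp.1⟩) (c := c) fun x hx => by
      rw [hpz]
      refine lt_of_le_of_ne (hnn x (mem_hull x)) fun h => hx (Subtype.ext (hone x ⟨x.2, h.symm⟩))).1
    refine ⟨⟨p, hp.1⟩, a, ha, ?_⟩
    exact (congrArg (· ∈ segment ℝ p (a : ℂ)) hzp).mpr (left_mem_segment ℝ p (a : ℂ))
  · push Not at hone
    obtain ⟨a, haZ, hap⟩ := hone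
    have ha : a ∈ P ∧ cr c (a - z) = 0 := haZ
    have ht := eq_smul_of_cr_eq_zero hc0 ((hpz a).trans ha.2)
    obtain ⟨t, ht⟩ := ht
    have ht0 : t ≠ 0 := by
      rintro rfl
      rw [zero_smul, sub_eq_zero] at ht
      exact hap ht
    have hor : ∀ x : ℂ, orient p a x = t * cr c (x - z) := fun x => by
      rw [orient, ht, cr_smul_left, hpz]
    have hne : (⟨p, hp.1⟩ : P) ≠ ⟨a, ha.1⟩ := fun h => hap (congrArg Subtype.val h).symm
    have hzs : z ∈ segment ℝ p a := by
      rw [← convexHull_pair]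
      refine convexHull_mono (fun x hxZ => ?_) hzZ
      have hx : x ∈ P ∧ cr c (x - z) = 0 := hxZ
      by_contra hxn
      simp only [Set.mem_insert_iff, Set.mem_singleton_iff, not_or] at hxn
      refine orient_ne_zero hP (p := ⟨p, hp.1⟩) (a := ⟨a, ha.1⟩) (b := ⟨x, hx.1⟩) hne
        (fun h => hxn.1 (congrArg Subtype.val h).symm)
        (fun h => hxn.2 (congrArg Subtype.val h).symm)
        ?_
      rw [hor, hx.2, mul_zero]
    rcases lt_or_gt_of_ne ht0 with h | h
    · refine ⟨⟨p, hp.1⟩, ⟨a, ha.1⟩, ⟨hne, fun x => ?_⟩, hzs⟩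
      rw [hor]
      exact mul_nonpos_of_nonpos_of_nonneg h.le (hnn x (mem_hull x))
    · refine ⟨⟨a, ha.1⟩, ⟨p, hp.1⟩, ⟨hne.symm, fun x => ?_⟩, segment_symm ℝ p a ▸ hzs⟩
      rw [orient_swap_left, hor]
      exact neg_nonpos.2 (mul_nonneg h.le (hnn x (mem_hull x)))

theorem frontier_hull_subset (hP : GeneralPosition P) (hn : 3 ≤ P.card)
    (hH : hullEdges P ⊆ G.edgeSet) : frontier (hull P) ⊆ edgeUnion G := by
  intro z hz
  obtain ⟨p, a, h, hzs⟩ := exists_hullDart_of_mem_frontier hP hn hz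
  exact mem_edgeUnion.2 ⟨s(p, a), hH (mem_hullEdges_iff.2 (Or.inl h)), hzs⟩

theorem IsComp.subset_interior_hull {r : Set ℂ} (hr : IsComp G r) (hP : GeneralPosition P)
    (hn : 3 ≤ P.card) (hH : hullEdges P ⊆ G.edgeSet) {z : ℂ} (hz : z ∈ r)
    (hzi : z ∈ interior (hull P)) : r ⊆ interior (hull P) := by
  refine hr.isPreconnected.subset_left_of_subset_union isOpen_interior
    (isClosed_hull (P := P)).isOpen_compl ?_ ?_ ⟨z, hz, hzi⟩
  · exact Set.disjoint_compl_right_iff_subset.2 interior_subset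
  · intro w hw
    by_cases hwi : w ∈ interior (hull P)
    · exact Or.inl hwi
    · refine Or.inr fun hwH => hr.subset hw (frontier_hull_subset hP hn hH
        ⟨subset_closure hwH, hwi⟩)

theorem isBounded_hull : Bornology.IsBounded (hull P) :=
  isBounded_convexHull.2 P.finite_toSet.isBounded

theorem IsComp.mem_regions_of_mem_interior {r : Set ℂ} (hr : IsComp G r) (hP : GeneralPosition P)
    (hn : 3 ≤ P.card) (hH : hullEdges P ⊆ G.edgeSet) {z : ℂ} (hz : z ∈ r)
    (hzi : z ∈ interior (hull P)) : r ∈ regions G :=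
  ⟨isBounded_hull.subset ((hr.subset_interior_hull hP hn hH hz hzi).trans interior_subset), hr⟩

theorem IsComp.mem_regions_of_isSide {r : Set ℂ} (hr : IsComp G r) (hP : GeneralPosition P)
    (hn : 3 ≤ P.card) (hH : hullEdges P ⊆ G.edgeSet) {p a x : P}
    (hx : 0 < orient (p : ℂ) a x) (hs : IsSide 1 r p a) : r ∈ regions G := by
  have hm := half_mem_openSegment (p : ℂ) a
  have h1 := eventually_mem_interior convex_hull (mem_hull p) (mem_hull a) (mem_hull x) hx hm
  have hv : 0 < 1 * cr ((a : ℂ) - p) (x - p) := by rw [one_mul]; exact hx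
  obtain ⟨ε, h2, h3⟩ := ((eventually_ray_of_side (σ := 1) (by simpa only [one_mul] using h1) hv).and
    (hs.ger hm hv)).exists
  exact hr.mem_regions_of_mem_interior hP hn hH h3 h2

end

section

variable {P : Finset ℂ} {G : SimpleGraph P}

/-! ### Convex components -/

theorem mem_edgeUnion_of_adj {p a : P} (h : G.Adj p a) : (p : ℂ) ∈ edgeUnion G :=
  mem_edgeUnion.2 ⟨s(p, a), h, left_mem_segment ℝ _ _⟩

/-- `p` is the midpoint of `p + ε u` and `p - ε u`. Most uses of convexity below produce two
opposite germs at a point of the drawing. -/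
theorem not_ger_neg {r : Set ℂ} (hc : Convex ℝ r) {p u : ℂ} (hp : p ∉ r) (h : Ger r p u) :
    ¬ Ger r p (-u) := by
  intro h'
  obtain ⟨ε, h1, h2⟩ := (h.and h').exists
  apply hp
  have := hc.midpoint_mem h1 h2
  convert this using 1
  rw [midpoint_eq_smul_add, invOf_eq_inv]
  module

theorem IsComp.ne_smul_of_ger {r : Set ℂ} (hr : IsComp G r) {p x : P} {u : ℂ} (hg : Ger r p u)
    (hx : G.Adj p x) {c : ℝ} (hc : 0 < c) : (x : ℂ) - p ≠ c • u := by
  intro h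
  have h1 : ∀ᶠ ε : ℝ in 𝓝[>] 0, ε < c := nhdsWithin_le_nhds (Iio_mem_nhds hc)
  obtain ⟨ε, ⟨h2, h3⟩, h4⟩ := ((hg.and h1).and self_mem_nhdsWithin).exists
  have h4 : 0 < ε := h4
  apply hr.subset h2
  refine mem_edgeUnion.2 ⟨s(p, x), hx, ?_⟩
  rw [edgeSeg_mk, segment_eq_image']
  refine ⟨ε / c, ⟨by positivity, (div_le_one hc).2 h3.le⟩, ?_⟩
  simp only [h, smul_smul]
  rw [div_mul_cancel₀ _ hc.ne']

variable {r : Set ℂ}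

/-- A point of `r` on the wrong side could be moved strictly to that side. Seen from the middle of
the edge, its direction would be a germ of `r` opposite to one on the side that `r` occupies. -/
theorem IsSide.pos_of_mem {σ : ℝ} (hσ : σ ≠ 0) (hr : IsComp G r) (hc : Convex ℝ r) {p a : P}
    (h : G.Adj p a) (hs : IsSide σ r p a) {y : ℂ} (hy : y ∈ r) :
    0 < σ * cr ((a : ℂ) - p) (y - p) := by
  by_contra hneg
  push Not at hneg
  obtain ⟨v, hv⟩ := exists_side_vector (coe_sub_ne_zero h.ne) hσ
  obtain ⟨δ, h1, h2⟩ := (((tendsto_ray y (-v)).eventually (hr.isOpen.mem_nhds hy)).and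
    self_mem_nhdsWithin).exists
  have h2 : 0 < δ := h2
  set m := (p : ℂ) + (1 / 2 : ℝ) • ((a : ℂ) - p)
  have hm : m ∈ openSegment ℝ (p : ℂ) a := half_mem_openSegment _ _
  have hms := openSegment_subset_segment _ _ _ hm
  have hg := ger_of_convex hr.isOpen hc (hs.mem_closure hσ (coe_ne_of_adj h).symm hm) h1
  refine not_ger_neg hc (fun hmr => hr.subset hmr (mem_edgeUnion.2 ⟨s(p, a), h, hms⟩)) hg
    (hs.ger hm ?_)
  rw [cr_neg_right, cr_sub_of_mem_segment hms, add_sub_right_comm, cr_add_right, cr_smul_right,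
    cr_neg_right]
  have := mul_pos h2 hv
  linarith

theorem IsSide.nonneg_of_mem_closure {σ : ℝ} (hσ : σ ≠ 0) (hr : IsComp G r) (hc : Convex ℝ r)
    {p a : P} (h : G.Adj p a) (hs : IsSide σ r p a) {y : ℂ} (hy : y ∈ closure r) :
    0 ≤ σ * cr ((a : ℂ) - p) (y - p) :=
  closure_minimal (fun _ hz => (hs.pos_of_mem hσ hr hc h hz).le)
    (isClosed_le continuous_const (continuous_const.mul (continuous_cr ((a : ℂ) - p) p))) hy

/-- Without neighbors on that side of `u`, all directions there would be germs of `r`. As `r` is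
open, some germ lies slightly on the other side of `u`, and its opposite would be a germ as well. -/
theorem IsComp.exists_adj_of_ger (hr : IsComp G r) (hc : Convex ℝ r) (hP : GeneralPosition P)
    {p a₀ : P} (h₀ : G.Adj p a₀) {u : ℂ} (hg : Ger r p u) {σ : ℝ} (hσ : σ ≠ 0) :
    ∃ b, G.Adj p b ∧ 0 < σ * cr u ((b : ℂ) - p) := by
  by_contra hcon
  push Not at hcon
  have hpr : (p : ℂ) ∉ r := fun h => hr.subset h (mem_edgeUnion_of_adj h₀)
  have hu : u ≠ 0 := by
    rintro rfl
    obtain ⟨ε, -, h⟩ := hg.exists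
    rw [smul_zero, add_zero] at h
    exact hpr h
  have hall : ∀ v, 0 < σ * cr u v → Ger r p v := by
    intro v hv
    refine hr.ger_of_ger hP hv (fun x hx h => ?_) hg
    have h0 : cr u ((x : ℂ) - p) = 0 :=
      (mul_eq_zero.1 (le_antisymm (hcon x hx) h.1)).resolve_left hσ
    obtain ⟨c, hcx⟩ := eq_smul_of_cr_eq_zero hu h0
    rcases lt_trichotomy c 0 with hc0 | rfl | hc0
    · have h2 := h.2
      rw [hcx, cr_smul_left] at h2
      nlinarith
    · rw [zero_smul] at hcx
      exact coe_sub_ne_zero hx.ne hcx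
    · exact hr.ne_smul_of_ger hg hx hc0 hcx
  obtain ⟨v, hv⟩ := exists_side_vector hu hσ
  obtain ⟨ε, hε, hεr⟩ := hg.exists
  obtain ⟨δ, h1, h2⟩ := (((tendsto_ray _ (-v)).eventually (hr.isOpen.mem_nhds hεr)).and
    self_mem_nhdsWithin).exists
  have h2 : 0 < δ := h2
  have hg' := ger_of_convex hr.isOpen hc hg.mem_closure h1
  refine not_ger_neg hc hpr hg' (hall _ ?_)
  rw [add_assoc, add_sub_cancel_left, cr_neg_right, cr_add_right, cr_smul_right, cr_smul_right,
    cr_neg_right, cr_self]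
  have := mul_pos h2 hv
  linarith

/-- Turn the edge slightly into the component. If no neighbor lies on this side of the edge, then
none lies on this side of the turned direction, against `IsComp.exists_adj_of_ger`. -/
theorem IsSide.exists_adj {σ : ℝ} (hσ : σ ≠ 0) (hr : IsComp G r) (hc : Convex ℝ r)
    (hP : GeneralPosition P) (hG : IsPlane G) {p a : P} (h : G.Adj p a) (hs : IsSide σ r p a) :
    ∃ b, G.Adj p b ∧ 0 < σ * orient (p : ℂ) a b := by
  by_contra hcon
  push Not at hcon
  set u := (a : ℂ) - p
  obtain ⟨v, hv⟩ := exists_side_vector (coe_sub_ne_zero h.ne) hσ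
  have hev : ∀ᶠ δ : ℝ in 𝓝[>] 0, ∀ b : P, G.Adj p b → σ * cr (u + δ • v) ((b : ℂ) - p) < 0 := by
    rw [eventually_all]
    intro b
    by_cases hb : G.Adj p b
    · by_cases hba : b = a
      · filter_upwards [self_mem_nhdsWithin] with δ hδ _
        subst hba
        have := mul_pos (Set.mem_Ioi.1 hδ) hv
        rw [cr_add_left, cr_smul_left, cr_self, cr_comm v]
        linarith
      · have h1 : σ * cr u ((b : ℂ) - p) < 0 := lt_of_le_of_ne (hcon b hb)
          (mul_ne_zero hσ (orient_ne_zero hP h.ne hb.ne (Ne.symm hba)))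
        have hcont : Continuous fun δ : ℝ => σ * cr (u + δ • v) ((b : ℂ) - p) := by
          unfold cr; fun_prop
        have := hcont.tendsto 0
        rw [zero_smul, add_zero] at this
        have h2 : ∀ᶠ δ : ℝ in 𝓝 0, σ * cr (u + δ • v) ((b : ℂ) - p) < 0 :=
          this.eventually_lt_const h1
        filter_upwards [nhdsWithin_le_nhds h2] with δ h _ using h
    · simp [hb]
  obtain ⟨δ, hδ, hδ0⟩ := (hev.and self_mem_nhdsWithin).exists
  have hg : Ger r p (u + δ • v) := (hr.isSide_iff_ger hP hG h (by
    rw [cr_add_right, cr_smul_right, cr_self]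
    have := mul_pos (Set.mem_Ioi.1 hδ0) hv
    linarith) (fun x hx hpos => absurd hpos (not_lt.2 (hcon x hx)))).1 hs
  obtain ⟨b, hb, hpos⟩ := hr.exists_adj_of_ger hc hP h hg hσ
  exact absurd hpos (not_lt.2 (hδ b hb).le)

/-- No edge lies inside the wedge, so the component along either bounding edge is the one seen from
`p` in the direction of the sum of the two edge vectors. -/
theorem Wedge.isSide_iff {p a b : P} (hw : Wedge G p a b) (hr : IsComp G r)
    (hP : GeneralPosition P) (hG : IsPlane G) : IsSide 1 r p a ↔ IsSide 1 r b p := by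
  have hab : 0 < cr ((a : ℂ) - p) ((b : ℂ) - p) := hw.pos
  set u := ((a : ℂ) - p) + ((b : ℂ) - p) with hu
  have e1 : IsSide 1 r p a ↔ Ger r p u := by
    refine hr.isSide_iff_ger hP hG hw.left ?_ fun x hx h => ?_
    · rw [hu, cr_add_right, cr_self]; linarith
    · have h1 : 0 < orient (p : ℂ) a x := by rw [orient]; linarith
      have h2 := hw.empty x hx h1
      rw [hu, cr_add_right, cr_comm ((x : ℂ) - p) ((a : ℂ) - p)]
      simp only [orient] at h1 h2
      linarith
  have e2 : IsSide (-1) r p b ↔ Ger r p u := by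
    refine hr.isSide_iff_ger hP hG hw.right ?_ fun x hx h => ?_
    · rw [hu, cr_add_right, cr_self, cr_comm]; linarith
    · have h1 : 0 < orient (p : ℂ) x b := by rw [orient, cr_comm]; linarith
      have h2 : ¬ 0 < orient (p : ℂ) a x := fun h => hw.empty x hx h h1
      rw [hu, cr_add_right, cr_comm ((x : ℂ) - p) ((a : ℂ) - p)]
      simp only [orient] at h1 h2
      linarith
  rw [e1, ← e2, isSide_swap_iff, neg_neg]

theorem IsSide.exists_wedge (hr : IsComp G r) (hc : Convex ℝ r) (hP : GeneralPosition P)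
    (hG : IsPlane G) {p a : P} (h : G.Adj p a) (hs : IsSide 1 r p a) :
    ∃ b, Wedge G p a b ∧ IsSide 1 r b p := by
  obtain ⟨x, hx, hpos⟩ := hs.exists_adj one_ne_zero hr hc hP hG h
  obtain ⟨b, hb⟩ := exists_wedge_left h hx (by linarith)
  exact ⟨b, hb, (hb.isSide_iff hr hP hG).1 hs⟩

theorem IsSide.exists_wedge_prev (hr : IsComp G r) (hc : Convex ℝ r) (hP : GeneralPosition P)
    (hG : IsPlane G) {p a : P} (h : G.Adj p a) (hs : IsSide 1 r p a) :
    ∃ x, Wedge G a x p ∧ IsSide 1 r a x := by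
  obtain ⟨y, hy, hpos⟩ := hs.swap.exists_adj (by norm_num) hr hc hP hG h.symm
  obtain ⟨x, hx⟩ := exists_wedge_right h.symm hy (by rw [orient_swap]; linarith)
  exact ⟨x, hx, (hx.isSide_iff hr hP hG).2 hs⟩

theorem Wedge.cone {p a b : P} (hw : Wedge G p a b) (hr : IsComp G r) (hc : Convex ℝ r)
    (hP : GeneralPosition P) (hG : IsPlane G) (hs : IsSide 1 r p a) {y : ℂ} (hy : y ∈ r) :
    0 < orient (p : ℂ) a y ∧ 0 < orient (p : ℂ) y b := by
  have h1 := hs.pos_of_mem one_ne_zero hr hc hw.left hy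
  have h2 := ((hw.isSide_iff hr hP hG).1 hs).pos_of_mem one_ne_zero hr hc hw.right.symm hy
  rw [one_mul] at h1 h2
  refine ⟨h1, ?_⟩
  rw [orient_rotate, orient_rotate]
  exact h2

theorem Wedge.closed_cone {p a b : P} (hw : Wedge G p a b) (hr : IsComp G r) (hc : Convex ℝ r)
    (hP : GeneralPosition P) (hG : IsPlane G) (hs : IsSide 1 r p a) {y : ℂ} (hy : y ∈ closure r) :
    0 ≤ orient (p : ℂ) a y ∧ 0 ≤ orient (p : ℂ) y b := by
  have h1 := hs.nonneg_of_mem_closure one_ne_zero hr hc hw.left hy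
  have h2 := ((hw.isSide_iff hr hP hG).1 hs).nonneg_of_mem_closure one_ne_zero hr hc
    hw.right.symm hy
  rw [one_mul] at h1 h2
  refine ⟨h1, ?_⟩
  rw [orient_rotate, orient_rotate]
  exact h2

/-- The closure of `r` lies in the closed cone of the wedge, and a cone of angle below `π` is
pointed. -/
theorem Wedge.mem_extremePoints {p a b : P} (hw : Wedge G p a b) (hr : IsComp G r) (hc : Convex ℝ r)
    (hP : GeneralPosition P) (hG : IsPlane G) (hs : IsSide 1 r p a) :
    (p : ℂ) ∈ Set.extremePoints ℝ (closure r) := by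
  refine ⟨hs.segment_subset_closure one_ne_zero (coe_ne_of_adj hw.left).symm
    (left_mem_segment ℝ _ _), fun x hx y hy hp => ?_⟩
  obtain ⟨s, t, hs0, ht0, hst, hp⟩ := hp
  have hx1 := hw.closed_cone hr hc hP hG hs hx
  have hy1 := hw.closed_cone hr hc hP hG hs hy
  obtain rfl : t = 1 - s := by linarith
  have e1 : s * orient (p : ℂ) a x + (1 - s) * orient (p : ℂ) a y = 0 := by
    have : s * orient (p : ℂ) a x + (1 - s) * orient (p : ℂ) a y =
      orient (p : ℂ) a (s • x + (1 - s) • y) := by simp [orient, cr]; ring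
    rw [this, hp, orient_self_outer]
  have e2 : s * orient (p : ℂ) x b + (1 - s) * orient (p : ℂ) y b = 0 := by
    have : s * orient (p : ℂ) x b + (1 - s) * orient (p : ℂ) y b =
      orient (p : ℂ) (s • x + (1 - s) • y) b := by simp [orient, cr]; ring
    rw [this, hp, orient_self_left]
  have f1 : s * orient (p : ℂ) a x = 0 := by
    linarith [mul_nonneg hs0.le hx1.1, mul_nonneg ht0.le hy1.1]
  have f2 : s * orient (p : ℂ) x b = 0 := by
    linarith [mul_nonneg hs0.le hx1.2, mul_nonneg ht0.le hy1.2]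
  have g1 : cr ((a : ℂ) - p) (x - p) = 0 := (mul_eq_zero.1 f1).resolve_left hs0.ne'
  have g2 : cr (x - p) ((b : ℂ) - p) = 0 := (mul_eq_zero.1 f2).resolve_left hs0.ne'
  have hab : cr ((a : ℂ) - p) ((b : ℂ) - p) ≠ 0 := hw.pos.ne'
  have := eq_combination_of_cr_ne_zero hab (x - p)
  rw [g1, g2, zero_div, zero_smul, zero_smul, add_zero, sub_eq_zero] at this
  exact this

/-- An extreme point is not in the open set `r`, so it lies on an edge. In the relative interior of
an edge it would be between the two endpoints, which are both in the closure of `r`. -/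
theorem IsComp.exists_eq_of_mem_extremePoints (hr : IsComp G r) (hc : Convex ℝ r)
    (hG : IsPlane G) {z : ℂ} (hz : z ∈ Set.extremePoints ℝ (closure r)) :
    ∃ p a : P, (p : ℂ) = z ∧ G.Adj p a := by
  have hzU : z ∈ edgeUnion G := by
    by_contra hzU
    have hzr := hr.closure_inter_subset ⟨hz.1, hzU⟩
    have hnh := hr.isOpen.mem_nhds hzr
    obtain ⟨ε, ⟨h1, h2⟩, h3⟩ := (((tendsto_ray z 1).eventually hnh).and
      ((tendsto_ray z (-1)).eventually hnh) |>.and self_mem_nhdsWithin).exists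
    have := hz.2 (subset_closure h1) (subset_closure h2)
      ⟨1 / 2, 1 / 2, by norm_num, by norm_num, by norm_num, by module⟩
    have h3 : 0 < ε := h3
    simp at this
    exact h3.ne' this
  obtain ⟨e, he, hze⟩ := mem_edgeUnion.1 hzU
  induction e using Sym2.ind with
  | _ x y =>
    have hxy : G.Adj x y := he
    by_cases hzx : z = x
    · exact ⟨x, y, hzx.symm, hxy⟩
    by_cases hzy : z = y
    · exact ⟨y, x, hzy.symm, hxy.symm⟩
    exfalso
    have hzo : z ∈ openSegment ℝ (x : ℂ) y :=
      mem_openSegment_of_ne_left_right (Ne.symm hzx) (Ne.symm hzy) hze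
    obtain ⟨w, hw⟩ := hr.nonempty
    have hg := ger_of_convex hr.isOpen hc hz.1 hw
    have hne : cr ((y : ℂ) - x) (w - z) ≠ 0 := by
      intro h0
      obtain ⟨t, ht⟩ := eq_smul_of_cr_eq_zero (coe_sub_ne_zero hxy.ne) h0
      rw [openSegment_eq_image'] at hzo
      obtain ⟨s, hs, rfl⟩ := hzo
      have hcont : Continuous fun ε : ℝ => s + ε * t := by fun_prop
      have h1 := hcont.tendsto 0
      rw [zero_mul, add_zero] at h1
      obtain ⟨ε, h2, h3⟩ := (hg.and (nhdsWithin_le_nhds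
        (h1.eventually (Ioo_mem_nhds hs.1 hs.2)))).exists
      apply hr.subset h2
      refine mem_edgeUnion.2 ⟨s(x, y), hxy, ?_⟩
      rw [edgeSeg_mk, segment_eq_image']
      refine ⟨s + ε * t, ⟨h3.1.le, h3.2.le⟩, ?_⟩
      rw [ht]
      module
    have hs := hr.isSide_of_ger hG hxy (σ := cr ((y : ℂ) - x) (w - z)) hzo
      (mul_self_pos.2 hne) hg
    have hsub := hs.segment_subset_closure hne (coe_ne_of_adj hxy).symm
    exact hzx (hz.2 (hsub (left_mem_segment ℝ _ _)) (hsub (right_mem_segment ℝ _ _)) hzo).symm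

/-- A direction into a convex component lies in one of the wedges. -/
theorem IsComp.exists_wedge_of_ger (hr : IsComp G r) (hc : Convex ℝ r) (hP : GeneralPosition P)
    (hG : IsPlane G) {p a₀ : P} (h₀ : G.Adj p a₀) {u : ℂ} (hg : Ger r p u) :
    ∃ a b, Wedge G p a b ∧ IsSide 1 r p a ∧ 0 < cr ((a : ℂ) - p) u ∧ 0 < cr u ((b : ℂ) - p) := by
  classical
  obtain ⟨x, hx, hxu⟩ := hr.exists_adj_of_ger hc hP h₀ hg (σ := -1) (by norm_num)
  -- `a` is the neighbor closest to `u` among those clockwise of `u`.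
  obtain ⟨a, ha, hlast⟩ := exists_last
    (Finset.univ.filter fun x : P => G.Adj p x ∧ 0 < cr ((x : ℂ) - p) u)
    ⟨x, by simp only [Finset.mem_filter, Finset.mem_univ, true_and]
           exact ⟨hx, by rw [cr_comm]; linarith⟩⟩
    (fun x => (x : ℂ) - p) (-u) (by
      intro y hy
      simp only [Finset.mem_filter, Finset.mem_univ, true_and] at hy
      rw [cr_neg_left, ← cr_comm]; exact hy.2)
  simp only [Finset.mem_filter, Finset.mem_univ, true_and] at ha hlast
  obtain ⟨hpa, hau⟩ := ha
  have hs : IsSide 1 r p a := by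
    refine (hr.isSide_iff_ger hP hG hpa (u := u) (by linarith) fun y hy hpos => ?_).2 hg
    rw [one_mul] at hpos ⊢
    rcases lt_trichotomy (cr ((y : ℂ) - p) u) 0 with h | h | h
    · exact h
    · have hu : u ≠ 0 := by rintro rfl; simp at hau
      obtain ⟨c, hcy⟩ := eq_smul_of_cr_eq_zero hu (by rw [cr_comm, h, neg_zero])
      exfalso
      rcases lt_trichotomy c 0 with hc0 | rfl | hc0
      · rw [hcy, cr_smul_right] at hpos
        nlinarith
      · rw [zero_smul] at hcy
        exact coe_sub_ne_zero hy.ne hcy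
      · exact hr.ne_smul_of_ger hg hy hc0 hcy
    · have := hlast y ⟨hy, h⟩
      rw [cr_comm] at this
      linarith
  obtain ⟨b, hb, -⟩ := hs.exists_wedge hr hc hP hG hpa
  obtain ⟨ε, hε, hεr⟩ := hg.exists
  have h2 := (hb.cone hr hc hP hG hs hεr).2
  rw [orient, add_sub_cancel_left, cr_smul_left] at h2
  exact ⟨a, b, hb, hs, hau, (mul_pos_iff_of_pos_left hε).1 h2⟩

theorem IsComp.exists_wedge_of_mem_closure (hr : IsComp G r) (hc : Convex ℝ r)
    (hP : GeneralPosition P) (hG : IsPlane G) {p a₀ : P} (h₀ : G.Adj p a₀)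
    (hp : (p : ℂ) ∈ closure r) : ∃ a b, Wedge G p a b ∧ IsSide 1 r p a := by
  obtain ⟨z, hz⟩ := hr.nonempty
  obtain ⟨a, b, h1, h2, -⟩ := hr.exists_wedge_of_ger hc hP hG h₀
    (ger_of_convex hr.isOpen hc hp hz)
  exact ⟨a, b, h1, h2⟩

/-- A convex component passes each of its corners only once: each of `a` and `a'` would have to lie
weakly to the left of the edge to the other one. This makes darts and corners correspond. -/
theorem IsSide.right_unique (hP : GeneralPosition P) (hr : IsComp G r) (hc : Convex ℝ r)
    {p a a' : P} (h : G.Adj p a) (h' : G.Adj p a') (hs : IsSide 1 r p a)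
    (hs' : IsSide 1 r p a') : a = a' := by
  have h1 := hs.nonneg_of_mem_closure one_ne_zero hr hc h
    (hs'.segment_subset_closure one_ne_zero (coe_ne_of_adj h').symm (right_mem_segment ℝ _ _))
  have h2 := hs'.nonneg_of_mem_closure one_ne_zero hr hc h'
    (hs.segment_subset_closure one_ne_zero (coe_ne_of_adj h).symm (right_mem_segment ℝ _ _))
  rw [one_mul] at h1 h2
  refine eq_of_orient_eq_zero hP h.ne h'.ne (le_antisymm ?_ h1)
  rw [orient_swap]
  exact neg_nonpos.2 h2

/-- The corners of a convex component are the origins of the darts with the component on their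
left. -/
theorem IsComp.mem_extremePoints_iff (hr : IsComp G r) (hc : Convex ℝ r)
    (hP : GeneralPosition P) (hG : IsPlane G) {z : ℂ} :
    z ∈ Set.extremePoints ℝ (closure r) ↔
      ∃ p a : P, (p : ℂ) = z ∧ G.Adj p a ∧ IsSide 1 r p a := by
  constructor
  · intro hz
    obtain ⟨p, a₀, rfl, h₀⟩ := hr.exists_eq_of_mem_extremePoints hc hG hz
    obtain ⟨a, b, hw, hs⟩ := hr.exists_wedge_of_mem_closure hc hP hG h₀ hz.1
    exact ⟨p, a, rfl, hw.left, hs⟩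
  · rintro ⟨p, a, rfl, h, hs⟩
    obtain ⟨b, hw, -⟩ := hs.exists_wedge hr hc hP hG h
    exact hw.mem_extremePoints hr hc hP hG hs

end

section

variable {P : Finset ℂ} {G : SimpleGraph P}

/-! ### Generic directions and connectivity -/

/-- The linear functional `cr c` separates the points. -/
def Generic (P : Finset ℂ) (c : ℂ) : Prop := ∀ p a : P, p ≠ a → cr c ((a : ℂ) - p) ≠ 0

/-- For `c = (1, δ)` each pair of distinct points excludes at most one `δ`. -/
theorem exists_generic (P : Finset ℂ) : ∃ c, Generic P c := by
  have hev : ∀ᶠ δ : ℝ in 𝓝[>] 0, ∀ p a : P, p ≠ a → cr ⟨1, δ⟩ ((a : ℂ) - p) ≠ 0 := by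
    rw [eventually_all]
    intro p
    rw [eventually_all]
    intro a
    by_cases hpa : p = a
    · simp [hpa]
    have hne := coe_sub_ne_zero hpa
    simp only [cr, one_mul]
    by_cases him : ((a : ℂ) - p).im = 0
    · have hre : ((a : ℂ) - p).re ≠ 0 := fun h => hne (Complex.ext h him)
      filter_upwards [self_mem_nhdsWithin] with δ hδ _
      rw [him, zero_sub, neg_ne_zero]
      exact mul_ne_zero (ne_of_gt (Set.mem_Ioi.1 hδ)) hre
    · have hcont : Continuous fun δ : ℝ => ((a : ℂ) - p).im - δ * ((a : ℂ) - p).re := by fun_prop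
      have h1 := hcont.tendsto 0
      rw [zero_mul, sub_zero] at h1
      have h2 : ∀ᶠ δ : ℝ in 𝓝 0, ((a : ℂ) - p).im - δ * ((a : ℂ) - p).re ≠ 0 :=
        h1.eventually_ne him
      filter_upwards [nhdsWithin_le_nhds h2] with δ h _ using h
  obtain ⟨δ, hδ⟩ := hev.exists
  exact ⟨_, hδ⟩

/-- Every edge has another edge at its endpoint on each side on which there is a point. -/
def Spread (G : SimpleGraph P) : Prop :=
  ∀ (p a : P) (σ : ℝ) (x : P), G.Adj p a → 0 < σ * orient (p : ℂ) a x →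
    ∃ b, G.Adj p b ∧ 0 < σ * orient (p : ℂ) a b

/-- If all neighbors of `p` were in the opposite half plane, `Spread` at the first and the last of
them would confine `x` to the cone between these two, which is in the opposite half plane too. -/
theorem Spread.exists_adj_right (hG : Spread G) (hP : GeneralPosition P) {c : ℂ}
    (hc : Generic P c) {p a₀ x : P} (h₀ : G.Adj p a₀) (hx : 0 < cr c ((x : ℂ) - p)) :
    ∃ b, G.Adj p b ∧ 0 < cr c ((b : ℂ) - p) := by
  classical
  by_contra hcon
  push Not at hcon
  have hlt : ∀ b, G.Adj p b → cr c ((b : ℂ) - p) < 0 := fun b hb =>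
    lt_of_le_of_ne (hcon b hb) (hc p b hb.ne)
  have hne : (Finset.univ.filter fun b => G.Adj p b).Nonempty := ⟨a₀, by simpa using h₀⟩
  have hneg : ∀ b ∈ Finset.univ.filter (fun b => G.Adj p b), 0 < cr (-c) ((b : ℂ) - p) := by
    intro b hb
    rw [cr_neg_left]
    linarith [hlt b (by simpa using hb)]
  obtain ⟨a, ha, hlast⟩ := exists_last _ hne (fun b : P => (b : ℂ) - p) (-c) hneg
  obtain ⟨a', ha', hfirst⟩ := exists_first _ hne (fun b : P => (b : ℂ) - p) (-c) hneg
  simp only [Finset.mem_filter, Finset.mem_univ, true_and] at ha hlast ha' hfirst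
  have h1 : orient (p : ℂ) a x ≤ 0 := by
    by_contra h
    obtain ⟨b, hb, hpos⟩ := hG p a 1 x ha (by linarith)
    have h2 : 0 ≤ orient (p : ℂ) b a := hlast b hb
    rw [orient_swap] at h2
    linarith
  have h2 : 0 ≤ orient (p : ℂ) a' x := by
    by_contra h
    obtain ⟨b, hb, hpos⟩ := hG p a' (-1) x ha' (by linarith)
    have h2 : 0 ≤ orient (p : ℂ) a' b := hfirst b hb
    linarith
  have h3 : 0 ≤ orient (p : ℂ) a' a := hfirst a ha
  have key : orient (p : ℂ) a' a * cr c ((x : ℂ) - p) =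
      -orient (p : ℂ) a x * cr c ((a' : ℂ) - p) + orient (p : ℂ) a' x * cr c ((a : ℂ) - p) := by
    simp only [orient, cr]; ring
  have hxp : p ≠ x := by rintro rfl; simp at hx
  have haa : a' = a := by
    refine eq_of_orient_eq_zero hP ha'.ne ha.ne (le_antisymm ?_ h3)
    by_contra h
    nlinarith [hlt a ha, hlt a' ha', mul_pos (not_le.1 h) hx]
  subst haa
  have : a' = x := eq_of_orient_eq_zero hP ha.ne hxp (le_antisymm h1 h2)
  subst this
  linarith [hlt _ ha]

/-- Steps that increase the functional end at its maximum, so every point is connected with the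
maximum. -/
theorem connected_of_exists_adj_right (hne : P.Nonempty) {c : ℂ} (hc : Generic P c)
    (h : ∀ p x : P, 0 < cr c ((x : ℂ) - p) → ∃ b, G.Adj p b ∧ 0 < cr c ((b : ℂ) - p)) :
    G.Connected := by
  obtain ⟨p₀, hp₀⟩ := hne
  obtain ⟨q, -, hq⟩ := Finset.exists_max_image Finset.univ (fun p : P => cr c p)
    ⟨⟨p₀, hp₀⟩, Finset.mem_univ _⟩
  have hreach : ∀ p : P, G.Reachable p q := by
    intro p
    let rel : P → P → Prop := fun a b => cr c b < cr c a
    have : IsTrans P rel := ⟨fun a b c h1 h2 => lt_trans h2 h1⟩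
    have : Std.Irrefl rel := ⟨fun a => lt_irrefl _⟩
    have wf : WellFounded rel := Finite.wellFounded_of_trans_of_irrefl rel
    induction p using wf.induction with
    | _ p ih =>
      by_cases hpq : p = q
      · rw [hpq]
      · have h1 : 0 < cr c ((q : ℂ) - p) := by
          refine lt_of_le_of_ne ?_ (hc p q hpq).symm
          rw [cr_sub_right]
          linarith [hq p (Finset.mem_univ _)]
        obtain ⟨b, hb, hpos⟩ := h p q h1
        rw [cr_sub_right] at hpos
        exact hb.reachable.trans (ih b (by simpa [rel] using by linarith))
  have : Nonempty P := ⟨q⟩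
  exact ⟨fun a b => (hreach a).trans (hreach b).symm⟩

/-! ### Neighbors on both sides of an edge in a full subdivision -/

namespace IsFullSubdivision

variable {S : SimpleGraph P}

theorem exists_region (hS : IsFullSubdivision S) (hP : GeneralPosition P) (hn : 3 ≤ P.card)
    {p a x : P} (h : S.Adj p a) (hx : 0 < orient (p : ℂ) a x) :
    ∃ r ∈ regions S, IsSide 1 r p a := by
  obtain ⟨r, hr, hs⟩ := exists_isSide hS.plane h one_ne_zero
  exact ⟨r, hr.mem_regions_of_isSide hP hn hS.hull hx hs, hs⟩

/-- A point beside the line `pa` guarantees that the component on that side of the edge is a region,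
hence convex, and a convex region has an angle below `π` at `p`. -/
theorem spread (hS : IsFullSubdivision S) (hP : GeneralPosition P) (hn : 3 ≤ P.card) :
    Spread S := by
  intro p a σ x h hx
  rcases lt_trichotomy σ 0 with hσ | rfl | hσ
  · have h1 : 0 < orient (a : ℂ) p x := by rw [orient_swap_left]; nlinarith
    obtain ⟨r, hr, hs⟩ := hS.exists_region hP hn h.symm h1
    obtain ⟨b, hb, hpos⟩ := hs.swap.exists_adj (by norm_num) hr.2 (hS.convex r hr) hP hS.plane h
    exact ⟨b, hb, by nlinarith⟩
  · simp at hx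
  · have h1 : 0 < orient (p : ℂ) a x := (mul_pos_iff_of_pos_left hσ).1 hx
    obtain ⟨r, hr, hs⟩ := hS.exists_region hP hn h h1
    obtain ⟨b, hb, hpos⟩ := hs.exists_adj one_ne_zero hr.2 (hS.convex r hr) hP hS.plane h
    exact ⟨b, hb, by nlinarith⟩

theorem exists_adj (hS : IsFullSubdivision S) (hn : 3 ≤ P.card) (p : P) : ∃ a, S.Adj p a := by
  obtain ⟨x, hx, -⟩ := exists_third hn p p
  have : Nontrivial P := ⟨x, p, hx⟩
  exact hS.connected.preconnected.exists_adj_of_nontrivial p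

theorem exists_adj_right (hS : IsFullSubdivision S) (hP : GeneralPosition P) (hn : 3 ≤ P.card)
    {c : ℂ} (hc : Generic P c) {p x : P} (hx : 0 < cr c ((x : ℂ) - p)) :
    ∃ b, S.Adj p b ∧ 0 < cr c ((b : ℂ) - p) := by
  obtain ⟨a, ha⟩ := hS.exists_adj hn p
  exact (hS.spread hP hn).exists_adj_right hP hc ha hx

end IsFullSubdivision

end

section

variable {P : Finset ℂ} {G : SimpleGraph P}

/-! ### Counting darts, corners and regions -/

open Classical in
/-- The component to the left of a dart. -/
def leftComp (G : SimpleGraph P) (d : P × P) : Set ℂ :=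
  if h : ∃ r, IsComp G r ∧ IsSide 1 r d.1 d.2 then h.choose else ∅

theorem leftComp_spec (hG : IsPlane G) {d : P × P} (h : G.Adj d.1 d.2) :
    IsComp G (leftComp G d) ∧ IsSide 1 (leftComp G d) d.1 d.2 := by
  have h' := exists_isSide hG h (one_ne_zero (α := ℝ))
  rw [leftComp, dif_pos h']
  exact h'.choose_spec

theorem leftComp_eq (hG : IsPlane G) {d : P × P} (h : G.Adj d.1 d.2) {r : Set ℂ}
    (hr : IsComp G r) (hs : IsSide 1 r d.1 d.2) : leftComp G d = r :=
  (leftComp_spec hG h).2.unique one_ne_zero (leftComp_spec hG h).1 hr (coe_ne_of_adj h).symm hs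

open Classical in
/-- All darts. -/
def darts (G : SimpleGraph P) : Finset (P × P) := Finset.univ.filter fun d => G.Adj d.1 d.2

open Classical in
/-- The darts with a point on their left. -/
def innerDarts (G : SimpleGraph P) : Finset (P × P) :=
  (darts G).filter fun d => ∃ x : P, 0 < orient (d.1 : ℂ) d.2 x

open Classical in
/-- The darts along which the functional `cr c` increases. -/
def rightDarts (G : SimpleGraph P) (c : ℂ) : Finset (P × P) :=
  (darts G).filter fun d => 0 < cr c ((d.2 : ℂ) - d.1)

theorem mem_darts {d : P × P} : d ∈ darts G ↔ G.Adj d.1 d.2 := by simp [darts]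

theorem mem_innerDarts {d : P × P} :
    d ∈ innerDarts G ↔ G.Adj d.1 d.2 ∧ ∃ x : P, 0 < orient (d.1 : ℂ) d.2 x := by
  rw [innerDarts, Finset.mem_filter, mem_darts]

theorem mem_rightDarts {c : ℂ} {d : P × P} :
    d ∈ rightDarts G c ↔ G.Adj d.1 d.2 ∧ 0 < cr c ((d.2 : ℂ) - d.1) := by
  rw [rightDarts, Finset.mem_filter, mem_darts]

theorem card_rightDarts {c : ℂ} (hc : Generic P c) : (rightDarts G c).card = G.edgeSet.ncard := by
  rw [← Set.ncard_coe_finset]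
  refine Set.ncard_congr (fun d _ => s(d.1, d.2)) ?_ ?_ ?_
  · intro d hd
    exact (mem_rightDarts.1 hd).1
  · rintro ⟨p, a⟩ ⟨p', a'⟩ hd hd' h
    have h1 := (mem_rightDarts.1 hd).2
    have h2 := (mem_rightDarts.1 hd').2
    rcases Sym2.eq_iff.1 h with ⟨rfl, rfl⟩ | ⟨rfl, rfl⟩
    · rfl
    · simp only [cr_sub_right] at h1 h2
      linarith
  · intro e he
    induction e using Sym2.ind with
    | _ p a =>
      have ha : G.Adj p a := he
      rcases lt_or_gt_of_ne (hc p a ha.ne) with h | h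
      · refine ⟨(a, p), mem_rightDarts.2 ⟨ha.symm, ?_⟩, Sym2.eq_swap⟩
        simp only [cr_sub_right] at h ⊢
        linarith
      · exact ⟨(p, a), mem_rightDarts.2 ⟨ha, h⟩, rfl⟩

theorem card_darts {c : ℂ} (hc : Generic P c) : (darts G).card = 2 * (rightDarts G c).card := by
  classical
  have h1 := Finset.card_filter_add_card_filter_not (s := darts G)
    (fun d : P × P => 0 < cr c ((d.2 : ℂ) - d.1))
  have h2 : ((darts G).filter fun d => ¬ 0 < cr c ((d.2 : ℂ) - d.1)).card =
      (rightDarts G c).card := by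
    refine Finset.card_bij (fun d _ => d.swap) ?_ ?_ ?_
    · rintro ⟨p, a⟩ hd
      rw [Finset.mem_filter, mem_darts] at hd
      refine mem_rightDarts.2 ⟨hd.1.symm, lt_of_le_of_ne ?_ (hc _ _ hd.1.ne.symm).symm⟩
      have := hd.2
      simp only [cr_sub_right, Prod.fst_swap, Prod.snd_swap] at this ⊢
      linarith
    · intro d _ d' _ h
      exact Prod.swap_injective h
    · rintro ⟨p, a⟩ hd
      rw [mem_rightDarts] at hd
      refine ⟨(a, p), ?_, rfl⟩
      rw [Finset.mem_filter, mem_darts]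
      refine ⟨hd.1.symm, ?_⟩
      have := hd.2
      simp only [cr_sub_right] at this ⊢
      linarith
  have h3 : ((darts G).filter fun d => 0 < cr c ((d.2 : ℂ) - d.1)).card =
      (rightDarts G c).card := by
    rw [rightDarts]
  omega

/-- A dart without a point on its left is a hull dart, and exactly one hull dart starts at each
extreme point. -/
theorem card_innerDarts (hP : GeneralPosition P) (hn : 3 ≤ P.card)
    (hH : hullEdges P ⊆ G.edgeSet) : (innerDarts G).card + extNum P = (darts G).card := by
  classical
  have h1 := Finset.card_filter_add_card_filter_not (s := darts G)
    (fun d : P × P => ∃ x : P, 0 < orient (d.1 : ℂ) d.2 x)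
  have h2 : ((darts G).filter fun d => ¬ ∃ x : P, 0 < orient (d.1 : ℂ) d.2 x).card =
      extNum P := by
    rw [← Set.ncard_coe_finset, extNum]
    have hmem : ∀ d : P × P, d ∈ ((darts G).filter fun d => ¬ ∃ x : P,
        0 < orient (d.1 : ℂ) d.2 x) ↔ IsHullDart d.1 d.2 := by
      intro d
      rw [Finset.mem_filter, mem_darts]
      constructor
      · rintro ⟨h1, h2⟩
        push Not at h2
        exact ⟨h1.ne, h2⟩
      · rintro h
        refine ⟨hH (mem_hullEdges_iff.2 (Or.inl h)), ?_⟩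
        push Not
        exact h.2
    refine Set.ncard_congr (fun d _ => d.1) ?_ ?_ ?_
    · intro d hd
      exact (mem_extPts_iff hP hn).2 ⟨d.2, (hmem d).1 hd⟩
    · rintro ⟨p, a⟩ ⟨p', a'⟩ hd hd' h
      obtain rfl : p = p' := h
      have e1 : IsHullDart p a := (hmem _).1 hd
      have e2 : IsHullDart p a' := (hmem _).1 hd'
      rw [e1.unique hP e2]
    · intro p hp
      obtain ⟨a, ha⟩ := (mem_extPts_iff hP hn).1 hp
      exact ⟨(p, a), (hmem _).2 ha, rfl⟩
  have h3 : ((darts G).filter fun d => ∃ x : P, 0 < orient (d.1 : ℂ) d.2 x).card =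
      (innerDarts G).card := by
    rw [innerDarts]
  omega

theorem ncard_hullEdges (hP : GeneralPosition P) (hn : 3 ≤ P.card) :
    (hullEdges P).ncard = extNum P := by
  rw [extNum]
  symm
  have hex : ∀ p ∈ extPts P, ∃ a, IsHullDart p a := fun p hp => (mem_extPts_iff hP hn).1 hp
  refine Set.ncard_congr (fun p hp => s(p, (hex p hp).choose)) ?_ ?_ ?_
  · intro p hp
    exact mem_hullEdges_iff.2 (Or.inl (hex p hp).choose_spec)
  · intro p p' hp hp' h
    rcases Sym2.eq_iff.1 h with ⟨h1, -⟩ | ⟨h1, h2⟩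
    · exact h1
    · have e1 := (hex p hp).choose_spec
      have e2 := (hex p' hp').choose_spec
      rw [h2] at e1
      rw [← h1] at e2
      exact absurd e2 (e1.not_swap hP hn)
  · intro e he
    induction e using Sym2.ind with
    | _ p a =>
      rcases mem_hullEdges_iff.1 he with h | h
      · have hp := (mem_extPts_iff hP hn).2 ⟨a, h⟩
        refine ⟨p, hp, ?_⟩
        rw [((hex p hp).choose_spec).unique hP h]
      · have hp := (mem_extPts_iff hP hn).2 ⟨p, h⟩
        refine ⟨a, hp, ?_⟩
        rw [((hex a hp).choose_spec).unique hP h, Sym2.eq_swap]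

theorem ncard_innerEdges (hP : GeneralPosition P) (hn : 3 ≤ P.card)
    (hH : hullEdges P ⊆ G.edgeSet) :
    (innerEdges G).ncard + extNum P = G.edgeSet.ncard := by
  rw [← ncard_hullEdges hP hn, innerEdges]
  exact Set.ncard_sdiff_add_ncard_of_subset hH

open Classical in
/-- The regions of a full subdivision, as a finite set. -/
def regionFinset (G : SimpleGraph P) : Finset (Set ℂ) := (innerDarts G).image (leftComp G)

/-! ### Regions, corners and Euler's formula -/

namespace IsFullSubdivision

variable {S : SimpleGraph P} {r : Set ℂ}

theorem isComp_leftComp (hS : IsFullSubdivision S) {d : P × P} (hd : d ∈ innerDarts S) :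
    IsComp S (leftComp S d) ∧ IsSide 1 (leftComp S d) d.1 d.2 :=
  leftComp_spec hS.plane (mem_innerDarts.1 hd).1

theorem leftComp_mem_regions (hS : IsFullSubdivision S) (hP : GeneralPosition P)
    (hn : 3 ≤ P.card) {d : P × P} (hd : d ∈ innerDarts S) : leftComp S d ∈ regions S := by
  obtain ⟨-, x, hx⟩ := mem_innerDarts.1 hd
  exact (hS.isComp_leftComp hd).1.mem_regions_of_isSide hP hn hS.hull hx (hS.isComp_leftComp hd).2

theorem exists_wedge (hS : IsFullSubdivision S) (hP : GeneralPosition P)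
    (hr : r ∈ regions S) {p a : P} (h : S.Adj p a) (hs : IsSide 1 r p a) :
    ∃ b, Wedge S p a b ∧ IsSide 1 r b p :=
  hs.exists_wedge hr.2 (hS.convex r hr) hP hS.plane h

theorem mem_innerDarts_of_isSide (hS : IsFullSubdivision S) (hP : GeneralPosition P)
    (hr : r ∈ regions S) {p a : P} (h : S.Adj p a)
    (hs : IsSide 1 r p a) : (p, a) ∈ innerDarts S ∧ leftComp S (p, a) = r := by
  obtain ⟨b, hw, -⟩ := hS.exists_wedge hP hr h hs
  exact ⟨mem_innerDarts.2 ⟨h, b, hw.pos⟩, leftComp_eq hS.plane (d := (p, a)) h hr.2 hs⟩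

theorem exists_isSide_of_region (hS : IsFullSubdivision S) (hP : GeneralPosition P)
    (hr : r ∈ regions S) : ∃ p a, S.Adj p a ∧ IsSide 1 r p a := by
  have hcomp : IsCompact (closure r) := hr.1.isCompact_closure
  obtain ⟨z, hz⟩ := hcomp.extremePoints_nonempty (IsComp.nonempty hr.2).closure
  obtain ⟨p, a, -, h⟩ :=
    (IsComp.mem_extremePoints_iff hr.2 (hS.convex r hr) hP hS.plane).1 hz
  exact ⟨p, a, h⟩

theorem coe_regionFinset (hS : IsFullSubdivision S) (hP : GeneralPosition P)
    (hn : 3 ≤ P.card) : (regionFinset S : Set (Set ℂ)) = regions S := by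
  ext r
  rw [regionFinset, Finset.coe_image]
  constructor
  · rintro ⟨d, hd, rfl⟩
    exact hS.leftComp_mem_regions hP hn hd
  · intro hr
    obtain ⟨p, a, h, hs⟩ := hS.exists_isSide_of_region hP hr
    have := hS.mem_innerDarts_of_isSide hP hr h hs
    exact ⟨(p, a), this.1, this.2⟩

theorem mem_regionFinset (hS : IsFullSubdivision S) (hP : GeneralPosition P)
    (hn : 3 ≤ P.card) : r ∈ regionFinset S ↔ r ∈ regions S := by
  rw [← hS.coe_regionFinset hP hn, Finset.mem_coe]

-- A corner is matched with the unique dart that starts there and has `r` on its left.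
open Classical in
theorem corners_eq (hS : IsFullSubdivision S) (hP : GeneralPosition P)
    (hr : r ∈ regions S) :
    corners r = ((innerDarts S).filter fun d => leftComp S d = r).card := by
  rw [corners, ← Set.ncard_coe_finset]
  symm
  have hside : ∀ d ∈ (innerDarts S).filter (fun d => leftComp S d = r),
      S.Adj d.1 d.2 ∧ IsSide 1 r d.1 d.2 := by
    intro d hd
    rw [Finset.mem_filter] at hd
    have := (hS.isComp_leftComp hd.1).2
    rw [hd.2] at this
    exact ⟨(mem_innerDarts.1 hd.1).1, this⟩
  refine Set.ncard_congr (fun d _ => (d.1 : ℂ)) ?_ ?_ ?_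
  · intro d hd
    obtain ⟨h, hs⟩ := hside d hd
    exact (IsComp.mem_extremePoints_iff hr.2 (hS.convex r hr) hP hS.plane).2
      ⟨d.1, d.2, rfl, h, hs⟩
  · rintro ⟨p, a⟩ ⟨p', a'⟩ hd hd' h
    obtain rfl : p = p' := Subtype.ext h
    obtain ⟨h1, hs1⟩ := hside _ hd
    obtain ⟨h2, hs2⟩ := hside _ hd'
    exact Prod.ext rfl (hs1.right_unique hP hr.2 (hS.convex r hr) h1 h2 hs2)
  · intro z hz
    obtain ⟨p, a, rfl, h, hs⟩ :=
      (IsComp.mem_extremePoints_iff hr.2 (hS.convex r hr) hP hS.plane).1 hz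
    have := hS.mem_innerDarts_of_isSide hP hr h hs
    refine ⟨(p, a), ?_, rfl⟩
    rw [Finset.mem_coe, Finset.mem_filter]
    exact this

theorem sum_corners (hS : IsFullSubdivision S) (hP : GeneralPosition P)
    (hn : 3 ≤ P.card) : ∑ r ∈ regionFinset S, corners r = (innerDarts S).card := by
  classical
  rw [regionFinset, Finset.card_eq_sum_card_image (leftComp S)]
  refine Finset.sum_congr rfl fun r hr => ?_
  rw [hS.corners_eq hP ((hS.mem_regionFinset hP hn).1 (by rw [regionFinset]; convert hr))]

theorem mem_extremePoints_of_wedge (hS : IsFullSubdivision S) (hP : GeneralPosition P)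
    (hr : r ∈ regions S) {p a b : P} (hw : Wedge S p a b)
    (hs : IsSide 1 r p a) : (p : ℂ) ∈ Set.extremePoints ℝ (closure r) ∧
      (a : ℂ) ∈ Set.extremePoints ℝ (closure r) ∧ (b : ℂ) ∈ Set.extremePoints ℝ (closure r) := by
  have hiff := fun {z} => IsComp.mem_extremePoints_iff hr.2 (hS.convex r hr) hP
    hS.plane (z := z)
  obtain ⟨x, hx, hsx⟩ := hs.exists_wedge_prev hr.2 (hS.convex r hr) hP hS.plane hw.left
  exact ⟨hiff.2 ⟨p, a, rfl, hw.left, hs⟩, hiff.2 ⟨a, x, rfl, hx.left, hsx⟩,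
    hiff.2 ⟨b, p, rfl, hw.right.symm, (hw.isSide_iff hr.2 hP hS.plane).1 hs⟩⟩

theorem finite_extremePoints (hS : IsFullSubdivision S) (hP : GeneralPosition P)
    (hr : r ∈ regions S) :
    (Set.extremePoints ℝ (closure r)).Finite := by
  refine (P.finite_toSet).subset fun z hz => ?_
  obtain ⟨p, a, rfl, -⟩ :=
    (IsComp.mem_extremePoints_iff hr.2 (hS.convex r hr) hP hS.plane).1 hz
  exact p.2

theorem three_le_corners (hS : IsFullSubdivision S) (hP : GeneralPosition P)
    (hr : r ∈ regions S) : 3 ≤ corners r := by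
  obtain ⟨p, a, h, hs⟩ := hS.exists_isSide_of_region hP hr
  obtain ⟨b, hw, -⟩ := hS.exists_wedge hP hr h hs
  obtain ⟨h1, h2, h3⟩ := hS.mem_extremePoints_of_wedge hP hr hw hs
  have hab : (a : ℂ) ≠ b := by
    intro hab
    have := hw.pos
    rw [hab, orient_self_right] at this
    exact lt_irrefl _ this
  have hsub : ({(p : ℂ), (a : ℂ), (b : ℂ)} : Set ℂ) ⊆ Set.extremePoints ℝ (closure r) := by
    rintro z (rfl | rfl | rfl)
    · exact h1
    · exact h2
    · exact h3
  have := Set.ncard_le_ncard hsub (hS.finite_extremePoints hP hr)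
  rwa [Set.ncard_eq_three.2 ⟨_, _, _, (coe_ne_of_adj hw.left).symm,
    (coe_ne_of_adj hw.right).symm, hab, rfl⟩] at this

/-- Euler's formula: the number of regions. -/
theorem card_regionFinset (hS : IsFullSubdivision S) (hP : GeneralPosition P)
    (hn : 3 ≤ P.card) : (regionFinset S).card + P.card = S.edgeSet.ncard + 1 := by
  classical
  obtain ⟨c, hc⟩ := exists_generic P
  obtain ⟨p₀, hp₀⟩ : P.Nonempty := Finset.card_pos.1 (by omega)
  obtain ⟨q, -, hq⟩ := Finset.exists_max_image Finset.univ (fun p : P => cr c p)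
    ⟨⟨p₀, hp₀⟩, Finset.mem_univ _⟩
  -- The increasing darts are split by whether another increasing dart at the same origin lies to
  -- their left. Those with one correspond to the regions, by their minimal corners; the others
  -- correspond to the points other than the maximum `q`.
  let RS : P × P → Prop := fun d => ∃ b, S.Adj d.1 b ∧ 0 < cr c ((b : ℂ) - d.1) ∧
    0 < orient (d.1 : ℂ) d.2 b
  have h1 := Finset.card_filter_add_card_filter_not (s := rightDarts S c) RS
  have h2 : ((rightDarts S c).filter RS).card = (regionFinset S).card := by
    have hprop : ∀ d ∈ (rightDarts S c).filter RS, d ∈ innerDarts S ∧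
        ∀ y ∈ closure (leftComp S d), 0 ≤ cr c (y - d.1) := by
      rintro ⟨p, a⟩ hd
      rw [Finset.mem_filter, mem_rightDarts] at hd
      obtain ⟨⟨ha, hca⟩, b', hb', hcb', hor⟩ := hd
      dsimp only at ha hca hb' hcb' hor
      have hd : (p, a) ∈ innerDarts S := mem_innerDarts.2 ⟨ha, b', hor⟩
      refine ⟨hd, fun y hy => ?_⟩
      have hr := hS.leftComp_mem_regions hP hn hd
      have hs : IsSide 1 (leftComp S (p, a)) p a := (hS.isComp_leftComp hd).2
      obtain ⟨b, hw, -⟩ := hS.exists_wedge hP hr ha hs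
      have h3 := hw.empty b' hb' hor
      -- The successor `b` of `a` does not come after `b'`, so `pb` is increasing as well. Then the
      -- functional is nonnegative on the cone of the region at `p`, and `p` is its minimal corner.
      have hcb : 0 < cr c ((b : ℂ) - p) := by
        have key : orient (p : ℂ) a b' * cr c ((b : ℂ) - p) =
          -orient (p : ℂ) b' b * cr c ((a : ℂ) - p) +
            orient (p : ℂ) a b * cr c ((b' : ℂ) - p) := by simp only [orient, cr]; ring
        have h4 := mul_pos hw.pos hcb'
        have h5 : 0 ≤ -orient (p : ℂ) b' b * cr c ((a : ℂ) - p) :=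
          mul_nonneg (by linarith) hca.le
        exact (mul_pos_iff_of_pos_left hor).1 (by linarith)
      obtain ⟨h6, h7⟩ := hw.closed_cone hr.2 (hS.convex _ hr) hP hS.plane hs hy
      have key : orient (p : ℂ) a b * cr c (y - p) =
          orient (p : ℂ) y b * cr c ((a : ℂ) - p) + orient (p : ℂ) a y * cr c ((b : ℂ) - p) := by
        simp only [orient, cr]; ring
      refine nonneg_of_mul_nonneg_right (b := _) ?_ hw.pos
      rw [key]
      exact add_nonneg (mul_nonneg h7 hca.le) (mul_nonneg h6 hcb.le)
    refine Finset.card_bij (fun d _ => leftComp S d) ?_ ?_ ?_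
    · intro d hd
      exact (hS.mem_regionFinset hP hn).2 (hS.leftComp_mem_regions hP hn (hprop d hd).1)
    · rintro ⟨p, a⟩ hd ⟨p', a'⟩ hd' heq
      obtain ⟨hi, hmin⟩ := hprop _ hd
      obtain ⟨hi', hmin'⟩ := hprop _ hd'
      have hs := (hS.isComp_leftComp hi).2
      have hs' := (hS.isComp_leftComp hi').2
      have ha := (mem_innerDarts.1 hi).1
      have ha' := (mem_innerDarts.1 hi').1
      have hr := hS.leftComp_mem_regions hP hn hi
      dsimp only at heq hs hs' ha ha' hmin hmin'
      rw [← heq] at hs' hmin'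
      have m1 := hmin _ (hs'.segment_subset_closure one_ne_zero (coe_ne_of_adj ha').symm
        (left_mem_segment ℝ _ _))
      have m2 := hmin' _ (hs.segment_subset_closure one_ne_zero (coe_ne_of_adj ha).symm
        (left_mem_segment ℝ _ _))
      have hpp : p = p' := by
        by_contra hne
        apply hc p p' hne
        rw [cr_sub_right] at m1 m2 ⊢
        linarith
      subst hpp
      rw [hs.right_unique hP hr.2 (hS.convex _ hr) ha ha' hs']
    · intro r hr
      have hr' := (hS.mem_regionFinset hP hn).1 hr
      obtain ⟨p₁, a₁, h₁, hs₁⟩ := hS.exists_isSide_of_region hP hr'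
      obtain ⟨p, hp, hmin⟩ := Finset.exists_min_image
        (Finset.univ.filter fun p : P => ∃ a, S.Adj p a ∧ IsSide 1 r p a) (fun p : P => cr c p)
        ⟨p₁, by simp only [Finset.mem_filter, Finset.mem_univ, true_and]; exact ⟨a₁, h₁, hs₁⟩⟩
      simp only [Finset.mem_filter, Finset.mem_univ, true_and] at hp hmin
      obtain ⟨a, ha, hs⟩ := hp
      obtain ⟨b, hw, hsb⟩ := hS.exists_wedge hP hr' ha hs
      obtain ⟨x, hx, hsx⟩ := hs.exists_wedge_prev hr'.2 (hS.convex r hr') hP hS.plane ha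
      have ca : 0 < cr c ((a : ℂ) - p) := by
        refine lt_of_le_of_ne ?_ (hc p a ha.ne).symm
        rw [cr_sub_right]
        linarith [hmin a ⟨x, hx.left, hsx⟩]
      have cb : 0 < cr c ((b : ℂ) - p) := by
        refine lt_of_le_of_ne ?_ (hc p b hw.right.ne).symm
        rw [cr_sub_right]
        linarith [hmin b ⟨p, hw.right.symm, hsb⟩]
      refine ⟨(p, a), ?_, leftComp_eq hS.plane (d := (p, a)) ha hr'.2 hs⟩
      rw [Finset.mem_filter, mem_rightDarts]
      exact ⟨⟨ha, ca⟩, b, hw.right, cb, hw.pos⟩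
  -- Each point except `q` has an increasing dart, hence exactly one counterclockwise last
  -- increasing dart.
  have h3 : ((rightDarts S c).filter fun d => ¬ RS d).card = (Finset.univ.erase q).card := by
    refine Finset.card_bij (fun d _ => d.1) ?_ ?_ ?_
    · rintro ⟨p, a⟩ hd
      rw [Finset.mem_filter, mem_rightDarts] at hd
      rw [Finset.mem_erase]
      refine ⟨?_, Finset.mem_univ _⟩
      rintro rfl
      have := hd.1.2
      rw [cr_sub_right] at this
      linarith [hq a (Finset.mem_univ _)]
    · rintro ⟨p, a⟩ hd ⟨p', a'⟩ hd' h
      obtain rfl : p = p' := h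
      rw [Finset.mem_filter, mem_rightDarts] at hd hd'
      obtain ⟨⟨h1, h2⟩, h3⟩ := hd
      obtain ⟨⟨h1', h2'⟩, h3'⟩ := hd'
      dsimp only at h1 h2 h1' h2'
      have e1 : orient (p : ℂ) a a' ≤ 0 := not_lt.1 fun h => h3 ⟨a', h1', h2', h⟩
      have e2 : orient (p : ℂ) a' a ≤ 0 := not_lt.1 fun h => h3' ⟨a, h1, h2, h⟩
      rw [orient_swap] at e2
      rw [eq_of_orient_eq_zero hP h1.ne h1'.ne (le_antisymm e1 (by linarith))]
    · intro p hp
      have hpq := (Finset.mem_erase.1 hp).1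
      have hpos : 0 < cr c ((q : ℂ) - p) := by
        refine lt_of_le_of_ne ?_ (hc p q hpq).symm
        rw [cr_sub_right]
        linarith [hq p (Finset.mem_univ _)]
      obtain ⟨b, hb, hcb⟩ := hS.exists_adj_right hP hn hc hpos
      obtain ⟨a, ha, hlast⟩ := exists_last
        (Finset.univ.filter fun b : P => S.Adj p b ∧ 0 < cr c ((b : ℂ) - p))
        ⟨b, by simp only [Finset.mem_filter, Finset.mem_univ, true_and]; exact ⟨hb, hcb⟩⟩
        (fun b : P => (b : ℂ) - p) c (by
          intro y hy
          simp only [Finset.mem_filter, Finset.mem_univ, true_and] at hy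
          exact hy.2)
      simp only [Finset.mem_filter, Finset.mem_univ, true_and] at ha hlast
      refine ⟨(p, a), ?_, rfl⟩
      rw [Finset.mem_filter, mem_rightDarts]
      refine ⟨ha, ?_⟩
      rintro ⟨b, hb, hcb, hor⟩
      have := hlast b ⟨hb, hcb⟩
      have h' : 0 ≤ orient (p : ℂ) b a := this
      rw [orient_swap] at h'
      dsimp only at hor
      linarith
  rw [Finset.card_erase_of_mem (Finset.mem_univ q), Finset.card_univ, Fintype.card_coe] at h3
  rw [card_rightDarts hc] at h1
  omega

theorem slack_eq_sum (hS : IsFullSubdivision S) (hP : GeneralPosition P)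
    (hn : 3 ≤ P.card) : slack S = ∑ r ∈ regionFinset S, regionSlack r := by
  rw [slack, ← hS.coe_regionFinset hP hn, finsum_mem_coe_finset]

theorem refinedSlack_eq_sum (hS : IsFullSubdivision S) (hP : GeneralPosition P)
    (hn : 3 ≤ P.card) : refinedSlack S = ∑ r ∈ regionFinset S, regionRefinedSlack r := by
  rw [refinedSlack, ← hS.coe_regionFinset hP hn, finsum_mem_coe_finset]

theorem slack_add (hS : IsFullSubdivision S) (hP : GeneralPosition P)
    (hn : 3 ≤ P.card) : slack S + 3 * (regionFinset S).card = (innerDarts S).card := by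
  rw [hS.slack_eq_sum hP hn, ← hS.sum_corners hP hn]
  simp only [regionSlack, Finset.sum_sub_distrib, Finset.sum_const, nsmul_eq_mul]
  push_cast
  ring

theorem innerDarts_add (hS : IsFullSubdivision S) (hP : GeneralPosition P)
    (hn : 3 ≤ P.card) : (innerDarts S).card + extNum P = 2 * S.edgeSet.ncard := by
  obtain ⟨c, hc⟩ := exists_generic P
  rw [card_innerDarts hP hn hS.hull, card_darts hc, card_rightDarts hc]

/-- Counting corners gives D + 3 regions = 2 edges - h; Euler's formula eliminates the number of
regions. -/
theorem slack_add_edges (hS : IsFullSubdivision S) (hP : GeneralPosition P)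
    (hn : 3 ≤ P.card) : slack S + S.edgeSet.ncard + extNum P = 3 * P.card - 3 := by
  have h1 := hS.card_regionFinset hP hn
  have h2 := hS.slack_add hP hn
  have h3 := hS.innerDarts_add hP hn
  zify at h1 h3
  linarith

theorem innerEdges_eq (hS : IsFullSubdivision S) (hP : GeneralPosition P)
    (hn : 3 ≤ P.card) :
    ((innerEdges S).ncard : ℤ) = 3 * P.card - 3 - 2 * extNum P - slack S := by
  have h1 := hS.slack_add_edges hP hn
  have h2 := ncard_innerEdges hP hn hS.hull
  zify at h2
  linarith

theorem regionSlack_nonneg (hS : IsFullSubdivision S) (hP : GeneralPosition P)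
    (hr : r ∈ regions S) : 0 ≤ regionSlack r := by
  have := hS.three_le_corners hP hr
  rw [regionSlack]
  omega

end IsFullSubdivision

end

section

variable {P : Finset ℂ} {S : SimpleGraph P}

/-! ### Counting unoriented edges -/

theorem exists_orient_pos_of_notMem_extPts (hP : GeneralPosition P) (hn : 3 ≤ P.card) {p a : P}
    (hp : p ∉ extPts P) (h : p ≠ a) : ∃ x : P, 0 < orient (p : ℂ) a x := by
  by_contra hcon
  push Not at hcon
  exact hp ((mem_extPts_iff hP hn).2 ⟨a, h, hcon⟩)

theorem mem_innerEdges_of_notMem_extPts (hP : GeneralPosition P) (hn : 3 ≤ P.card) {p q : P}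
    (hp : p ∉ extPts P) (h : S.Adj q p) : s(q, p) ∈ innerEdges S := by
  refine ⟨h, fun hh => hp ?_⟩
  rcases mem_hullEdges_iff.1 hh with h | h
  · exact (mem_extPts_iff' hP hn).2 ⟨q, h⟩
  · exact (mem_extPts_iff hP hn).2 ⟨q, h⟩

namespace PartialOrientation

variable (O : PartialOrientation S)

open Classical in
/-- The oriented edges directed to inner points. -/
def innerArcs : Finset (P × P) := Finset.univ.filter fun d => O.dir d.1 d.2 ∧ d.2 ∉ extPts P

theorem mem_innerArcs {d : P × P} : d ∈ O.innerArcs ↔ O.dir d.1 d.2 ∧ d.2 ∉ extPts P := by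
  simp [innerArcs]

/-- An edge with an inner endpoint is never a hull edge, so the arcs to inner points are exactly the
oriented inner edges. -/
theorem ncard_innerEdges_eq (hP : GeneralPosition P) (hn : 3 ≤ P.card)
    (hO : ∀ q p, O.dir q p → s(q, p) ∈ innerEdges S → p ∉ extPts P) :
    O.unorientedInner.ncard + O.innerArcs.card = (innerEdges S).ncard := by
  have hsub : O.unorientedInner ⊆ innerEdges S := fun e he => he.1
  have h : O.innerArcs.card = (innerEdges S \ O.unorientedInner).ncard := by
    rw [← Set.ncard_coe_finset]
    refine Set.ncard_congr (fun d _ => s(d.1, d.2)) ?_ ?_ ?_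
    · intro d hd
      obtain ⟨h1, h2⟩ := O.mem_innerArcs.1 hd
      exact ⟨mem_innerEdges_of_notMem_extPts hP hn h2 (O.adj _ _ h1), fun h => h.2 _ _ rfl h1⟩
    · rintro ⟨p, a⟩ ⟨p', a'⟩ hd hd' h
      obtain ⟨h1, -⟩ := O.mem_innerArcs.1 hd
      obtain ⟨h2, -⟩ := O.mem_innerArcs.1 hd'
      rcases Sym2.eq_iff.1 h with ⟨rfl, rfl⟩ | ⟨rfl, rfl⟩
      · rfl
      · exact absurd h2 (O.asymm _ _ h1)
    · rintro e ⟨he, hne⟩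
      have : ∃ p q, e = s(p, q) ∧ O.dir p q := by
        by_contra hcon
        push Not at hcon
        exact hne ⟨he, hcon⟩
      obtain ⟨p, q, rfl, hpq⟩ := this
      exact ⟨(p, q), O.mem_innerArcs.2 ⟨hpq, hO p q hpq he⟩, rfl⟩
  rw [h, add_comm, Set.ncard_sdiff_add_ncard_of_subset hsub]

open Classical in
/-- The inner points. -/
def innerPoints (P : Finset ℂ) : Finset P := Finset.univ.filter fun p => p ∉ extPts P

theorem mem_innerPoints {p : P} : p ∈ innerPoints P ↔ p ∉ extPts P := by simp [innerPoints]

theorem card_innerPoints (P : Finset ℂ) : (innerPoints P).card + extNum P = P.card := by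
  classical
  have h : extNum P = (Finset.univ.filter fun p => p ∈ extPts P).card := by
    rw [extNum, ← Set.ncard_coe_finset]
    congr 1
    ext p
    simp
  have h2 := Finset.card_filter_add_card_filter_not (s := (Finset.univ : Finset P))
    (fun p => p ∈ extPts P)
  rw [Finset.card_univ, Fintype.card_coe] at h2
  rw [h, innerPoints]
  omega

theorem card_innerArcs : O.innerArcs.card = ∑ p ∈ innerPoints P, O.indegree p := by
  classical
  rw [Finset.card_eq_sum_card_fiberwise (f := fun d : P × P => d.2) (t := innerPoints P)
    (fun d hd => mem_innerPoints.2 (O.mem_innerArcs.1 hd).2)]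
  refine Finset.sum_congr rfl fun p hp => ?_
  rw [indegree, ← Set.ncard_coe_finset]
  refine Set.ncard_congr (fun d _ => d.1) ?_ ?_ ?_
  · intro d hd
    rw [Finset.mem_coe, Finset.mem_filter, mem_innerArcs] at hd
    rw [← hd.2]
    exact hd.1.1
  · rintro ⟨q, p⟩ ⟨q', p'⟩ hd hd' h
    rw [Finset.mem_coe, Finset.mem_filter, mem_innerArcs] at hd hd'
    exact Prod.ext h (hd.2.trans hd'.2.symm)
  · intro q hq
    refine ⟨(q, p), ?_, rfl⟩
    rw [Finset.mem_coe, Finset.mem_filter, mem_innerArcs]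
    exact ⟨⟨hq, mem_innerPoints.1 hp⟩, rfl⟩

open Classical in
theorem card_filter_indegree (i : ℕ) :
    ((innerPoints P).filter fun p => O.indegree p = i).card = O.innerCount i := by
  rw [innerCount, ← Set.ncard_coe_finset]
  congr 1
  ext p
  simp [mem_innerPoints]

theorem indegree_lt_of_innerCount (h : ∀ i, 4 ≤ i → O.innerCount i = 0) {p : P}
    (hp : p ∈ innerPoints P) : O.indegree p < 4 := by
  classical
  by_contra hge
  have h1 := h _ (not_lt.1 hge)
  rw [← card_filter_indegree, Finset.card_eq_zero] at h1
  have : p ∈ (innerPoints P).filter fun q => O.indegree q = O.indegree p :=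
    Finset.mem_filter.2 ⟨hp, rfl⟩
  rw [h1] at this
  exact absurd this (Finset.notMem_empty p)

theorem sum_innerPoints (h : ∀ p ∈ innerPoints P, O.indegree p < 4) (f : ℕ → ℕ) :
    ∑ p ∈ innerPoints P, f (O.indegree p) = O.innerCount 0 * f 0 + O.innerCount 1 * f 1 +
      O.innerCount 2 * f 2 + O.innerCount 3 * f 3 := by
  classical
  rw [← Finset.sum_fiberwise_of_maps_to (g := fun p => O.indegree p) (t := Finset.range 4)
    (fun p hp => Finset.mem_range.2 (h p hp))]
  have : ∀ i ∈ Finset.range 4, ∑ p ∈ (innerPoints P).filter (fun p => O.indegree p = i),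
      f (O.indegree p) = O.innerCount i * f i := by
    intro i _
    rw [Finset.sum_congr rfl (g := fun _ => f i) (fun p hp => by rw [(Finset.mem_filter.1 hp).2]),
      Finset.sum_const, card_filter_indegree, smul_eq_mul]
  rw [Finset.sum_congr rfl this]
  simp [Finset.sum_range_succ]

/-- Subtract C_1 + 2 C_2 + 3 C_3 oriented edges from the 3n - 3 - 2h - D inner edges, and replace
2(n - h) by twice the sum of the C_i. -/
theorem unorientedInner_eq (hS : IsFullSubdivision S) (hP : GeneralPosition P)
    (hn : 3 ≤ P.card) (hO : ∀ q p, O.dir q p → s(q, p) ∈ innerEdges S → p ∉ extPts P)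
    (h4 : ∀ p ∈ innerPoints P, O.indegree p < 4) :
    (O.unorientedInner.ncard : ℤ) =
      P.card - 3 - O.innerCount 3 - slack S + (O.innerCount 1 + 2 * O.innerCount 0) ∧
    (P.card : ℤ) = extNum P + O.innerCount 0 + O.innerCount 1 + O.innerCount 2 +
      O.innerCount 3 := by
  have h1 := O.ncard_innerEdges_eq hP hn hO
  have h2 := O.card_innerArcs
  have h3 := O.sum_innerPoints h4 (fun i => i)
  have h5 := O.sum_innerPoints h4 (fun _ => 1)
  rw [Finset.sum_const, smul_eq_mul] at h5
  have h6 := card_innerPoints P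
  have h7 := hS.innerEdges_eq hP hn
  zify at h1 h2 h3 h5 h6
  constructor <;> linarith

/-! #### Well-oriented subdivisions -/

variable {O}

/-- At an inner point there are points, hence neighbors, to the left of every edge. So the successor
of an edge comes at an angle below `π`, and two consecutive edges bound a corner of a region. -/
theorem WellOriented.wedge (hO : O.WellOriented) (hS : IsFullSubdivision S)
    (hP : GeneralPosition P) (hn : 3 ≤ P.card) {p a b : P} (hab : a ≠ b) (ha : O.dir a p)
    (hb : O.dir b p) : Wedge S p a b ∨ Wedge S p b a := by
  have hp := hO.1 a p ha
  have key : ∀ {x y : P}, S.Adj p x → IsNext S p x y → Wedge S p x y := by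
    intro x y hx hxy
    obtain ⟨z, hz⟩ := exists_orient_pos_of_notMem_extPts hP hn hp hx.ne
    obtain ⟨w, hw, hpos⟩ := hS.spread hP hn p x 1 z hx (by linarith)
    exact hxy.wedge ⟨w, hw, by linarith⟩
  rcases hO.2 p a b hab ha hb with h | h
  · exact Or.inl (key (O.adj _ _ ha).symm h)
  · exact Or.inr (key (O.adj _ _ hb).symm h)

theorem WellOriented.exists_wedge (hO : O.WellOriented) (hS : IsFullSubdivision S)
    (hP : GeneralPosition P) (hn : 3 ≤ P.card) {p a b c : P} (hab : a ≠ b) (hac : a ≠ c)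
    (hbc : b ≠ c) (ha : O.dir a p) (hb : O.dir b p) (hc : O.dir c p) :
    Wedge S p a b ∨ Wedge S p a c := by
  rcases hO.wedge hS hP hn hab ha hb with h1 | h1
  · exact Or.inl h1
  rcases hO.wedge hS hP hn hac ha hc with h2 | h2
  · exact Or.inr h2
  exact absurd (h1.left_unique hP h2) hbc

theorem WellOriented.indegree_lt (hO : O.WellOriented) (hS : IsFullSubdivision S)
    (hP : GeneralPosition P) (hn : 3 ≤ P.card) (p : P) : O.indegree p < 4 := by
  by_contra hge
  obtain ⟨t, ht, hcard⟩ := Set.exists_subset_card_eq (not_lt.1 hge)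
  obtain ⟨a, b, c, d, hab, hac, had, hbc, hbd, hcd, rfl⟩ := Set.ncard_eq_four.1 hcard
  have ha : O.dir a p := ht (by simp)
  have hb : O.dir b p := ht (by simp)
  have hc : O.dir c p := ht (by simp)
  have hd : O.dir d p := ht (by simp)
  -- The successor of `a` would have to be in each of {b, c}, {c, d} and {b, d}.
  rcases hO.exists_wedge hS hP hn hab hac hbc ha hb hc with h1 | h1
  · rcases hO.exists_wedge hS hP hn hac had hcd ha hc hd with h2 | h2
    · exact hbc (h1.right_unique hP h2)
    · exact hbd (h1.right_unique hP h2)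
  · rcases hO.exists_wedge hS hP hn hab had hbd ha hb hd with h2 | h2
    · exact hbc (h2.right_unique hP h1)
    · exact hcd (h1.right_unique hP h2)

variable (O)

open Classical in
/-- The corners of regions with both sides directed to the corner. -/
def goodDarts : Finset (P × P) := (innerDarts S).filter fun d =>
  O.dir d.2 d.1 ∧ ∃ b, Wedge S d.1 d.2 b ∧ O.dir b d.1

theorem mem_goodDarts {d : P × P} : d ∈ O.goodDarts ↔
    O.dir d.2 d.1 ∧ ∃ b, Wedge S d.1 d.2 b ∧ O.dir b d.1 := by
  classical
  rw [goodDarts, Finset.mem_filter, mem_innerDarts]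
  constructor
  · exact fun h => h.2
  · rintro ⟨h1, b, h2, h3⟩
    exact ⟨⟨h2.left, b, h2.pos⟩, h1, b, h2, h3⟩

variable {O}

-- Of three pairwise consecutive edges each is followed by another one, which makes three good
-- corners; two consecutive edges make one. These are the values of `2 i - 3` for `i = 3` and `i =
-- 2`; for smaller `i` it is negative.
open Classical in
theorem WellOriented.card_goodDarts_at (hO : O.WellOriented) (hS : IsFullSubdivision S)
    (hP : GeneralPosition P) (hn : 3 ≤ P.card) (p : P) :
    2 * O.indegree p ≤ (O.goodDarts.filter fun d => d.1 = p).card + 3 := by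
  have hlt := hO.indegree_lt hS hP hn p
  have hmem : ∀ a b, O.dir a p → O.dir b p → Wedge S p a b →
      (p, a) ∈ O.goodDarts.filter fun d => d.1 = p := fun a b ha hb hw =>
    Finset.mem_filter.2 ⟨O.mem_goodDarts.2 ⟨ha, b, hw, hb⟩, rfl⟩
  by_cases h3 : O.indegree p = 3
  · obtain ⟨a, b, c, hab, hac, hbc, hset⟩ := Set.ncard_eq_three.1 h3
    have ha : O.dir a p := hset.ge (by simp)
    have hb : O.dir b p := hset.ge (by simp)
    have hc : O.dir c p := hset.ge (by simp)
    have key : ∀ {x y z : P}, x ≠ y → x ≠ z → y ≠ z → O.dir x p → O.dir y p → O.dir z p →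
        (p, x) ∈ O.goodDarts.filter fun d => d.1 = p := by
      intro x y z hxy hxz hyz hx hy hz
      rcases hO.exists_wedge hS hP hn hxy hxz hyz hx hy hz with h | h
      · exact hmem x y hx hy h
      · exact hmem x z hx hz h
    have hsub : ({(p, a), (p, b), (p, c)} : Finset (P × P)) ⊆
        O.goodDarts.filter fun d => d.1 = p := by
      intro d hd
      simp only [Finset.mem_insert, Finset.mem_singleton] at hd
      rcases hd with rfl | rfl | rfl
      · exact key hab hac hbc ha hb hc
      · exact key hab.symm hbc hac hb ha hc
      · exact key hac.symm hbc.symm hab hc ha hb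
    have := Finset.card_le_card hsub
    rw [Finset.card_eq_three.2 ⟨(p, a), (p, b), (p, c), by simp [hab], by simp [hac],
      by simp [hbc], rfl⟩] at this
    omega
  by_cases h2 : O.indegree p = 2
  · obtain ⟨a, b, hab, hset⟩ := Set.ncard_eq_two.1 h2
    have ha : O.dir a p := hset.ge (by simp)
    have hb : O.dir b p := hset.ge (by simp)
    have : 0 < (O.goodDarts.filter fun d => d.1 = p).card := by
      rw [Finset.card_pos]
      rcases hO.wedge hS hP hn hab ha hb with h | h
      · exact ⟨_, hmem a b ha hb h⟩
      · exact ⟨_, hmem b a hb ha h⟩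
    omega
  omega

theorem WellOriented.le_card_goodDarts (hO : O.WellOriented) (hS : IsFullSubdivision S)
    (hP : GeneralPosition P) (hn : 3 ≤ P.card) :
    O.innerCount 2 + 3 * O.innerCount 3 ≤ O.goodDarts.card := by
  classical
  have h1 : O.goodDarts.card = ∑ p ∈ innerPoints P, (O.goodDarts.filter fun d => d.1 = p).card :=
    Finset.card_eq_sum_card_fiberwise (fun d hd => mem_innerPoints.2
      (hO.1 _ _ (O.mem_goodDarts.1 hd).1))
  -- Subtraction is truncated: `2 * i - 3` takes the values 0, 0, 1, 3.
  have h2 := O.sum_innerPoints (fun p _ => hO.indegree_lt hS hP hn p) (fun i => 2 * i - 3)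
  have h3 : ∑ p ∈ innerPoints P, (2 * O.indegree p - 3) ≤
      ∑ p ∈ innerPoints P, (O.goodDarts.filter fun d => d.1 = p).card :=
    Finset.sum_le_sum fun p _ => by
      have := hO.card_goodDarts_at hS hP hn p
      omega
  omega

variable (O)

open Classical in
/-- At most half of the corners of a region have both sides directed to the corner. -/
theorem two_mul_card_goodDarts_le (hS : IsFullSubdivision S) (hP : GeneralPosition P)
    {r : Set ℂ} (hr : r ∈ regions S) :
    2 * (O.goodDarts.filter fun d => leftComp S d = r).card ≤ corners r := by
  rw [hS.corners_eq hP hr]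
  set W := (innerDarts S).filter fun d => leftComp S d = r
  have hgW : O.goodDarts.filter (fun d => leftComp S d = r) =
      W.filter fun d => d ∈ O.goodDarts := by
    ext d
    simp only [W, Finset.mem_filter]
    constructor
    · rintro ⟨h1, h2⟩
      exact ⟨⟨(Finset.mem_filter.1 h1).1, h2⟩, h1⟩
    · rintro ⟨⟨-, h2⟩, h1⟩
      exact ⟨h1, h2⟩
  have hsplit := Finset.card_filter_add_card_filter_not (s := W) (fun d => d ∈ O.goodDarts)
  have hex : ∀ d ∈ W, ∃ x, Wedge S d.2 x d.1 ∧ (d.2, x) ∈ W := by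
    intro d hd
    obtain ⟨h1, h2⟩ := Finset.mem_filter.1 hd
    have hs := (hS.isComp_leftComp h1).2
    rw [h2] at hs
    obtain ⟨x, hw, hsx⟩ := hs.exists_wedge_prev hr.2 (hS.convex r hr) hP hS.plane
      (mem_innerDarts.1 h1).1
    exact ⟨x, hw, Finset.mem_filter.2 (hS.mem_innerDarts_of_isSide hP hr hw.left hsx)⟩
  have hle : (W.filter fun d => d ∈ O.goodDarts).card ≤
      (W.filter fun d => ¬ d ∈ O.goodDarts).card := by
    -- Send a good corner to the next corner along the boundary of the region. The side between them
    -- is directed to the first, so the second is not good.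
    refine Finset.card_le_card_of_injOn
      (fun d => if h : d ∈ W then (d.2, (hex d h).choose) else d) ?_ ?_
    · intro d hd
      rw [Finset.mem_coe, Finset.mem_filter] at hd
      have hspec := (hex d hd.1).choose_spec
      simp only [dif_pos hd.1, Finset.coe_filter, Set.mem_ofPred_eq]
      refine ⟨hspec.2, fun hgood => ?_⟩
      obtain ⟨-, b, hb, hdir⟩ := O.mem_goodDarts.1 hgood
      dsimp only at hb hdir
      rw [hb.right_unique hP hspec.1] at hdir
      exact O.asymm _ _ hdir (O.mem_goodDarts.1 hd.2).1
    · intro d hd d' hd' heq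
      rw [Finset.mem_coe, Finset.mem_filter] at hd hd'
      simp only [dif_pos hd.1, dif_pos hd'.1, Prod.mk.injEq] at heq
      have h1 := (hex d hd.1).choose_spec.1
      have h2 := (hex d' hd'.1).choose_spec.1
      rw [heq.2, heq.1] at h1
      exact Prod.ext (h1.right_unique hP h2) heq.1
  rw [hgW]
  omega

/-- A region of slack s has s + 3 corners, and half of this, rounded down, is 1 + ⌈s/2⌉. -/
theorem card_goodDarts_le (hS : IsFullSubdivision S) (hP : GeneralPosition P)
    (hn : 3 ≤ P.card) :
    (O.goodDarts.card : ℤ) ≤ (regionFinset S).card + refinedSlack S := by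
  classical
  have h1 : O.goodDarts.card =
      ∑ r ∈ regionFinset S, (O.goodDarts.filter fun d => leftComp S d = r).card :=
    Finset.card_eq_sum_card_fiberwise (fun d hd => (hS.mem_regionFinset hP hn).2
      (hS.leftComp_mem_regions hP hn (Finset.mem_filter.1 hd).1))
  rw [h1, hS.refinedSlack_eq_sum hP hn, Finset.cast_card, ← Finset.sum_add_distrib, Nat.cast_sum]
  refine Finset.sum_le_sum fun r hr => ?_
  have h2 := O.two_mul_card_goodDarts_le hS hP ((hS.mem_regionFinset hP hn).1 hr)
  have h3 := Int.le_ceil ((regionSlack r : ℚ) / 2)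
  rw [← regionRefinedSlack] at h3
  have h4 : (regionSlack r : ℚ) ≤ 2 * regionRefinedSlack r := by linarith
  have h5 : regionSlack r ≤ 2 * regionRefinedSlack r := by exact_mod_cast h4
  rw [regionSlack] at h5
  omega

end PartialOrientation

theorem IsFullSubdivision.refinedSlack_le (hS : IsFullSubdivision S) (hP : GeneralPosition P)
    (hn : 3 ≤ P.card) : refinedSlack S ≤ slack S := by
  rw [hS.refinedSlack_eq_sum hP hn, hS.slack_eq_sum hP hn]
  refine Finset.sum_le_sum fun r hr => ?_
  have h := hS.regionSlack_nonneg hP ((hS.mem_regionFinset hP hn).1 hr)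
  rw [regionRefinedSlack, Int.ceil_le]
  have : (0 : ℚ) ≤ regionSlack r := by exact_mod_cast h
  linarith

theorem unoriented_edges_first (hP : GeneralPosition P) (hn : 3 ≤ P.card)
    (hS : IsFullSubdivision S) (O : PartialOrientation S)
    (hO : ∀ q p, O.dir q p → s(q, p) ∈ innerEdges S → p ∉ extPts P)
    (h4 : ∀ i, 4 ≤ i → O.innerCount i = 0) :
    (O.unorientedInner.ncard : ℤ) =
      (P.card : ℤ) - 3 - O.innerCount 3 - slack S + (O.innerCount 1 + 2 * O.innerCount 0) ∧
    (P.card : ℤ) - 3 - O.innerCount 3 - slack S + (O.innerCount 1 + 2 * O.innerCount 0) ≥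
      (P.card : ℤ) - 3 - O.innerCount 3 - slack S ∧
    (P.card : ℤ) - 3 - O.innerCount 3 - slack S ≥ (extNum P : ℤ) - 3 - slack S := by
  obtain ⟨h1, h2⟩ := O.unorientedInner_eq hS hP hn hO
    (fun p hp => O.indegree_lt_of_innerCount h4 hp)
  refine ⟨h1, by omega, by omega⟩

/-- From C_2 + 3 C_3 ≤ regions + D^*, where regions = 2n - 2 - h - D, one gets 2 C_3 ≤ n - 2 - D +
D^* + C_0 + C_1. Inserted into the identity for the unoriented edges, this leaves the claim with C_1
+ 3 C_0 to spare in the doubled inequality. -/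
theorem unoriented_edges_second (hP : GeneralPosition P) (hn : 3 ≤ P.card)
    (hS : IsFullSubdivision S) (O : PartialOrientation S) (hO : O.WellOriented) :
    (O.unorientedInner.ncard : ℝ) ≥
      (P.card : ℝ) / 2 - 2 - ((slack S : ℝ) + (refinedSlack S : ℝ)) / 2 ∧
    (P.card : ℝ) / 2 - 2 - ((slack S : ℝ) + (refinedSlack S : ℝ)) / 2 ≥
      (P.card : ℝ) / 2 - 2 - (slack S : ℝ) := by
  obtain ⟨h1, h2⟩ := O.unorientedInner_eq hS hP hn (fun q p h _ => hO.1 q p h)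
    (fun p _ => hO.indegree_lt hS hP hn p)
  have h3 := hO.le_card_goodDarts hS hP hn
  have h4 := O.card_goodDarts_le hS hP hn
  have h5 := hS.card_regionFinset hP hn
  have h6 := hS.slack_add_edges hP hn
  have h7 := hS.refinedSlack_le hP hn
  zify at h3 h5
  have h8 : (P.card : ℤ) - 4 - slack S - refinedSlack S ≤ 2 * O.unorientedInner.ncard := by
    omega
  have h9 : (P.card : ℝ) - 4 - slack S - refinedSlack S ≤ 2 * O.unorientedInner.ncard := by
    exact_mod_cast h8
  have h10 : (refinedSlack S : ℝ) ≤ slack S := by exact_mod_cast h7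
  constructor <;> linarith

/-- A well-oriented subdivision satisfies the hypotheses of both bounds. -/
theorem le_unoriented_of_wellOriented (hP : GeneralPosition P) (hn : 3 ≤ P.card)
    (hS : IsFullSubdivision S) (O : PartialOrientation S) (hO : O.WellOriented) :
    (O.unorientedInner.ncard : ℝ) ≥
      max ((P.card : ℝ) / 2 - 2 - slack S) ((extNum P : ℝ) - 3 - slack S) := by
  obtain ⟨h1, h2⟩ := unoriented_edges_second hP hn hS O hO
  obtain ⟨h3, h4⟩ := O.unorientedInner_eq hS hP hn (fun q p h _ => hO.1 q p h)
    (fun p _ => hO.indegree_lt hS hP hn p)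
  have h5 : (extNum P : ℤ) - 3 - slack S ≤ O.unorientedInner.ncard := by omega
  have h6 : (extNum P : ℝ) - 3 - slack S ≤ O.unorientedInner.ncard := by exact_mod_cast h5
  exact max_le (by linarith) h6

end

section

variable {P : Finset ℂ} {G : SimpleGraph P}

/-! ### Removing an edge -/

theorem mem_edgeSet_deleteEdges {e f : Sym2 P} :
    f ∈ (G.deleteEdges {e}).edgeSet ↔ f ∈ G.edgeSet ∧ f ≠ e := by
  rw [SimpleGraph.edgeSet_deleteEdges]; rfl

theorem IsPlane.mono {G' : SimpleGraph P} (hG : IsPlane G) (h : G' ≤ G) : IsPlane G' :=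
  fun e he f hf hne => hG e (SimpleGraph.edgeSet_mono h he) f (SimpleGraph.edgeSet_mono h hf) hne

/-- The further edges at `p` and at `q` keep the endpoints in the drawing, so exactly the open
segment is set free. -/
theorem compl_edgeUnion_deleteEdges (hG : IsPlane G) {p q a b : P} (h : G.Adj p q)
    (ha : (G.deleteEdges {s(p, q)}).Adj p a) (hb : (G.deleteEdges {s(p, q)}).Adj q b) :
    (edgeUnion (G.deleteEdges {s(p, q)}))ᶜ = (edgeUnion G)ᶜ ∪ openSegment ℝ (p : ℂ) q := by
  ext z
  constructor
  · intro hz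
    by_cases hzU : z ∈ edgeUnion G
    · right
      obtain ⟨f, hf, hzf⟩ := mem_edgeUnion.1 hzU
      have hfe : f = s(p, q) := by
        by_contra hne
        exact hz (mem_edgeUnion.2 ⟨f, mem_edgeSet_deleteEdges.2 ⟨hf, hne⟩, hzf⟩)
      subst hfe
      refine mem_openSegment_of_ne_left_right ?_ ?_ hzf
      · rintro rfl; exact hz (mem_edgeUnion_of_adj ha)
      · rintro rfl; exact hz (mem_edgeUnion_of_adj hb)
    · exact Or.inl hzU
  · rintro (hz | hz) hzU
    · obtain ⟨f, hf, hzf⟩ := mem_edgeUnion.1 hzU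
      exact hz (mem_edgeUnion.2 ⟨f, (mem_edgeSet_deleteEdges.1 hf).1, hzf⟩)
    · obtain ⟨f, hf, hzf⟩ := mem_edgeUnion.1 hzU
      obtain ⟨hf1, hf2⟩ := mem_edgeSet_deleteEdges.1 hf
      exact notMem_of_mem_openSegment hG h hz hf1 hf2 hzf

theorem eventually_mem_openSegment {p q z : ℂ} (hpq : p ≠ q) (hz : z ∈ openSegment ℝ p q) :
    ∀ᶠ w in 𝓝 z, cr (q - p) (w - p) = 0 → w ∈ openSegment ℝ p q := by
  have hne : q - p ≠ 0 := sub_ne_zero.2 hpq.symm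
  have hcont : Continuous fun w : ℂ => ((w - p) / (q - p)).re := by fun_prop
  have hval : ∀ t : ℝ, ((p + t • (q - p) - p) / (q - p)).re = t := by
    intro t
    rw [add_sub_cancel_left, Complex.real_smul, mul_div_assoc, div_self hne, mul_one,
      Complex.ofReal_re]
  have hz' : ((z - p) / (q - p)).re ∈ Set.Ioo (0 : ℝ) 1 := by
    rw [openSegment_eq_image'] at hz
    obtain ⟨t, ht, rfl⟩ := hz
    dsimp only
    rw [hval]; exact ht
  filter_upwards [hcont.continuousAt.eventually_mem (isOpen_Ioo.mem_nhds hz')] with w hw h0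
  obtain ⟨t, ht⟩ := eq_smul_of_cr_eq_zero hne h0
  obtain rfl : w = p + t • (q - p) := by rw [← ht]; ring
  rw [hval] at hw
  rw [openSegment_eq_image']
  exact ⟨t, hw, rfl⟩

/-- The union of the sides of an edge with the open edge. -/
def merged (r₁ r₂ : Set ℂ) (p q : ℂ) : Set ℂ := r₁ ∪ openSegment ℝ p q ∪ r₂

theorem isOpen_merged {r₁ r₂ : Set ℂ} (h₁ : IsOpen r₁) (h₂ : IsOpen r₂) {p q : ℂ} (hpq : p ≠ q)
    (hs₁ : IsSide 1 r₁ p q) (hs₂ : IsSide 1 r₂ q p) : IsOpen (merged r₁ r₂ p q) := by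
  rw [isOpen_iff_mem_nhds]
  rintro z ((hz | hz) | hz)
  · exact mem_of_superset (h₁.mem_nhds hz) fun w hw => Or.inl (Or.inl hw)
  · have hs₂' := hs₂.swap z hz
    filter_upwards [hs₁ z hz, hs₂', eventually_mem_openSegment hpq hz] with w h1 h2 h3
    have e := cr_sub_of_mem_segment (openSegment_subset_segment _ _ _ hz) w
    rcases lt_trichotomy (cr (q - p) (w - p)) 0 with h | h | h
    · exact Or.inr (h2 (by rw [e]; linarith))
    · exact Or.inl (Or.inr (h3 h))
    · exact Or.inl (Or.inl (h1 (by rw [e]; linarith)))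
  · exact mem_of_superset (h₂.mem_nhds hz) fun w hw => Or.inr hw

theorem isPreconnected_merged {r₁ r₂ : Set ℂ} (h₁ : IsPreconnected r₁) (h₂ : IsPreconnected r₂)
    {p q : ℂ} (hs₁ : openSegment ℝ p q ⊆ closure r₁) (hs₂ : openSegment ℝ p q ⊆ closure r₂) :
    IsPreconnected (merged r₁ r₂ p q) := by
  have hm := half_mem_openSegment p q
  have k1 : IsPreconnected (r₁ ∪ openSegment ℝ p q) :=
    h₁.subset_closure Set.subset_union_left (Set.union_subset subset_closure hs₁)
  have k2 : IsPreconnected (openSegment ℝ p q ∪ r₂) :=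
    h₂.subset_closure Set.subset_union_right (Set.union_subset hs₂ subset_closure)
  have := IsPreconnected.union (p + (1 / 2 : ℝ) • (q - p)) (Set.mem_union_right _ hm)
    (Set.mem_union_left _ hm) k1 k2
  rwa [← Set.union_assoc, Set.union_assoc r₁, Set.union_self] at this

section Merge

variable {r₁ r₂ : Set ℂ} {p q a b : P}

theorem isComp_merged (hG : IsPlane G) (h : G.Adj p q)
    (ha : (G.deleteEdges {s(p, q)}).Adj p a) (hb : (G.deleteEdges {s(p, q)}).Adj q b)
    (h₁ : IsComp G r₁) (h₂ : IsComp G r₂) (hs₁ : IsSide 1 r₁ p q) (hs₂ : IsSide 1 r₂ q p) :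
    IsComp (G.deleteEdges {s(p, q)}) (merged r₁ r₂ p q) := by
  have hpq := (coe_ne_of_adj h).symm
  have hU := compl_edgeUnion_deleteEdges hG h ha hb
  refine isComp_of_isOpen (isOpen_merged h₁.isOpen h₂.isOpen hpq hs₁ hs₂)
    (isPreconnected_merged h₁.isPreconnected h₂.isPreconnected
      (fun z hz => hs₁.mem_closure one_ne_zero hpq hz)
      (fun z hz => hs₂.mem_closure one_ne_zero hpq.symm (by rwa [openSegment_symm])))
    ⟨_, Or.inl (Or.inr (half_mem_openSegment (p : ℂ) q))⟩ ?_ ?_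
  · rw [hU]
    rintro z ((hz | hz) | hz)
    · exact Or.inl (h₁.subset hz)
    · exact Or.inr hz
    · exact Or.inl (h₂.subset hz)
  · rw [hU]
    rintro z ⟨hz, hzU | hzU⟩
    · rw [merged, closure_union, closure_union, closure_openSegment] at hz
      rcases hz with (hz | hz) | hz
      · exact Or.inl (Or.inl (h₁.closure_inter_subset ⟨hz, hzU⟩))
      · exact absurd (mem_edgeUnion.2 ⟨s(p, q), h, hz⟩) hzU
      · exact Or.inr (h₂.closure_inter_subset ⟨hz, hzU⟩)
    · exact Or.inl (Or.inr hzU)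

theorem IsComp.eq_merged_or (hG : IsPlane G) (h : G.Adj p q)
    (ha : (G.deleteEdges {s(p, q)}).Adj p a) (hb : (G.deleteEdges {s(p, q)}).Adj q b)
    (h₁ : IsComp G r₁) (h₂ : IsComp G r₂) (hs₁ : IsSide 1 r₁ p q) (hs₂ : IsSide 1 r₂ q p)
    {r : Set ℂ} (hr : IsComp (G.deleteEdges {s(p, q)}) r) :
    r = merged r₁ r₂ p q ∨ IsComp G r := by
  have hM := isComp_merged hG h ha hb h₁ h₂ hs₁ hs₂
  have hU := compl_edgeUnion_deleteEdges hG h ha hb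
  by_cases hdis : ∃ z, z ∈ r ∧ z ∈ merged r₁ r₂ p q
  · obtain ⟨z, h1, h2⟩ := hdis
    exact Or.inl (hr.eq_of_mem hM h1 h2)
  · push Not at hdis
    refine Or.inr (isComp_of_isOpen hr.isOpen hr.isPreconnected hr.nonempty ?_ ?_)
    · intro z hz
      have := hr.subset hz
      rw [hU] at this
      exact this.resolve_right fun h => hdis z hz (Or.inl (Or.inr h))
    · rintro z ⟨hz, hzU⟩
      refine hr.closure_inter_subset ⟨hz, ?_⟩
      rw [hU]
      exact Or.inl hzU

end Merge

/-- A segment from `r₁` to `r₂` meets the line `pq` once. By `hcross` this happens inside the open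
edge, so each of its two halves joins a boundary point of a convex open set to a point of that set
and stays inside. -/
theorem convex_merged {r₁ r₂ : Set ℂ} (ho₁ : IsOpen r₁) (ho₂ : IsOpen r₂) (hc₁ : Convex ℝ r₁)
    (hc₂ : Convex ℝ r₂) {p q : ℂ} (hs₁ : openSegment ℝ p q ⊆ closure r₁)
    (hs₂ : openSegment ℝ p q ⊆ closure r₂) (h₁ : ∀ z ∈ r₁, 0 < orient p q z)
    (h₂ : ∀ z ∈ r₂, orient p q z < 0)
    (hcross : ∀ x ∈ r₁, ∀ y ∈ r₂, ∀ w ∈ openSegment ℝ x y, orient p q w = 0 →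
      w ∈ openSegment ℝ p q) : Convex ℝ (merged r₁ r₂ p q) := by
  have mix : ∀ {r : Set ℂ}, IsOpen r → Convex ℝ r → openSegment ℝ p q ⊆ closure r →
      ∀ z ∈ openSegment ℝ p q, ∀ x ∈ r, openSegment ℝ z x ⊆ r := by
    intro r ho hc hs z hz x hx
    have := hc.openSegment_closure_interior_subset_interior (hs hz) (by rwa [ho.interior_eq])
    rwa [ho.interior_eq] at this
  have key : ∀ x ∈ r₁, ∀ y ∈ r₂, openSegment ℝ x y ⊆ merged r₁ r₂ p q := by
    intro x hx y hy
    have hA := h₁ x hx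
    have hB := h₂ y hy
    set A := orient p q x
    set B := orient p q y
    have hAB : 0 < A - B := by linarith
    have haff : ∀ t : ℝ, orient p q (x + t • (y - x)) = A - t * (A - B) := by
      intro t; simp only [A, B, orient, cr]; simp; ring
    set t₀ := A / (A - B)
    have ht0 : 0 < t₀ := div_pos hA hAB
    have ht1 : t₀ < 1 := (div_lt_one hAB).2 (by linarith)
    have hw₀ : x + t₀ • (y - x) ∈ openSegment ℝ p q := by
      refine hcross x hx y hy _ ?_ ?_
      · rw [openSegment_eq_image']; exact ⟨t₀, ⟨ht0, ht1⟩, rfl⟩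
      · rw [haff, div_mul_cancel₀ _ hAB.ne', sub_self]
    rw [openSegment_eq_image' ℝ x y]
    rintro _ ⟨t, ⟨h0, h1⟩, rfl⟩
    dsimp only
    rcases lt_trichotomy t t₀ with h | h | h
    · refine Or.inl (Or.inl (mix ho₁ hc₁ hs₁ _ hw₀ x hx ?_))
      rw [openSegment_symm, openSegment_eq_image']
      refine ⟨t / t₀, ⟨div_pos h0 ht0, (div_lt_one ht0).2 h⟩, ?_⟩
      dsimp only
      rw [add_sub_cancel_left, smul_smul, div_mul_cancel₀ _ ht0.ne']
    · rw [h]; exact Or.inl (Or.inr hw₀)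
    · refine Or.inr (mix ho₂ hc₂ hs₂ _ hw₀ y hy ?_)
      rw [openSegment_eq_image']
      have h1t : 0 < 1 - t₀ := by linarith
      refine ⟨(t - t₀) / (1 - t₀), ⟨div_pos (by linarith) h1t,
        (div_lt_one h1t).2 (by linarith)⟩, ?_⟩
      dsimp only
      have e : y - (x + t₀ • (y - x)) = (1 - t₀) • (y - x) := by module
      rw [e, smul_smul, div_mul_cancel₀ _ h1t.ne']
      module
  rw [convex_iff_openSegment_subset]
  rintro x ((hx | hx) | hx) y ((hy | hy) | hy)
  · exact fun z hz => Or.inl (Or.inl (hc₁.openSegment_subset hx hy hz))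
  · rw [openSegment_symm]
    exact fun z hz => Or.inl (Or.inl (mix ho₁ hc₁ hs₁ y hy x hx hz))
  · exact key x hx y hy
  · exact fun z hz => Or.inl (Or.inl (mix ho₁ hc₁ hs₁ x hx y hy hz))
  · exact fun z hz => Or.inl (Or.inr ((convex_openSegment p q).openSegment_subset hx hy hz))
  · exact fun z hz => Or.inr (mix ho₂ hc₂ hs₂ x hx y hy hz)
  · rw [openSegment_symm]; exact key y hy x hx
  · rw [openSegment_symm]
    exact fun z hz => Or.inr (mix ho₂ hc₂ hs₂ y hy x hx hz)
  · exact fun z hz => Or.inr (hc₂.openSegment_subset hx hy hz)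

/-- The Grassmann–Plücker relation; it derives the sign of one determinant from the signs of others
when directions around a point are compared. -/
theorem cr_plucker (a b c d : ℂ) : cr a c * cr b d = cr a b * cr c d + cr a d * cr b c := by
  simp only [cr]; ring

/-- Around an unlocked edge, the two neighboring edges span a convex angle. -/
theorem Unlocked.exists_wedges {p q : P} (h : G.Adj p q) (hu : Unlocked G p q) :
    ∃ a b, Wedge G p a q ∧ Wedge G p q b ∧ 0 < orient (p : ℂ) a b := by
  obtain ⟨y, x, hy, hx, h1, h2, h3⟩ := hu
  obtain ⟨a, ha⟩ := exists_wedge_right h hy h1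
  obtain ⟨b, hb⟩ := exists_wedge_left h hx h2
  refine ⟨a, b, ha, hb, ?_⟩
  have k1 : 0 ≤ orient (p : ℂ) b x := by
    rw [orient_swap]; linarith [not_lt.1 (hb.empty x hx h2)]
  have k2 : 0 ≤ orient (p : ℂ) y a := by
    by_contra hneg
    exact ha.empty y hy (by rw [orient_swap]; linarith) h1
  have h4 := ha.pos
  have h5 := hb.pos
  simp only [orient] at *
  have e1 := cr_plucker ((y : ℂ) - p) (q - p) (b - p) (x - p)
  have k3 : 0 < cr ((y : ℂ) - p) (b - p) := by
    refine pos_of_mul_pos_left (b := cr ((q : ℂ) - p) (x - p)) ?_ h2.le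
    rw [e1]
    have := mul_pos h3 h5
    have := mul_nonneg h1.le k1
    linarith
  have e2 := cr_plucker ((a : ℂ) - p) (y - p) (b - p) (q - p)
  have e3 : cr ((a : ℂ) - p) (b - p) * cr ((y : ℂ) - p) (q - p) =
      cr ((y : ℂ) - p) (a - p) * cr (q - p) (b - p) + cr (y - p) (b - p) * cr (a - p) (q - p) := by
    simp only [cr]; ring
  refine pos_of_mul_pos_left ?_ h1.le
  rw [e3]
  have := mul_pos k3 h4
  have := mul_nonneg k2 h5.le
  linarith

/-- The neighbors `a` and `b` of `q` around `p` span less than `π`, so both regions beside `pq` lie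
strictly to the left of `pa`. So does the crossing point `w`; as `q` is also to the left of `pa`,
`w` and `q` are on the same side of `p`. -/
theorem Unlocked.pos_of_cross {r₁ r₂ : Set ℂ} (hP : GeneralPosition P) (hG : IsPlane G)
    (h₁ : IsComp G r₁) (h₂ : IsComp G r₂) (hc₁ : Convex ℝ r₁) (hc₂ : Convex ℝ r₂) {p q : P}
    (h : G.Adj p q) (hu : Unlocked G p q) (hs₁ : IsSide 1 r₁ p q) (hs₂ : IsSide 1 r₂ q p)
    {x y : ℂ} (hx : x ∈ r₁) (hy : y ∈ r₂) {w : ℂ} (hw : w ∈ openSegment ℝ x y) {t : ℝ}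
    (ht : w - p = t • ((q : ℂ) - p)) : 0 < t := by
  obtain ⟨a, b, ha, hb, hab⟩ := hu.exists_wedges h
  obtain ⟨h1, h2⟩ := hb.cone h₁ hc₁ hP hG hs₁ hx
  obtain ⟨h3, h4⟩ := ha.cone h₂ hc₂ hP hG ((ha.isSide_iff h₂ hP hG).2 hs₂) hy
  have h5 := ha.pos
  have h6 := hb.pos
  obtain ⟨s, u, hs, hu', hsu, rfl⟩ := hw
  simp only [orient] at *
  have e1 := cr_plucker ((a : ℂ) - p) (q - p) (x - p) (b - p)
  have k1 : 0 < cr ((a : ℂ) - p) (x - p) := by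
    refine pos_of_mul_pos_left (b := cr ((q : ℂ) - p) (b - p)) ?_ h6.le
    rw [e1]
    have := mul_pos h5 h2
    have := mul_pos hab h1
    linarith
  have e2 : cr ((a : ℂ) - p) (s • x + u • y - p) =
      s * cr ((a : ℂ) - p) (x - p) + u * cr ((a : ℂ) - p) (y - p) := by
    obtain rfl : u = 1 - s := by linarith
    simp [cr]; ring
  rw [ht, cr_smul_right] at e2
  refine pos_of_mul_pos_left (b := cr ((a : ℂ) - p) (q - p)) ?_ h5.le
  rw [e2]
  have := mul_pos hs k1
  have := mul_pos hu' h3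
  linarith

theorem convex_merged_of_unlocked {r₁ r₂ : Set ℂ} (hP : GeneralPosition P) (hG : IsPlane G)
    (h₁ : IsComp G r₁) (h₂ : IsComp G r₂) (hc₁ : Convex ℝ r₁) (hc₂ : Convex ℝ r₂) {p q : P}
    (h : G.Adj p q) (hp : Unlocked G p q) (hq : Unlocked G q p) (hs₁ : IsSide 1 r₁ p q)
    (hs₂ : IsSide 1 r₂ q p) : Convex ℝ (merged r₁ r₂ p q) := by
  have hpq := (coe_ne_of_adj h).symm
  refine convex_merged h₁.isOpen h₂.isOpen hc₁ hc₂
    (fun z hz => hs₁.mem_closure one_ne_zero hpq hz)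
    (fun z hz => hs₂.mem_closure one_ne_zero hpq.symm (by rwa [openSegment_symm])) ?_ ?_ ?_
  · intro z hz
    have := hs₁.pos_of_mem one_ne_zero h₁ hc₁ h hz
    rwa [one_mul] at this
  · intro z hz
    have := hs₂.pos_of_mem one_ne_zero h₂ hc₂ h.symm hz
    rw [one_mul] at this
    rw [orient_swap_left]
    exact neg_neg_of_pos this
  · intro x hx y hy w hw h0
    obtain ⟨t, ht⟩ := eq_smul_of_cr_eq_zero (coe_sub_ne_zero h.ne) h0
    have h1 := hp.pos_of_cross hP hG h₁ h₂ hc₁ hc₂ h hs₁ hs₂ hx hy hw ht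
    have h2 := hq.pos_of_cross hP hG h₂ h₁ hc₂ hc₁ h.symm hs₂ hs₁ hy hx
      (by rwa [openSegment_symm]) (t := 1 - t) (by
        have : w - q = (w - p) - ((q : ℂ) - p) := by ring
        rw [this, ht]
        module)
    rw [openSegment_eq_image']
    exact ⟨t, ⟨h1, by linarith⟩, by dsimp only; rw [← ht]; ring⟩

/-! ### Unlocked edges -/

theorem IsComp.unlocked {r : Set ℂ} (hr : IsComp G r) (hc : Convex ℝ r) (hP : GeneralPosition P)
    (hG : IsPlane G) {p q a₀ : P} (h₀ : G.Adj p a₀)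
    (hsub : openSegment ℝ (p : ℂ) q ⊆ r) : Unlocked G p q := by
  have hg : Ger r p ((q : ℂ) - p) := by
    filter_upwards [Ioo_mem_nhdsGT (one_pos (α := ℝ))] with ε hε
    apply hsub
    rw [openSegment_eq_image']
    exact ⟨ε, hε, rfl⟩
  obtain ⟨a, b, hw, -, h1, h2⟩ := hr.exists_wedge_of_ger hc hP hG h₀ hg
  exact ⟨a, b, hw.left, hw.right, h1, h2, hw.pos⟩

theorem exists_orient_of_notMem_hullEdges {p q : P} (hne : p ≠ q) (h : s(p, q) ∉ hullEdges P) :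
    (∃ x : P, 0 < orient (p : ℂ) q x) ∧ ∃ x : P, 0 < orient (q : ℂ) p x := by
  rw [mem_hullEdges_iff] at h
  push Not at h
  simp only [IsHullDart, not_and, not_forall, not_le] at h
  exact ⟨h.1 hne, h.2 hne.symm⟩

theorem openSegment_subset_interior_of_notMem {p q : P} (hne : p ≠ q)
    (h : s(p, q) ∉ hullEdges P) : openSegment ℝ (p : ℂ) q ⊆ interior (hull P) := by
  obtain ⟨⟨x, hx⟩, y, hy⟩ := exists_orient_of_notMem_hullEdges hne h
  exact openSegment_subset_interior_hull hx (y := y) (by rw [orient_swap_left]; linarith)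

theorem not_adj_deleteEdges {p q : P} : ¬ (G.deleteEdges {s(p, q)}).Adj p q := by
  rw [← SimpleGraph.mem_edgeSet, mem_edgeSet_deleteEdges]
  exact fun h => h.2 rfl

/-- The direction of `q` is a positive combination of those of `y` and `x`, so on whichever side of
a line through `p` the point `q` lies, `y` or `x` lies too. Hence `Spread` survives the deletion of
`pq`. -/
theorem Unlocked.exists_adj_deleteEdges {p q : P} (hu : Unlocked G p q) {σ : ℝ} {a : P}
    (h : 0 < σ * orient (p : ℂ) a q) :
    ∃ b, (G.deleteEdges {s(p, q)}).Adj p b ∧ 0 < σ * orient (p : ℂ) a b := by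
  obtain ⟨y, x, hy, hx, h1, h2, h3⟩ := hu
  have hyq : y ≠ q := by rintro rfl; simp at h1
  have hxq : x ≠ q := by rintro rfl; simp at h2
  have hadj : ∀ z, G.Adj p z → z ≠ q → (G.deleteEdges {s(p, q)}).Adj p z := by
    intro z hz hzq
    rw [← SimpleGraph.mem_edgeSet, mem_edgeSet_deleteEdges]
    exact ⟨hz, fun h => hzq (Sym2.congr_right.1 h)⟩
  by_contra hcon
  push Not at hcon
  have k1 := hcon y (hadj y hy hyq)
  have k2 := hcon x (hadj x hx hxq)
  simp only [orient] at *
  have e := cr_plucker ((a : ℂ) - p) (y - p) (q - p) (x - p)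
  have := mul_pos h h3
  have := mul_nonneg (neg_nonneg.2 k1) h2.le
  have := mul_nonneg (neg_nonneg.2 k2) h1.le
  have e' := congrArg (fun t => σ * t) e
  linarith

theorem Unlocked.exists_adj_ne {p q : P} (hu : Unlocked G p q) :
    ∃ b, (G.deleteEdges {s(p, q)}).Adj p b := by
  obtain ⟨y, x, hy, hx, h1, h2, h3⟩ := hu
  obtain ⟨b, hb, -⟩ := Unlocked.exists_adj_deleteEdges ⟨y, x, hy, hx, h1, h2, h3⟩
    (σ := 1) (a := y) (by linarith)
  exact ⟨b, hb⟩

/-! ### Deletion of unlocked edges and maximal subdivisions -/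

namespace IsFullSubdivision

variable {S S' : SimpleGraph P}

theorem unlocked_of_subset_region (hS : IsFullSubdivision S) (hP : GeneralPosition P)
    (hn : 3 ≤ P.card) {r : Set ℂ} (hr : r ∈ regions S) {p q : P}
    (hsub : openSegment ℝ (p : ℂ) q ⊆ r) : Unlocked S p q := by
  obtain ⟨a, ha⟩ := hS.exists_adj hn p
  exact IsComp.unlocked hr.2 (hS.convex r hr) hP hS.plane ha hsub

theorem unlocked_of_disjoint (hS : IsFullSubdivision S) (hP : GeneralPosition P)
    (hn : 3 ≤ P.card) {p q : P} (hpq : p ≠ q) (hH : s(p, q) ∉ hullEdges P)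
    (hsub : openSegment ℝ (p : ℂ) q ⊆ (edgeUnion S)ᶜ) : Unlocked S p q := by
  have hm := half_mem_openSegment (p : ℂ) q
  obtain ⟨r, hr, hr'⟩ := exists_isComp_superset (convex_openSegment (p : ℂ) q).isPreconnected
    ⟨_, hm⟩ hsub
  exact hS.unlocked_of_subset_region hP hn (hr.mem_regions_of_mem_interior hP hn hS.hull (hr' hm)
    (openSegment_subset_interior_of_notMem hpq hH hm)) hr'

/-- An edge that is removed in a coarsening is unlocked. -/
theorem unlocked_of_le (hS : IsFullSubdivision S) (hS' : IsFullSubdivision S')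
    (hP : GeneralPosition P) (hn : 3 ≤ P.card) (hle : S' ≤ S) {p q : P} (h : S.Adj p q)
    (h' : ¬ S'.Adj p q) : Unlocked S' p q := by
  refine hS'.unlocked_of_disjoint hP hn h.ne (fun hH => h' (hS'.hull hH)) fun z hz hzU => ?_
  obtain ⟨f, hf, hzf⟩ := mem_edgeUnion.1 hzU
  refine notMem_of_mem_openSegment hS.plane h hz (SimpleGraph.edgeSet_mono hle hf) ?_ hzf
  rintro rfl
  exact h' hf

/-- The two hull edges at an extreme point span an angle below `π` that contains every inner edge
there. -/
theorem unlocked_of_mem_extPts (hS : IsFullSubdivision S) (hP : GeneralPosition P)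
    (hn : 3 ≤ P.card) {p q : P} (h : s(p, q) ∈ innerEdges S) (hp : p ∈ extPts P) :
    Unlocked S p q := by
  have hpq : p ≠ q := S.ne_of_adj h.1
  obtain ⟨a, ha⟩ := (mem_extPts_iff hP hn).1 hp
  obtain ⟨b, hb⟩ := (mem_extPts_iff' hP hn).1 hp
  have hH := h.2
  rw [mem_hullEdges_iff] at hH
  have hqa : q ≠ a := by rintro rfl; exact hH (Or.inl ha)
  have hqb : q ≠ b := by rintro rfl; exact hH (Or.inr hb)
  have hab : a ≠ b := by rintro rfl; exact ha.not_swap hP hn hb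
  have h1 := lt_of_le_of_ne (ha.2 q) (orient_ne_zero hP ha.1 hpq hqa.symm)
  have h2 := lt_of_le_of_ne (ha.2 b) (orient_ne_zero hP ha.1 hb.1.symm hab)
  have h3 := lt_of_le_of_ne (hb.2 q) (orient_ne_zero hP hb.1 hqb.symm hpq)
  refine ⟨b, a, hS.hull (mem_hullEdges_iff.2 (Or.inr hb)),
    hS.hull (mem_hullEdges_iff.2 (Or.inl ha)),
    ?_, ?_, ?_⟩
  · rw [orient_swap_left]; linarith
  · rw [orient_swap]; linarith
  · rw [orient_swap]; linarith

/-- The regions after removal of an unlocked edge. -/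
theorem exists_merged (hS : IsFullSubdivision S) (hP : GeneralPosition P) (hn : 3 ≤ P.card)
    {p q : P} (h : s(p, q) ∈ innerEdges S) (hp : Unlocked S p q) (hq : Unlocked S q p) :
    ∃ M ∈ regions (S.deleteEdges {s(p, q)}), Convex ℝ M ∧ openSegment ℝ (p : ℂ) q ⊆ M ∧
      ∀ r ∈ regions (S.deleteEdges {s(p, q)}), r = M ∨ r ∈ regions S := by
  have hadj : S.Adj p q := h.1
  obtain ⟨⟨x, hx⟩, y, hy⟩ := exists_orient_of_notMem_hullEdges hadj.ne h.2
  obtain ⟨r₁, h₁, hs₁⟩ := hS.exists_region hP hn hadj hx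
  obtain ⟨r₂, h₂, hs₂⟩ := hS.exists_region hP hn hadj.symm hy
  obtain ⟨a, ha⟩ := hp.exists_adj_ne
  obtain ⟨b, hb⟩ := hq.exists_adj_ne
  rw [Sym2.eq_swap] at hb
  refine ⟨merged r₁ r₂ p q, ⟨?_, isComp_merged hS.plane hadj ha hb h₁.2 h₂.2 hs₁ hs₂⟩,
    convex_merged_of_unlocked hP hS.plane h₁.2 h₂.2 (hS.convex _ h₁) (hS.convex _ h₂) hadj hp hq
      hs₁ hs₂, fun z hz => Or.inl (Or.inr hz), fun r hr => ?_⟩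
  · exact (h₁.1.union ((isCompact_segment_complex (p : ℂ) q).isBounded.subset
      (openSegment_subset_segment _ _ _))).union h₂.1
  · exact (IsComp.eq_merged_or hS.plane hadj ha hb h₁.2 h₂.2 hs₁ hs₂ hr.2).imp_right
      fun h => ⟨hr.1, h⟩

/-- Connectivity is recovered from `Spread` by increasing paths; convexity concerns only the merged
region. -/
theorem deleteEdges (hS : IsFullSubdivision S) (hP : GeneralPosition P) (hn : 3 ≤ P.card)
    {p q : P} (h : s(p, q) ∈ innerEdges S) (hp : Unlocked S p q) (hq : Unlocked S q p) :
    IsFullSubdivision (S.deleteEdges {s(p, q)}) := by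
  obtain ⟨M, -, hMc, -, hM⟩ := hS.exists_merged hP hn h hp hq
  have hadj' : ∀ {u b : P}, S.Adj u b → s(u, b) ≠ s(p, q) →
      (S.deleteEdges {s(p, q)}).Adj u b := by
    intro u b hub hne
    rw [← SimpleGraph.mem_edgeSet, mem_edgeSet_deleteEdges]
    exact ⟨hub, hne⟩
  have hspread : Spread (S.deleteEdges {s(p, q)}) := by
    intro u a σ x hua hx
    obtain ⟨b, hb, hpos⟩ := hS.spread hP hn u a σ x (SimpleGraph.deleteEdges_le _ hua) hx
    by_cases hne : s(u, b) = s(p, q)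
    · rcases Sym2.eq_iff.1 hne with ⟨rfl, rfl⟩ | ⟨rfl, rfl⟩
      · exact hp.exists_adj_deleteEdges hpos
      · rw [Sym2.eq_swap]
        exact hq.exists_adj_deleteEdges hpos
    · exact ⟨b, hadj' hb hne, hpos⟩
  refine ⟨hS.plane.mono (SimpleGraph.deleteEdges_le _), ?_, ?_, ?_⟩
  · obtain ⟨c, hc⟩ := exists_generic P
    refine connected_of_exists_adj_right (Finset.card_pos.1 (by omega)) hc fun u x hx => ?_
    obtain ⟨b, hb⟩ := hS.exists_adj hn u
    have : ∃ a, (S.deleteEdges {s(p, q)}).Adj u a := by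
      by_cases hne : s(u, b) = s(p, q)
      · rcases Sym2.eq_iff.1 hne with ⟨rfl, rfl⟩ | ⟨rfl, rfl⟩
        · exact hp.exists_adj_ne
        · rw [Sym2.eq_swap]
          exact hq.exists_adj_ne
      · exact ⟨b, hadj' hb hne⟩
    obtain ⟨a, ha⟩ := this
    exact hspread.exists_adj_right hP hc ha hx
  · intro f hf
    exact mem_edgeSet_deleteEdges.2 ⟨hS.hull hf, by rintro rfl; exact h.2 hf⟩
  · intro r hr
    rcases hM r hr with rfl | hr
    · exact hMc
    · exact hS.convex r hr

/-- The inner edges that are not locked. -/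
def unlockedEdges (S : SimpleGraph P) : Set (Sym2 P) :=
  {e | e ∈ innerEdges S ∧ ∀ p q, e = s(p, q) → Unlocked S p q}

theorem mem_unlockedEdges {p q : P} : s(p, q) ∈ unlockedEdges S ↔
    s(p, q) ∈ innerEdges S ∧ Unlocked S p q ∧ Unlocked S q p := by
  refine and_congr_right fun _ => ⟨fun h => ⟨h p q rfl, h q p Sym2.eq_swap⟩, ?_⟩
  rintro ⟨h1, h2⟩ u v h
  rcases Sym2.eq_iff.1 h with ⟨rfl, rfl⟩ | ⟨rfl, rfl⟩
  · exact h1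
  · exact h2

theorem locked_iff {e : Sym2 P} (he : e ∈ innerEdges S) : Locked S e ↔ e ∉ unlockedEdges S := by
  induction e using Sym2.ind with
  | _ p q =>
    rw [mem_unlockedEdges]
    have hadj : S.Adj p q := he.1
    constructor
    · rintro ⟨u, v, h, hl⟩ ⟨-, h1, h2⟩
      rw [lockedAt_iff hl.1] at hl
      rcases Sym2.eq_iff.1 h with ⟨rfl, rfl⟩ | ⟨rfl, rfl⟩
      · exact hl h1
      · exact hl h2
    · intro h
      by_contra hl
      refine h ⟨he, ?_, ?_⟩
      · by_contra h1
        exact hl ⟨p, q, rfl, (lockedAt_iff hadj).2 h1⟩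
      · by_contra h1
        exact hl ⟨q, p, Sym2.eq_swap, (lockedAt_iff hadj.symm).2 h1⟩

/-- An unlocked inner edge can be deleted. In the other direction, an edge missing from a coarsening
`S'` is unlocked in `S'`, and monotonicity makes it unlocked in `S`; so no order of single deletions
has to be found. -/
theorem isMaximalSubdivision_iff (hS : IsFullSubdivision S) (hP : GeneralPosition P)
    (hn : 3 ≤ P.card) : IsMaximalSubdivision S ↔ ∀ e ∈ innerEdges S, Locked S e := by
  constructor
  · intro h e he
    rw [locked_iff he]
    induction e using Sym2.ind with
    | _ p q =>
      intro hu
      obtain ⟨-, h1, h2⟩ := mem_unlockedEdges.1 hu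
      have := h.2 _ (hS.deleteEdges hP hn he h1 h2)
        (SimpleGraph.edgeSet_mono (SimpleGraph.deleteEdges_le _))
      have hadj : S.Adj p q := he.1
      rw [← this] at hadj
      exact not_adj_deleteEdges hadj
  · intro h
    refine ⟨hS, fun S' hS' hle => ?_⟩
    have hle' : S' ≤ S := SimpleGraph.edgeSet_subset_edgeSet.1 hle
    by_contra hne
    have : ∃ p q, S.Adj p q ∧ ¬ S'.Adj p q := by
      by_contra hcon
      push Not at hcon
      exact hne (le_antisymm hle' fun p q hpq => hcon p q hpq)
    obtain ⟨p, q, h1, h2⟩ := this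
    have he : s(p, q) ∈ innerEdges S := ⟨h1, fun hH => h2 (hS'.hull hH)⟩
    refine (locked_iff he).1 (h _ he) (mem_unlockedEdges.2 ⟨he, ?_, ?_⟩)
    · exact (hS.unlocked_of_le hS' hP hn hle' h1 h2).mono hle'
    · exact (hS.unlocked_of_le hS' hP hn hle' h1.symm fun h => h2 h.symm).mono hle'

/-- Orient the locked inner edges to an endpoint where they are locked, with the generic
direction `c` breaking ties. -/
def lockOrientation (S : SimpleGraph P) (c : ℂ) : PartialOrientation S where
  dir q p := s(q, p) ∈ innerEdges S ∧ LockedAt S p q ∧ (LockedAt S q p → cr c q < cr c p)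
  adj _ _ h := h.1.1
  asymm _ _ h h' := lt_asymm (h.2.2 h'.2.1) (h'.2.2 h.2.1)

theorem lockOrientation_wellOriented (hS : IsFullSubdivision S) (hP : GeneralPosition P)
    (hn : 3 ≤ P.card) (c : ℂ) : (lockOrientation S c).WellOriented := by
  constructor
  · intro q p h hp
    exact (lockedAt_iff h.2.1.1).1 h.2.1
      (hS.unlocked_of_mem_extPts hP hn (by rw [Sym2.eq_swap]; exact h.1) hp)
  · exact fun p a b hab ha hb => ha.2.1.consecutive hP hab hb.2.1

/-- An edge locked at both ends is still oriented, because the generic functional distinguishes its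
ends. -/
theorem unorientedInner_lockOrientation_subset {c : ℂ} (hc : Generic P c) :
    (lockOrientation S c).unorientedInner ⊆ unlockedEdges S := by
  rintro e ⟨he, hno⟩
  by_contra hu
  rw [← locked_iff he] at hu
  obtain ⟨p, q, rfl, hl⟩ := hu
  by_cases hl' : LockedAt S q p
  · have hne := hc p q hl.1.ne
    rw [cr_sub_right, sub_ne_zero] at hne
    rcases lt_or_gt_of_ne hne with h | h
    · exact hno q p Sym2.eq_swap ⟨by rw [Sym2.eq_swap]; exact he, hl, fun _ => h⟩
    · exact hno p q rfl ⟨he, hl', fun _ => h⟩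
  · exact hno q p Sym2.eq_swap ⟨by rw [Sym2.eq_swap]; exact he, hl, fun h => absurd h hl'⟩

/-- The common source of all lower bounds for maximal subdivisions (no unlocked edges), flips (slack
0) and compatible flips (slack 1). -/
theorem le_ncard_unlockedEdges (hS : IsFullSubdivision S) (hP : GeneralPosition P)
    (hn : 3 ≤ P.card) : ((unlockedEdges S).ncard : ℝ) ≥
      max ((P.card : ℝ) / 2 - 2 - slack S) ((extNum P : ℝ) - 3 - slack S) := by
  obtain ⟨c, hc⟩ := exists_generic P
  refine (le_unoriented_of_wellOriented hP hn hS _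
    (hS.lockOrientation_wellOriented hP hn c)).trans ?_
  exact_mod_cast Set.ncard_le_ncard (unorientedInner_lockOrientation_subset hc) (Set.toFinite _)

end IsFullSubdivision

theorem IsMaximalSubdivision.le_slack {S : SimpleGraph P} (hS : IsMaximalSubdivision S)
    (hP : GeneralPosition P) (hn : 3 ≤ P.card) :
    (slack S : ℝ) ≥ max ((P.card : ℝ) / 2 - 2) ((extNum P : ℝ) - 3) := by
  have h1 := hS.1.le_ncard_unlockedEdges hP hn
  have h2 : IsFullSubdivision.unlockedEdges S = ∅ := by
    refine Set.eq_empty_of_forall_notMem fun e he => ?_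
    exact (IsFullSubdivision.locked_iff he.1).1
      ((hS.1.isMaximalSubdivision_iff hP hn).1 hS e he.1) he
  rw [h2, Set.ncard_empty, Nat.cast_zero, ge_iff_le, max_le_iff] at h1
  exact max_le (by linarith [h1.1]) (by linarith [h1.2])

end

section

variable {P : Finset ℂ} {G : SimpleGraph P}

/-! ### Adding a diagonal -/

theorem IsPlane.sup_edge (hP : GeneralPosition P) (hG : IsPlane G) {a b : P} (hab : a ≠ b)
    (h : ∀ z ∈ openSegment ℝ (a : ℂ) b, ∀ f ∈ G.edgeSet, f ≠ s(a, b) → z ∉ edgeSeg f) :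
    IsPlane (G ⊔ SimpleGraph.edge a b) := by
  have key : ∀ f ∈ G.edgeSet, f ≠ s(a, b) → ∀ z, z ∈ edgeSeg s(a, b) → z ∈ edgeSeg f →
      ∃ p : P, p ∈ s(a, b) ∧ p ∈ f ∧ (p : ℂ) = z := by
    intro f hf hne z hz hzf
    by_cases h1 : z = a
    · subst h1
      exact ⟨a, Sym2.mem_mk_left _ _, mem_edge_of_mem_edgeSeg hP hf hzf, rfl⟩
    by_cases h2 : z = b
    · subst h2
      exact ⟨b, Sym2.mem_mk_right _ _, mem_edge_of_mem_edgeSeg hP hf hzf, rfl⟩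
    exact absurd hzf (h z (mem_openSegment_of_ne_left_right (Ne.symm h1) (Ne.symm h2) hz) f hf hne)
  intro e he f hf hne z hz
  rw [SimpleGraph.edgeSet_sup, SimpleGraph.edgeSet_edge_of_ne hab] at he hf
  by_cases hea : e = s(a, b)
  · subst hea
    exact key f (hf.resolve_right fun h => hne h.symm) hne.symm z hz.1 hz.2
  · have he' := he.resolve_right hea
    by_cases hfa : f = s(a, b)
    · subst hfa
      obtain ⟨p, h1, h2, h3⟩ := key e he' hea z hz.2 hz.1
      exact ⟨p, h2, h1, h3⟩
    · exact hG e he' f (hf.resolve_right hfa) hne hz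

theorem edgeUnion_sup_edge {a b : P} (hab : a ≠ b) :
    edgeUnion (G ⊔ SimpleGraph.edge a b) = edgeUnion G ∪ segment ℝ (a : ℂ) b := by
  rw [edgeUnion, SimpleGraph.edgeSet_sup, SimpleGraph.edgeSet_edge_of_ne hab, Set.biUnion_union,
    Set.biUnion_singleton]
  rfl

/-- A convex component that contains the open chord `ab` but not its ends meets the line `ab` in
nothing else. -/
theorem IsComp.mem_openSegment_of_orient_eq_zero {M : Set ℂ} (hM : IsComp G M) (hc : Convex ℝ M)
    {a b a₀ b₀ : P} (ha : G.Adj a a₀) (hb : G.Adj b b₀) (hab : a ≠ b)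
    (hsub : openSegment ℝ (a : ℂ) b ⊆ M) {w : ℂ} (hw : w ∈ M) (h0 : orient (a : ℂ) b w = 0) :
    w ∈ openSegment ℝ (a : ℂ) b := by
  have haM : (a : ℂ) ∉ M := fun h => hM.subset h (mem_edgeUnion_of_adj ha)
  have hbM : (b : ℂ) ∉ M := fun h => hM.subset h (mem_edgeUnion_of_adj hb)
  obtain ⟨t, ht⟩ := eq_smul_of_cr_eq_zero (coe_sub_ne_zero hab) h0
  obtain rfl : w = a + t • ((b : ℂ) - a) := by rw [← ht]; ring
  have hm := hsub (half_mem_openSegment (a : ℂ) b)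
  have hseg := hc.segment_subset hm hw
  have hpt : ∀ s : ℝ, 0 ≤ s → s ≤ 1 →
      (a : ℂ) + ((1 - s) * (1 / 2) + s * t) • ((b : ℂ) - a) ∈ M := by
    intro s h1 h2
    apply hseg
    refine ⟨1 - s, s, by linarith, h1, by ring, ?_⟩
    module
  rw [openSegment_eq_image']
  refine ⟨t, ⟨?_, ?_⟩, rfl⟩
  · by_contra hneg
    push Not at hneg
    apply haM
    have hd : 0 < 1 / 2 - t := by linarith
    -- At this ratio the segment from the midpoint of `ab` to the point of parameter `t ≤ 0` passes
    -- through `a`.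
    have := hpt ((1 / 2) / (1 / 2 - t)) (by positivity) ((div_le_one hd).2 (by linarith))
    have e : (1 - (1 / 2) / (1 / 2 - t)) * (1 / 2) + (1 / 2) / (1 / 2 - t) * t = 0 := by
      linear_combination -(div_mul_cancel₀ (1 / 2 : ℝ) hd.ne')
    rwa [e, zero_smul, add_zero] at this
  · by_contra hneg
    push Not at hneg
    apply hbM
    have hd : 0 < t - 1 / 2 := by linarith
    have := hpt ((1 / 2) / (t - 1 / 2)) (by positivity) ((div_le_one hd).2 (by linarith))
    have e : (1 - (1 / 2) / (t - 1 / 2)) * (1 / 2) + (1 / 2) / (t - 1 / 2) * t = 1 := by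
      linear_combination div_mul_cancel₀ (1 / 2 : ℝ) hd.ne'
    rwa [e, one_smul, add_sub_cancel] at this

/-- The chord cuts `M` into its intersections with the two open half planes of the line `ab`; every
other component is untouched. -/
theorem IsFullSubdivision.sup_edge {S : SimpleGraph P} (hS : IsFullSubdivision S)
    (hP : GeneralPosition P) (hn : 3 ≤ P.card) {M : Set ℂ} (hM : M ∈ regions S) {a b : P}
    (hab : a ≠ b) (hsub : openSegment ℝ (a : ℂ) b ⊆ M) :
    IsFullSubdivision (S ⊔ SimpleGraph.edge a b) := by
  have hMU : M ⊆ (edgeUnion S)ᶜ := IsComp.subset hM.2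
  obtain ⟨a₀, ha⟩ := hS.exists_adj hn a
  obtain ⟨b₀, hb⟩ := hS.exists_adj hn b
  refine ⟨hS.plane.sup_edge hP hab fun z hz f hf _ hzf =>
      hMU (hsub hz) (mem_edgeUnion.2 ⟨f, hf, hzf⟩),
    hS.connected.mono le_sup_left, hS.hull.trans (SimpleGraph.edgeSet_mono le_sup_left), ?_⟩
  rintro r ⟨hrb, hr⟩
  replace hr : IsComp (S ⊔ SimpleGraph.edge a b) r := hr
  have hU := edgeUnion_sup_edge (G := S) hab
  have hU' : ∀ z, z ∈ (edgeUnion S)ᶜ → z ∉ openSegment ℝ (a : ℂ) b →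
      z ∈ (edgeUnion (S ⊔ SimpleGraph.edge a b))ᶜ := by
    intro z hz hzo
    rw [hU]
    rintro (h | h)
    · exact hz h
    · refine hzo (mem_openSegment_of_ne_left_right ?_ ?_ h)
      · rintro rfl; exact hz (mem_edgeUnion_of_adj ha)
      · rintro rfl; exact hz (mem_edgeUnion_of_adj hb)
  have hrU : r ⊆ (edgeUnion S)ᶜ := by
    intro z hz h
    apply hr.subset hz
    rw [hU]
    exact Or.inl h
  have hrs : ∀ z ∈ r, z ∉ openSegment ℝ (a : ℂ) b := by
    intro z hz h
    apply hr.subset hz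
    rw [hU]
    exact Or.inr (openSegment_subset_segment _ _ _ h)
  obtain ⟨m, hm, hrm⟩ := exists_isComp_superset hr.isPreconnected hr.nonempty hrU
  obtain ⟨y, hy⟩ := hr.nonempty
  by_cases hmM : m = M
  · subst hmM
    have hno : ∀ z ∈ r, orient (a : ℂ) b z ≠ 0 := fun z hz h0 => hrs z hz
      (hm.mem_openSegment_of_orient_eq_zero (hS.convex _ hM) ha hb hab hsub (hrm hz) h0)
    have side : ∀ σ : ℝ, 0 < σ * cr ((b : ℂ) - a) (y - a) → Convex ℝ r := by
      intro σ hσ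
      have hσ0 : σ ≠ 0 := by rintro rfl; simp at hσ
      have hconv := (hS.convex m hM).inter (convex_cr_pos σ ((b : ℂ) - a) a)
      have h1 : m ∩ {w | 0 < σ * cr ((b : ℂ) - a) (w - a)} ⊆ r := by
        refine hr.subset_of_isPreconnected hconv.isPreconnected ?_ ⟨hrm hy, hσ⟩ hy
        rintro z ⟨hz1, hz2⟩
        refine hU' z (hm.subset hz1) fun h => ?_
        have := cr_eq_zero_of_mem_segment (openSegment_subset_segment _ _ _ h)
        rw [Set.mem_ofPred_eq, this, mul_zero] at hz2
        exact lt_irrefl _ hz2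
      have h2 : r ⊆ {w | 0 < σ * cr ((b : ℂ) - a) (w - a)} := by
        refine hr.isPreconnected.subset_left_of_subset_union
          (v := {w | σ * cr ((b : ℂ) - a) (w - a) < 0})
          (isOpen_lt continuous_const (continuous_const.mul (continuous_cr _ _)))
          (isOpen_lt (continuous_const.mul (continuous_cr _ _)) continuous_const) ?_ ?_ ⟨y, hy, hσ⟩
        · rw [Set.disjoint_left]
          intro z h1 h2
          rw [Set.mem_ofPred_eq] at h1 h2
          exact lt_asymm h1 h2
        · intro z hz
          rcases lt_or_gt_of_ne (mul_ne_zero hσ0 (hno z hz)) with h | h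
          · exact Or.inr h
          · exact Or.inl h
      rw [(Set.subset_inter hrm h2).antisymm h1]
      exact hconv
    rcases lt_or_gt_of_ne (hno y hy) with h | h
    · exact side (-1) (by rw [orient] at h; linarith)
    · exact side 1 (by rw [orient] at h; linarith)
  · have : r = m := by
      refine hrm.antisymm (hr.subset_of_isPreconnected hm.isPreconnected ?_ (hrm hy) hy)
      intro z hz
      exact hU' z (hm.subset hz) fun h => hmM (hm.eq_of_mem hM.2 hz (hsub h))
    rw [this] at hrb ⊢
    exact hS.convex m ⟨hrb, hm⟩

/-! ### Flips -/

/-- If `Q` missed the deleted edge, it would have been a region already before the deletion. -/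
theorem IsFlipQuad.openSegment_subset {T : SimpleGraph P} {p q : P} {Q : Set ℂ}
    (h : IsFlipQuad T s(p, q) Q) (hT : IsPlane T) : openSegment ℝ (p : ℂ) q ⊆ Q := by
  obtain ⟨he, ⟨hb, hQ⟩, hno, hc, -⟩ := h
  replace hQ : IsComp (T.deleteEdges {s(p, q)}) Q := hQ
  have hadj : T.Adj p q := he.1
  have hU : openSegment ℝ (p : ℂ) q ⊆ (edgeUnion (T.deleteEdges {s(p, q)}))ᶜ := by
    intro z hz hzU
    obtain ⟨f, hf, hzf⟩ := mem_edgeUnion.1 hzU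
    obtain ⟨h1, h2⟩ := mem_edgeSet_deleteEdges.1 hf
    exact notMem_of_mem_openSegment hT hadj hz h1 h2 hzf
  by_cases hdis : ∃ z ∈ Q, z ∈ openSegment ℝ (p : ℂ) q
  · obtain ⟨z, h1, h2⟩ := hdis
    exact hQ.subset_of_isPreconnected (convex_openSegment _ _).isPreconnected hU h2 h1
  · exfalso
    push Not at hdis
    have hseg : ∀ z ∈ Q, z ∉ segment ℝ (p : ℂ) q := by
      intro z hz hzs
      rw [← closure_openSegment] at hzs
      obtain ⟨y, h1, h2⟩ := mem_closure_iff.1 hzs Q hQ.isOpen hz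
      exact hdis y h1 h2
    refine hno ⟨hb, isComp_of_isOpen hQ.isOpen hQ.isPreconnected hQ.nonempty ?_ ?_⟩
    · intro z hz hzU
      obtain ⟨f, hf, hzf⟩ := mem_edgeUnion.1 hzU
      by_cases hfe : f = s(p, q)
      · subst hfe; exact hseg z hz hzf
      · exact hQ.subset hz (mem_edgeUnion.2 ⟨f, mem_edgeSet_deleteEdges.2 ⟨hf, hfe⟩, hzf⟩)
    · rintro z ⟨hz, hzU⟩
      refine hQ.closure_inter_subset ⟨hz, fun hzU' => ?_⟩
      obtain ⟨f, hf, hzf⟩ := mem_edgeUnion.1 hzU'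
      exact hzU (mem_edgeUnion.2 ⟨f, (mem_edgeSet_deleteEdges.1 hf).1, hzf⟩)

/-! ### Flips in full subdivisions of slack zero -/

namespace IsFullSubdivision

variable {T : SimpleGraph P}

theorem mem_unlockedEdges_of_flippable (hT : IsFullSubdivision T) (hP : GeneralPosition P)
    (hn : 3 ≤ P.card) {e : Sym2 P} (h : Flippable T e) : e ∈ unlockedEdges T := by
  obtain ⟨Q, hQ⟩ := h
  have key : ∀ p q, e = s(p, q) → Unlocked T p q := by
    rintro p q rfl
    have hadj : T.Adj p q := hQ.1.1
    obtain ⟨⟨x, hx⟩, -⟩ := exists_orient_of_notMem_hullEdges hadj.ne hQ.1.2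
    obtain ⟨b, hb, hpos⟩ := hT.spread hP hn p q 1 x hadj (by linarith)
    have hbq : b ≠ q := by rintro rfl; simp at hpos
    refine Unlocked.mono (SimpleGraph.deleteEdges_le {s(p, q)})
      (IsComp.unlocked hQ.2.1.2 hQ.2.2.2.1 hP (hT.plane.mono (SimpleGraph.deleteEdges_le _))
        (a₀ := b) ?_ (hQ.openSegment_subset hT.plane))
    rw [← SimpleGraph.mem_edgeSet, mem_edgeSet_deleteEdges]
    exact ⟨hb, fun h => hbq (Sym2.congr_right.1 h)⟩
  exact ⟨hQ.1, key⟩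

theorem slack_deleteEdges (hT : IsFullSubdivision T) (hP : GeneralPosition P)
    (hn : 3 ≤ P.card) {e : Sym2 P} (he : e ∈ T.edgeSet)
    (hS : IsFullSubdivision (T.deleteEdges {e})) : slack (T.deleteEdges {e}) = slack T + 1 := by
  have h1 := hT.slack_add_edges hP hn
  have h2 := hS.slack_add_edges hP hn
  have h3 : (T.deleteEdges {e}).edgeSet.ncard + 1 = T.edgeSet.ncard := by
    rw [SimpleGraph.edgeSet_deleteEdges]
    exact Set.ncard_sdiff_singleton_add_one he (Set.toFinite _)
  omega

/-- Deleting an edge raises the slack from 0 to 1. All regions but the merged one are old and have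
slack 0, so the merged one has slack 1 and is a quadrilateral. -/
theorem exists_flipQuad (hT : IsFullSubdivision T) (hP : GeneralPosition P) (hn : 3 ≤ P.card)
    (h0 : slack T = 0) {p q : P} (he : s(p, q) ∈ unlockedEdges T) :
    ∃ M, IsFlipQuad T s(p, q) M ∧ openSegment ℝ (p : ℂ) q ⊆ M := by
  obtain ⟨hin, hp, hq⟩ := mem_unlockedEdges.1 he
  have hadj : T.Adj p q := hin.1
  have hS := hT.deleteEdges hP hn hin hp hq
  obtain ⟨M, hM, hMc, hMs, hMo⟩ := hT.exists_merged hP hn hin hp hq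
  refine ⟨M, ⟨hin, hM, fun h => ?_, hMc, ?_⟩, hMs⟩
  · have hm := half_mem_openSegment (p : ℂ) q
    exact IsComp.subset h.2 (hMs hm)
      (mem_edgeUnion.2 ⟨s(p, q), hadj, openSegment_subset_segment _ _ _ hm⟩)
  · have h1 := hT.slack_deleteEdges hP hn hadj hS
    rw [h0, hS.slack_eq_sum hP hn, Finset.sum_eq_single M] at h1
    · rw [regionSlack] at h1
      omega
    · intro r hr hrM
      have hr' := (hMo r ((hS.mem_regionFinset hP hn).1 hr)).resolve_left hrM
      rw [hT.slack_eq_sum hP hn, Finset.sum_eq_zero_iff_of_nonneg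
        fun r hr => hT.regionSlack_nonneg hP ((hT.mem_regionFinset hP hn).1 hr)] at h0
      exact h0 r ((hT.mem_regionFinset hP hn).2 hr')
    · intro h
      exact absurd ((hS.mem_regionFinset hP hn).2 hM) h

/-- The diagonals of a convex quadrilateral cross. -/
theorem openSegment_subset_of_quad {M : Set ℂ} (hM : IsOpen M) (hc : Convex ℝ M) {p q a b : ℂ}
    (hpq : p ≠ q) (hMs : openSegment ℝ p q ⊆ M) (hp : p ∈ closure M) (ha : a ∈ closure M)
    (hb : b ∈ closure M) (hq : q ∈ Set.extremePoints ℝ (closure M)) (haq : 0 < orient p a q)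
    (hqb : 0 < orient p q b) (hab : 0 < orient p a b) : openSegment ℝ a b ⊆ M := by
  have hqa : 0 < -orient p q a := by rw [orient_swap] at haq; linarith
  set A := -orient p q a
  set B := orient p q b
  have hAB : 0 < A + B := by linarith
  -- The point of `ab` on the line `pq`; `A` and `B` are twice the areas of the triangles that `a`
  -- and `b` form with `pq`.
  set w := (B / (A + B)) • a + (A / (A + B)) • b
  have hsum : B / (A + B) + A / (A + B) = 1 := by field_simp; ring
  have hBp : 0 < B / (A + B) := by positivity
  have hAp : 0 < A / (A + B) := by positivity
  have hw : w ∈ openSegment ℝ a b := ⟨_, _, hBp, hAp, hsum, rfl⟩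
  have hcr : ∀ c : ℂ, cr c (w - p) = B / (A + B) * cr c (a - p) + A / (A + B) * cr c (b - p) := by
    intro c
    have e : w - p = (B / (A + B)) • (a - p) + (A / (A + B)) • (b - p) := by
      have : p = (B / (A + B) + A / (A + B)) • p := by rw [hsum, one_smul]
      conv_lhs => rw [this]
      simp only [w]
      module
    rw [e, cr_add_right, cr_smul_right, cr_smul_right]
  have h0 : cr (q - p) (w - p) = 0 := by
    rw [hcr]
    have e1 : cr (q - p) (a - p) = -A := by simp only [A, orient]; ring
    have e2 : cr (q - p) (b - p) = B := rfl
    rw [e1, e2]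
    ring
  have hwc : w ∈ closure M := hc.closure.openSegment_subset ha hb hw
  obtain ⟨t, ht⟩ := eq_smul_of_cr_eq_zero (sub_ne_zero.2 hpq.symm) h0
  have ht0 : 0 < t := by
    have h1 := hcr (a - p)
    rw [ht, cr_smul_right, cr_self, mul_zero, zero_add] at h1
    refine pos_of_mul_pos_left (b := cr (a - p) (q - p)) ?_ haq.le
    rw [h1]
    exact mul_pos hAp hab
  have hwt : w = p + t • (q - p) := by rw [← ht]; ring
  -- At or beyond `q`, the crossing point would show that `q` is not extreme.
  have ht1 : t < 1 := by
    by_contra hge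
    push Not at hge
    rcases hge.eq_or_lt with rfl | hgt
    · rw [one_smul, add_sub_cancel] at hwt
      rw [hwt] at hw
      have := hq.2 ha hb hw
      rw [this, orient_self_right] at haq
      exact lt_irrefl _ haq
    · refine hpq (hq.2 hp hwc ?_)
      rw [openSegment_eq_image', hwt]
      refine ⟨t⁻¹, ⟨by positivity, inv_lt_one_of_one_lt₀ hgt⟩, ?_⟩
      dsimp only
      rw [add_sub_cancel_left, smul_smul, inv_mul_cancel₀ (by positivity), one_smul,
        add_sub_cancel]
  have hwM : w ∈ M := by
    apply hMs
    rw [openSegment_eq_image', hwt]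
    exact ⟨t, ⟨ht0, ht1⟩, rfl⟩
  have mix : ∀ x ∈ closure M, openSegment ℝ x w ⊆ M := by
    intro x hx
    have := hc.openSegment_closure_interior_subset_interior hx (by rwa [hM.interior_eq])
    rwa [hM.interior_eq] at this
  intro z hz
  have hwr : w ∈ Set.range (AffineMap.lineMap a b : ℝ → ℂ) := by
    rw [openSegment_eq_image_lineMap] at hw
    exact Set.image_subset_range _ _ hw
  rcases openSegment_subset_union a b hwr hz with rfl | hz | hz
  · exact hwM
  · exact mix a ha hz
  · rw [openSegment_symm] at hz
    exact mix b hb hz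

/-- The second diagonal joins the neighbors `a`, `b` that span the corner of the quadrilateral at
`p`. Inserting it restores the number of edges, hence slack 0, so the flip can be iterated. -/
theorem exists_isFlip (hT : IsFullSubdivision T) (hP : GeneralPosition P) (hn : 3 ≤ P.card)
    (h0 : slack T = 0) {e : Sym2 P} (he : e ∈ unlockedEdges T) :
    ∃ T', IsFlip T e T' ∧ IsFullSubdivision T' ∧ slack T' = 0 ∧ T.deleteEdges {e} ≤ T' := by
  induction e using Sym2.ind with
  | _ p q =>
  obtain ⟨M, hQ, hMs⟩ := hT.exists_flipQuad hP hn h0 he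
  obtain ⟨hin, hp, hq⟩ := mem_unlockedEdges.1 he
  have hadj : T.Adj p q := hin.1
  have hS := hT.deleteEdges hP hn hin hp hq
  obtain ⟨-, hM, -, hMc, hM4⟩ := id hQ
  have ger : ∀ {u v : P}, openSegment ℝ (u : ℂ) v ⊆ M → Ger M u ((v : ℂ) - u) := by
    intro u v h
    filter_upwards [Ioo_mem_nhdsGT (one_pos (α := ℝ))] with ε hε
    apply h
    rw [openSegment_eq_image']
    exact ⟨ε, hε, rfl⟩
  obtain ⟨p', hp'⟩ := hS.exists_adj hn p
  obtain ⟨q', hq'⟩ := hS.exists_adj hn q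
  obtain ⟨a, b, hw, hs, h1, h2⟩ := IsComp.exists_wedge_of_ger hM.2 hMc hP hS.plane hp' (ger hMs)
  obtain ⟨a', b', hw', hs', -, -⟩ := IsComp.exists_wedge_of_ger hM.2 hMc hP hS.plane hq'
    (ger (u := q) (v := p) (by rwa [openSegment_symm]))
  obtain ⟨ep, ea, eb⟩ := hS.mem_extremePoints_of_wedge hP hM hw hs
  obtain ⟨eq, -, -⟩ := hS.mem_extremePoints_of_wedge hP hM hw' hs'
  have hab : a ≠ b := by rintro rfl; exact absurd hw.pos (by simp)
  have haq : a ≠ q := by rintro rfl; simp at h1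
  have hbq : b ≠ q := by rintro rfl; simp at h2
  have hpq : p ≠ q := hadj.ne
  have hsubM : openSegment ℝ (a : ℂ) b ⊆ M :=
    openSegment_subset_of_quad (IsComp.isOpen hM.2) hMc (coe_ne_of_adj hadj).symm hMs ep.1 ea.1
      eb.1 eq h1 h2 hw.pos
  have hext : Set.extremePoints ℝ (closure M) = {(p : ℂ), (q : ℂ), (a : ℂ), (b : ℂ)} := by
    symm
    refine Set.eq_of_subset_of_ncard_le ?_ ?_ (hS.finite_extremePoints hP hM)
    · rintro z (rfl | rfl | rfl | rfl)
      exacts [ep, eq, ea, eb]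
    · rw [corners] at hM4
      have hne : ∀ {u v : P}, u ≠ v → (u : ℂ) ≠ v := fun h => Subtype.coe_injective.ne h
      rw [hM4, Set.ncard_eq_four.2 ⟨(p : ℂ), q, a, b, hne hpq, hne hw.left.ne, hne hw.right.ne,
        hne haq.symm, hne hbq.symm, hne hab, rfl⟩]
  have hnot : s(a, b) ∉ (T.deleteEdges {s(p, q)}).edgeSet := fun h => by
    have hm := half_mem_openSegment (a : ℂ) b
    exact IsComp.subset hM.2 (hsubM hm)
      (mem_edgeUnion.2 ⟨s(a, b), h, openSegment_subset_segment _ _ _ hm⟩)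
  have hT' := hS.sup_edge hP hn hM hab hsubM
  have hE : (T.deleteEdges {s(p, q)} ⊔ SimpleGraph.edge a b).edgeSet =
      (T.deleteEdges {s(p, q)}).edgeSet ∪ {s(a, b)} := by
    rw [SimpleGraph.edgeSet_sup, SimpleGraph.edgeSet_edge_of_ne hab]
  refine ⟨_, ⟨M, hQ, p, q, a, b, rfl, hext, ?_⟩, hT', ?_, le_sup_left⟩
  · rw [hE, SimpleGraph.edgeSet_deleteEdges]
  · have k1 := hT'.slack_add_edges hP hn
    have k2 := hS.slack_add_edges hP hn
    have k3 := hT.slack_deleteEdges hP hn hadj hS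
    have k4 : (T.deleteEdges {s(p, q)} ⊔ SimpleGraph.edge a b).edgeSet.ncard =
        (T.deleteEdges {s(p, q)}).edgeSet.ncard + 1 := by
      rw [hE, Set.union_singleton, Set.ncard_insert_of_notMem hnot (Set.toFinite _)]
    omega

theorem flippable_iff (hT : IsFullSubdivision T) (hP : GeneralPosition P) (hn : 3 ≤ P.card)
    (h0 : slack T = 0) {e : Sym2 P} : Flippable T e ↔ e ∈ unlockedEdges T := by
  refine ⟨hT.mem_unlockedEdges_of_flippable hP hn, fun h => ?_⟩
  obtain ⟨T', ⟨Q, hQ, -⟩, -⟩ := hT.exists_isFlip hP hn h0 h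
  exact ⟨Q, hQ⟩

theorem unlockedEdges_mono {S S' : SimpleGraph P} (h : S ≤ S') :
    unlockedEdges S ⊆ unlockedEdges S' := fun _ he =>
  ⟨⟨SimpleGraph.edgeSet_mono h he.1.1, he.1.2⟩, fun p q hpq => (he.2 p q hpq).mono h⟩

/-- `T - e` is contained in `T` and in `T[e]`, so `f` is unlocked in both. Deleting both edges
leaves a full subdivision, whence `e` is unlocked in `T - f` and thus in `T[f]`. Unlocked edges can
be flipped when the slack is 0. -/
theorem compatible_of_mem_unlockedEdges (hT : IsFullSubdivision T) (hP : GeneralPosition P)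
    (hn : 3 ≤ P.card) (h0 : slack T = 0) {e f : Sym2 P} (he : e ∈ unlockedEdges T)
    (hS : IsFullSubdivision (T.deleteEdges {e})) (hf : f ∈ unlockedEdges (T.deleteEdges {e})) :
    Compatible T e f := by
  have hfT := unlockedEdges_mono (SimpleGraph.deleteEdges_le {e}) hf
  have hne : f ≠ e := (mem_edgeSet_deleteEdges.1 hf.1.1).2
  obtain ⟨Te, h1, hTe, hTe0, hle⟩ := hT.exists_isFlip hP hn h0 he
  obtain ⟨Tf, h2, hTf, hTf0, hlf⟩ := hT.exists_isFlip hP hn h0 hfT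
  obtain ⟨Tef, h3, -⟩ := hTe.exists_isFlip hP hn hTe0 (unlockedEdges_mono hle hf)
  have heTf : e ∈ unlockedEdges Tf := by
    refine unlockedEdges_mono hlf ?_
    induction e using Sym2.ind with
    | _ p q =>
    induction f using Sym2.ind with
    | _ u v =>
    obtain ⟨k1, k2, k3⟩ := mem_unlockedEdges.1 hf
    obtain ⟨l1, l2, l3⟩ := mem_unlockedEdges.1 hfT
    have hSf := hS.deleteEdges hP hn k1 k2 k3
    have hTf := hT.deleteEdges hP hn l1 l2 l3
    have hle : (T.deleteEdges {s(p, q)}).deleteEdges {s(u, v)} ≤ T.deleteEdges {s(u, v)} :=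
      SimpleGraph.deleteEdges_mono (SimpleGraph.deleteEdges_le _)
    have hadj : (T.deleteEdges {s(u, v)}).Adj p q := by
      rw [← SimpleGraph.mem_edgeSet, mem_edgeSet_deleteEdges]
      exact ⟨he.1.1, hne.symm⟩
    have hnadj : ¬ ((T.deleteEdges {s(p, q)}).deleteEdges {s(u, v)}).Adj p q := fun h =>
      not_adj_deleteEdges (SimpleGraph.deleteEdges_le _ h)
    exact mem_unlockedEdges.2 ⟨⟨hadj, he.1.2⟩,
      (hTf.unlocked_of_le hSf hP hn hle hadj hnadj).mono hle,
      (hTf.unlocked_of_le hSf hP hn hle hadj.symm fun h => hnadj h.symm).mono hle⟩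
  obtain ⟨Tfe, h4, -⟩ := hTf.exists_isFlip hP hn hTf0 heTf
  by_cases heq : Tef = Tfe
  · exact Or.inl ⟨hne.symm, Te, Tf, Tef, Tfe, h1, h2, h3, h4, heq⟩
  · exact Or.inr ⟨hne.symm, Te, Tf, Tef, Tfe, h1, h2, h3, h4, heq⟩

theorem le_ncard_flippable (hT : IsFullSubdivision T) (hP : GeneralPosition P) (hn : 3 ≤ P.card)
    (h0 : slack T = 0) : ({e | Flippable T e}.ncard : ℝ) ≥
      max ((P.card : ℝ) / 2 - 2) ((extNum P : ℝ) - 3) := by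
  have h := hT.le_ncard_unlockedEdges hP hn
  rw [h0, Int.cast_zero, sub_zero, sub_zero] at h
  refine h.trans ?_
  exact_mod_cast Set.ncard_le_ncard (fun e he => (hT.flippable_iff hP hn h0).2 he) (Set.toFinite _)

theorem le_ncard_compatible (hT : IsFullSubdivision T) (hP : GeneralPosition P) (hn : 3 ≤ P.card)
    (h0 : slack T = 0) {e : Sym2 P} (he : Flippable T e) :
    ({f | f ∈ T.edgeSet ∧ Compatible T e f}.ncard : ℝ) ≥
      max ((P.card : ℝ) / 2 - 3) ((extNum P : ℝ) - 4) := by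
  have heu := (hT.flippable_iff hP hn h0).1 he
  have hS : IsFullSubdivision (T.deleteEdges {e}) := by
    induction e using Sym2.ind with
    | _ p q =>
    obtain ⟨h1, h2, h3⟩ := mem_unlockedEdges.1 heu
    exact hT.deleteEdges hP hn h1 h2 h3
  have h := hS.le_ncard_unlockedEdges hP hn
  rw [hT.slack_deleteEdges hP hn heu.1.1 hS, h0] at h
  have hle : ((unlockedEdges (T.deleteEdges {e})).ncard : ℝ) ≤
      ({f | f ∈ T.edgeSet ∧ Compatible T e f}.ncard : ℝ) := by
    have hsub : unlockedEdges (T.deleteEdges {e}) ⊆ {f | f ∈ T.edgeSet ∧ Compatible T e f} :=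
      fun f hf => ⟨(mem_edgeSet_deleteEdges.1 hf.1.1).1,
        hT.compatible_of_mem_unlockedEdges hP hn h0 heu hS hf⟩
    exact_mod_cast Set.ncard_le_ncard hsub (Set.toFinite _)
  push_cast at h
  rw [ge_iff_le, max_le_iff] at h
  exact max_le (by linarith [h.1]) (by linarith [h.2])

end IsFullSubdivision

end

section

variable {P : Finset ℂ} {G T : SimpleGraph P}

/-! ### Visibility in maximal plane graphs -/

theorem cr_lerp_right (c p x y : ℂ) (t : ℝ) :
    cr c (x + t • (y - x) - p) = (1 - t) * cr c (x - p) + t * cr c (y - p) := by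
  simp [cr]; ring

theorem cr_lerp_left (c p x y : ℂ) (t : ℝ) :
    cr (x + t • (y - x) - p) c = (1 - t) * cr (x - p) c + t * cr (y - p) c := by
  simp [cr]; ring

theorem IsFullTriangulation.adj (hT : IsFullTriangulation T) (hP : GeneralPosition P) {a b : P}
    (hab : a ≠ b)
    (h : ∀ z ∈ openSegment ℝ (a : ℂ) b, ∀ f ∈ T.edgeSet, f ≠ s(a, b) → z ∉ edgeSeg f) :
    T.Adj a b := by
  have hle := hT.le_of_ge (IsPlane.sup_edge hP hT.prop hab h) le_sup_left
  rw [← SimpleGraph.mem_edgeSet]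
  apply SimpleGraph.edgeSet_mono hle
  rw [SimpleGraph.edgeSet_sup, SimpleGraph.edgeSet_edge_of_ne hab]
  exact Or.inr rfl

/-- An edge that meets the segment `pb` has an endpoint on each side of it. -/
theorem exists_endpoint_side (hP : GeneralPosition P) {p b : P} (hpb : p ≠ b) {g : Sym2 P}
    (hg : ¬ g.IsDiag) (hne : g ≠ s(p, b)) {v : ℂ} (hv : v ∈ openSegment ℝ (p : ℂ) b)
    (hvg : v ∈ edgeSeg g) {τ : ℝ} (hτ : τ ≠ 0) :
    ∃ u : P, (u : ℂ) ∈ edgeSeg g ∧ 0 < τ * orient (p : ℂ) b u := by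
  induction g using Sym2.ind with
  | _ u₁ u₂ =>
  have hu : u₁ ≠ u₂ := hg
  obtain ⟨hvp, hvb⟩ := ne_of_mem_openSegment (Subtype.coe_injective.ne hpb) hv
  have hzero : ∀ u : P, orient (p : ℂ) b u = 0 → u = p ∨ u = b := by
    intro u h
    by_contra hcon
    push Not at hcon
    exact orient_ne_zero hP hpb hcon.1.symm hcon.2.symm h
  have hvu : ∀ u : P, orient (p : ℂ) b u = 0 → v ≠ u := by
    rintro u h rfl
    rcases hzero u h with rfl | rfl
    · exact hvp rfl
    · exact hvb rfl
  have h0 := cr_eq_zero_of_mem_segment (openSegment_subset_segment _ _ _ hv)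
  rw [edgeSeg_mk, segment_eq_image'] at hvg
  obtain ⟨t, ⟨ht0, ht1⟩, rfl⟩ := hvg
  rw [cr_lerp_right] at h0
  by_contra hcon
  push Not at hcon
  have k1 := hcon u₁ (left_mem_segment ℝ _ _)
  have k2 := hcon u₂ (right_mem_segment ℝ _ _)
  have k3 : (1 - t) * (τ * orient (p : ℂ) b u₁) + t * (τ * orient (p : ℂ) b u₂) = 0 := by
    simp only [orient]
    linear_combination τ * h0
  have k4 := mul_nonpos_of_nonneg_of_nonpos (sub_nonneg.2 ht1) k1
  have k5 := mul_nonpos_of_nonneg_of_nonpos ht0 k2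
  have k6 : (1 - t) * (τ * orient (p : ℂ) b u₁) = 0 := by linarith
  have k7 : t * (τ * orient (p : ℂ) b u₂) = 0 := by linarith
  have o1 : 1 - t = 0 ∨ orient (p : ℂ) b u₁ = 0 := by
    rcases mul_eq_zero.1 k6 with h | h
    · exact Or.inl h
    · exact Or.inr ((mul_eq_zero.1 h).resolve_left hτ)
  have o2 : t = 0 ∨ orient (p : ℂ) b u₂ = 0 := by
    rcases mul_eq_zero.1 k7 with h | h
    · exact Or.inl h
    · exact Or.inr ((mul_eq_zero.1 h).resolve_left hτ)
  rcases o1 with o1 | o1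
  · obtain rfl : t = 1 := by linarith
    rcases o2 with o2 | o2
    · exact one_ne_zero o2
    · exact hvu u₂ o2 (by simp)
  · rcases o2 with rfl | o2
    · exact hvu u₁ o1 (by simp)
    · rcases hzero _ o1 with rfl | rfl <;> rcases hzero _ o2 with rfl | rfl
      · exact hu rfl
      · exact hne rfl
      · exact hne Sym2.eq_swap
      · exact hu rfl

theorem exists_extreme {ι : Type*} (A : Finset ι) (hA : A.Nonempty) (f : ι → ℂ) (c : ℂ) {σ : ℝ}
    (h : ∀ x ∈ A, 0 < σ * cr c (f x)) : ∃ b ∈ A, ∀ x ∈ A, 0 ≤ σ * cr (f b) (f x) := by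
  rcases lt_trichotomy σ 0 with hσ | rfl | hσ
  · obtain ⟨b, hb, hm⟩ := exists_last A hA f (-c) fun x hx => by
      rw [cr_neg_left]
      have := h x hx
      by_contra hneg
      nlinarith
    refine ⟨b, hb, fun x hx => ?_⟩
    rw [cr_comm]
    nlinarith [hm x hx]
  · obtain ⟨b, hb⟩ := hA
    simpa using h b hb
  · obtain ⟨b, hb, hm⟩ := exists_first A hA f c fun x hx => (mul_pos_iff_of_pos_left hσ).1 (h x hx)
    exact ⟨b, hb, fun x hx => mul_nonneg hσ.le (hm x hx)⟩

/-- If the ray from `p` first meets the drawing at an inner point `w` of the edge `yy'`, then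
there is a neighbor of `p` in the angle between `w` and `y`. -/
theorem IsFullTriangulation.exists_adj_cone (hT : IsFullTriangulation T) (hP : GeneralPosition P)
    {p y y' : P} {w : ℂ} (hyy : T.Adj y y') (hw : w ∈ openSegment ℝ (y : ℂ) y')
    (hfree : openSegment ℝ (p : ℂ) w ⊆ (edgeUnion T)ᶜ) {σ : ℝ} (hy : 0 < σ * orient (p : ℂ) w y) :
    ∃ b, T.Adj p b ∧ 0 < σ * orient (p : ℂ) w b ∧ 0 ≤ σ * orient (p : ℂ) b y := by
  classical
  have hσ : σ ≠ 0 := by rintro rfl; simp at hy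
  have hwp : w - p ≠ 0 := by
    intro h
    rw [orient, h] at hy
    simp at hy
  have hyw : (y : ℂ) - w ≠ 0 := by
    intro h
    rw [sub_eq_zero.1 h] at hy
    simp at hy
  have hline : ∀ v ∈ segment ℝ (y : ℂ) y', orient w (y : ℂ) v = 0 := by
    intro v hv
    rw [openSegment_eq_image'] at hw
    rw [segment_eq_image'] at hv
    obtain ⟨t, -, rfl⟩ := hw
    obtain ⟨t', -, rfl⟩ := hv
    simp [orient, cr]; ring
  have hlp : 0 < σ * orient w (y : ℂ) p := by rwa [← orient_rotate]
  -- Among the points on the side of `y` of the ray `pw` and weakly on the side of `p` of the line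
  -- `yy'`, `b` has the direction closest to the ray; `y` itself is a candidate. It is shown that
  -- nothing hides `b` from `p`: an edge `g` crossing `pb` at `v` is followed to its endpoint `u` on
  -- the side of the ray.
  obtain ⟨b, hb, hmin⟩ := exists_extreme
    (Finset.univ.filter fun x : P => 0 < σ * orient (p : ℂ) w x ∧ 0 ≤ σ * orient w (y : ℂ) x)
    ⟨y, by simpa using hy⟩ (fun x => (x : ℂ) - p) (w - p) (σ := σ)
    (fun x hx => (Finset.mem_filter.1 hx).2.1)
  simp only [Finset.mem_filter, Finset.mem_univ, true_and] at hb hmin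
  have hby : 0 ≤ σ * orient (p : ℂ) b y := hmin y ⟨hy, by simp⟩
  have hpb : p ≠ b := by rintro rfl; simp at hb
  refine ⟨b, hT.adj hP hpb fun v hv g hg hne hvg => ?_, hb.1, hby⟩
  obtain ⟨u, hug, hu⟩ := exists_endpoint_side hP hpb (T.not_isDiag_of_mem_edgeSet hg) hne hv hvg
    (neg_ne_zero.2 hσ)
  have hgne : ∀ z ∈ openSegment ℝ (y : ℂ) y', z ∉ edgeSeg g := by
    intro z hz hzg
    have hgy : g = s(y, y') := by
      by_contra h
      exact notMem_of_mem_openSegment hT.prop hyy hz hg h hzg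
    subst hgy
    have h1 := hline v hvg
    rw [openSegment_eq_image'] at hv
    obtain ⟨t, ht, rfl⟩ := hv
    rw [orient, cr_lerp_right] at h1
    have h2 := mul_pos (sub_pos.2 ht.2) hlp
    have h3 := mul_nonneg ht.1.le hb.2
    simp only [orient] at h2 h3
    have h4 := congrArg (fun x => σ * x) h1
    rw [mul_zero] at h4
    linarith
  have hpath : ∀ τ : ℝ, 0 ≤ τ → τ ≤ 1 → v + τ • ((u : ℂ) - v) ∈ edgeSeg g := by
    intro τ h0 h1
    have hconv : Convex ℝ (edgeSeg g) := by
      induction g using Sym2.ind with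
      | _ x x' => exact convex_segment _ _
    refine hconv.segment_subset hvg hug ?_
    rw [segment_eq_image']
    exact ⟨τ, ⟨h0, h1⟩, rfl⟩
  obtain ⟨t, ⟨ht0, ht1⟩, hvt⟩ := (openSegment_eq_image' ℝ (p : ℂ) b).subset hv
  dsimp only at hvt
  have v1 : 0 < σ * cr (w - p) (v - p) := by
    rw [← hvt, add_sub_cancel_left, cr_smul_right]
    have := mul_pos ht0 hb.1
    rw [orient] at this
    linarith
  have v2 : σ * cr (v - p) (b - p) = 0 := by
    rw [← hvt, add_sub_cancel_left, cr_smul_left, cr_self, mul_zero, mul_zero]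
  have v3 : 0 < σ * cr ((y : ℂ) - w) (v - w) := by
    rw [← hvt, cr_lerp_right]
    have h2 := mul_pos (sub_pos.2 ht1) hlp
    have h3 := mul_nonneg ht0.le hb.2
    simp only [orient] at h2 h3
    linarith
  have u2 : 0 < σ * cr ((u : ℂ) - p) (b - p) := by
    rw [cr_comm]
    rw [orient] at hu
    linarith
  have z2 : ∀ τ : ℝ, 0 < τ → 0 < σ * cr (v + τ • ((u : ℂ) - v) - p) (b - p) := by
    intro τ h
    rw [cr_lerp_left]
    have := mul_pos h u2
    have e : σ * ((1 - τ) * cr (v - p) (b - p) + τ * cr ((u : ℂ) - p) (b - p)) =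
      (1 - τ) * (σ * cr (v - p) (b - p)) + τ * (σ * cr ((u : ℂ) - p) (b - p)) := by ring
    rw [e, v2]
    linarith
  -- Where the path from `v` to `u` meets the line `pw`, it has already passed the line `yy'`, since
  -- the segment from `p` to `w` is free.
  have C1 : ∀ τ : ℝ, 0 ≤ τ → τ ≤ 1 → cr (w - p) (v + τ • ((u : ℂ) - v) - p) = 0 →
      σ * cr ((y : ℂ) - w) (v + τ • ((u : ℂ) - v) - w) < 0 := by
    intro τ h0 h1 hz
    have hτ : 0 < τ := by
      refine lt_of_le_of_ne h0 ?_
      rintro rfl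
      rw [zero_smul, add_zero] at hz
      rw [hz] at v1
      simp at v1
    have hz2 := z2 τ hτ
    have hzg := hpath τ h0 h1
    set z := v + τ • ((u : ℂ) - v)
    obtain ⟨k, hk⟩ := eq_smul_of_cr_eq_zero hwp hz
    have hk0 : 0 < k := by
      rw [hk, cr_smul_left] at hz2
      refine pos_of_mul_pos_left (b := σ * cr (w - p) ((b : ℂ) - p)) ?_ hb.1.le
      linarith
    obtain hzk : z = p + k • (w - p) := by rw [← hk]; ring
    by_contra hneg
    push Not at hneg
    have hk1 : 0 ≤ 1 - k := by
      rw [hzk, cr_lerp_right, cr_comm _ (w - w), sub_self, cr_zero_left, neg_zero, mul_zero,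
        add_zero] at hneg
      refine nonneg_of_mul_nonneg_left (b := σ * orient w (y : ℂ) p) ?_ hlp
      rw [orient]
      linarith
    rcases hk1.eq_or_lt with hk1 | hk1
    · obtain rfl : k = 1 := by linarith
      rw [one_smul, add_sub_cancel] at hzk
      rw [hzk] at hzg
      exact hgne w hw hzg
    · refine hfree (a := z) ?_ (mem_edgeUnion.2 ⟨g, hg, hzg⟩)
      rw [openSegment_eq_image']
      exact ⟨k, ⟨hk0, by linarith⟩, hzk.symm⟩
  -- The path cannot cross the line `yy'` strictly between `w` and `y`, since `g` avoids the open
  -- edge.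
  have C2 : ∀ τ : ℝ, 0 ≤ τ → τ ≤ 1 → cr ((y : ℂ) - w) (v + τ • ((u : ℂ) - v) - w) = 0 →
      σ * cr (w - p) (v + τ • ((u : ℂ) - v) - p) ≤ 0 := by
    intro τ h0 h1 hz
    have hτ : 0 < τ := by
      refine lt_of_le_of_ne h0 ?_
      rintro rfl
      rw [zero_smul, add_zero] at hz
      rw [hz] at v3
      simp at v3
    have hz2 := z2 τ hτ
    have hzg := hpath τ h0 h1
    set z := v + τ • ((u : ℂ) - v)
    obtain ⟨k, hk⟩ := eq_smul_of_cr_eq_zero hyw hz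
    obtain hzk : z = w + k • ((y : ℂ) - w) := by rw [← hk]; ring
    by_contra hneg
    push Not at hneg
    have hk0 : 0 < k := by
      rw [hzk, cr_lerp_right, cr_self, mul_zero, zero_add] at hneg
      refine pos_of_mul_pos_left (b := σ * orient (p : ℂ) w y) ?_ hy.le
      rw [orient]
      linarith
    have hk1 : k < 1 := by
      by_contra hge
      push Not at hge
      rw [hzk, cr_lerp_left, cr_comm ((y : ℂ) - p)] at hz2
      have h2 := mul_nonneg (sub_nonneg.2 hge) hb.1.le
      have h3 := mul_nonneg hk0.le hby
      simp only [orient] at h2 h3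
      linarith
    refine hgne z ?_ hzg
    obtain ⟨t', ht', hw'⟩ := (openSegment_eq_image' ℝ (y : ℂ) y').subset hw
    dsimp only at hw'
    rw [openSegment_eq_image']
    refine ⟨(1 - k) * t', ⟨mul_pos (by linarith) ht'.1, ?_⟩, ?_⟩
    · nlinarith [ht'.1, ht'.2]
    · dsimp only
      rw [hzk, ← hw']
      module
  -- The path does get beyond the line `yy'` while weakly on the side of `y` of the ray: either at
  -- `u`, by the choice of `b`, or where it meets the line `pw`.
  have hend : ∃ τ : ℝ, 0 ≤ τ ∧ τ ≤ 1 ∧ 0 ≤ σ * cr (w - p) (v + τ • ((u : ℂ) - v) - p) ∧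
      σ * cr ((y : ℂ) - w) (v + τ • ((u : ℂ) - v) - w) < 0 := by
    by_cases hu1 : 0 < σ * cr (w - p) ((u : ℂ) - p)
    · refine ⟨1, by norm_num, le_rfl, ?_, ?_⟩
      · rw [one_smul, add_sub_cancel]; exact hu1.le
      · rw [one_smul, add_sub_cancel]
        by_contra hge
        push Not at hge
        have := hmin u ⟨hu1, hge⟩
        rw [cr_comm] at u2
        linarith
    · push Not at hu1
      have hd : 0 < σ * cr (w - p) (v - p) - σ * cr (w - p) ((u : ℂ) - p) := by linarith
      set τ := σ * cr (w - p) (v - p) / (σ * cr (w - p) (v - p) - σ * cr (w - p) ((u : ℂ) - p))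
      have hτ0 : 0 ≤ τ := div_nonneg v1.le hd.le
      have hτ1 : τ ≤ 1 := (div_le_one hd).2 (by linarith)
      have hz : σ * cr (w - p) (v + τ • ((u : ℂ) - v) - p) = 0 := by
        rw [cr_lerp_right]
        have := div_mul_cancel₀ (σ * cr (w - p) (v - p)) hd.ne'
        linear_combination -this
      exact ⟨τ, hτ0, hτ1, hz.ge, C1 τ hτ0 hτ1 ((mul_eq_zero.1 hz).resolve_left hσ)⟩
  obtain ⟨τ, h0, h1, h2, h3⟩ := hend
  rw [cr_lerp_right] at h2 h3
  set A := σ * cr (w - p) (v - p)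
  set B := σ * cr (w - p) ((u : ℂ) - p)
  set C := σ * cr ((y : ℂ) - w) (v - w)
  set D := σ * cr ((y : ℂ) - w) ((u : ℂ) - w)
  have h2' : 0 ≤ (1 - τ) * A + τ * B := by simp only [A, B]; linarith
  have h3' : (1 - τ) * C + τ * D < 0 := by simp only [C, D]; linarith
  have hCD : 0 < C - D := by
    by_contra hge
    nlinarith
  -- Here the path crosses the line `yy'`. It starts strictly on the side of `y` and is still weakly
  -- there at the later time `τ`, so it is strictly there at `ρ`, against `C2`.
  set ρ := C / (C - D)
  have hρ : ρ * (C - D) = C := div_mul_cancel₀ C hCD.ne'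
  have hρ0 : 0 < ρ := div_pos v3 hCD
  have hρτ : ρ < τ := by
    by_contra hge
    nlinarith
  have hz : σ * cr ((y : ℂ) - w) (v + ρ • ((u : ℂ) - v) - w) = 0 := by
    rw [cr_lerp_right]
    simp only [C, D] at hρ
    linear_combination -hρ
  have hle := C2 ρ hρ0.le (by linarith) ((mul_eq_zero.1 hz).resolve_left hσ)
  rw [cr_lerp_right] at hle
  have hle' : (1 - ρ) * A + ρ * B ≤ 0 := by simp only [A, B]; linarith
  have e : τ * ((1 - ρ) * A + ρ * B) = (τ - ρ) * A + ρ * ((1 - τ) * A + τ * B) := by ring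
  have := mul_pos (sub_pos.2 hρτ) v1
  have := mul_nonneg hρ0.le h2'
  have := mul_nonpos_of_nonneg_of_nonpos h0 hle'
  linarith

/-- The first point of the drawing on a segment. -/
theorem exists_first_hit (hP : GeneralPosition P) {p : P} {z : ℂ}
    (h : ∃ x ∈ segment ℝ (p : ℂ) z, ∃ f ∈ G.edgeSet, p ∉ f ∧ x ∈ edgeSeg f) :
    ∃ k : ℝ, 0 < k ∧ k ≤ 1 ∧
      (∃ f ∈ G.edgeSet, p ∉ f ∧ (p : ℂ) + k • (z - p) ∈ edgeSeg f) ∧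
      ∀ t : ℝ, 0 ≤ t → t < k → ∀ f ∈ G.edgeSet, p ∉ f → (p : ℂ) + t • (z - p) ∉ edgeSeg f := by
  set F := ⋃ f ∈ {f | f ∈ G.edgeSet ∧ p ∉ f}, edgeSeg f
  have hF : ∀ x, x ∈ F ↔ ∃ f ∈ G.edgeSet, p ∉ f ∧ x ∈ edgeSeg f := by
    intro x
    simp [F, and_assoc]
  have hcont : Continuous fun t : ℝ => (p : ℂ) + t • (z - p) := by fun_prop
  have hK : IsCompact (Set.Icc (0 : ℝ) 1 ∩ (fun t : ℝ => (p : ℂ) + t • (z - p)) ⁻¹' F) :=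
    isCompact_Icc.inter_right ((isClosed_biUnion_edgeSeg _).preimage hcont)
  obtain ⟨k, ⟨⟨hk0, hk1⟩, hkF⟩, hleast⟩ := hK.exists_isLeast (by
    obtain ⟨x, hx, hf⟩ := h
    rw [segment_eq_image'] at hx
    obtain ⟨t, ht, rfl⟩ := hx
    exact ⟨t, ht, (hF _).2 hf⟩)
  have hkF' := (hF _).1 hkF
  refine ⟨k, lt_of_le_of_ne hk0 ?_, hk1, hkF', fun t ht0 htk f hf hpf htf => ?_⟩
  · rintro rfl
    obtain ⟨f, hf, hpf, hpF⟩ := hkF'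
    dsimp only at hpF
    rw [zero_smul, add_zero] at hpF
    exact hpf (mem_edge_of_mem_edgeSeg hP hf hpF)
  · exact absurd (hleast ⟨⟨ht0, by linarith⟩, (hF _).2 ⟨f, hf, hpf, htf⟩⟩) (not_le.2 htk)

/-- What can be seen from `p` in the direction of `z`. -/
theorem IsFullTriangulation.exists_view (hT : IsFullTriangulation T) (hP : GeneralPosition P)
    {p : P} {z : ℂ} (hz : z ≠ p)
    (h : ∃ x ∈ segment ℝ (p : ℂ) z, ∃ f ∈ T.edgeSet, p ∉ f ∧ x ∈ edgeSeg f)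
    (hray : ∀ x, T.Adj p x → ∀ c : ℝ, 0 < c → (x : ℂ) - p ≠ c • (z - p)) :
    ∃ (k : ℝ) (y y' : P), 0 < k ∧ k ≤ 1 ∧ T.Adj y y' ∧ p ∉ s(y, y') ∧
      (p : ℂ) + k • (z - p) ∈ openSegment ℝ (y : ℂ) y' ∧ 0 < orient (p : ℂ) z y ∧
      0 < -orient (p : ℂ) z y' ∧
      (∃ b, T.Adj p b ∧ 0 < orient (p : ℂ) z b ∧ 0 ≤ orient (p : ℂ) b y) ∧
      ∃ b, T.Adj p b ∧ 0 < -orient (p : ℂ) z b ∧ 0 ≤ -orient (p : ℂ) b y' := by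
  obtain ⟨k, hk0, hk1, ⟨f, hf, hpf, hkf⟩, hfirst⟩ := exists_first_hit hP h
  set w := (p : ℂ) + k • (z - p) with hw
  have hwz : ∀ x : ℂ, orient (p : ℂ) w x = k * orient (p : ℂ) z x := by
    intro x
    rw [orient, hw, add_sub_cancel_left, cr_smul_left, orient]
  have hwp : (p : ℂ) ≠ w := by
    intro h
    have : k • (z - p) = 0 := by
      have := hw.symm.trans h.symm
      simpa using this
    rcases smul_eq_zero.1 this with h | h
    · exact hk0.ne' h
    · exact hz (sub_eq_zero.1 h)
  have hfree : openSegment ℝ (p : ℂ) w ⊆ (edgeUnion T)ᶜ := by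
    intro v hv hvU
    obtain ⟨hvp, -⟩ := ne_of_mem_openSegment hwp hv
    obtain ⟨g, hg, hvg⟩ := mem_edgeUnion.1 hvU
    rw [openSegment_eq_image'] at hv
    obtain ⟨t, ⟨ht0, ht1⟩, rfl⟩ := hv
    have e : (p : ℂ) + t • (w - p) = p + (t * k) • (z - p) := by
      rw [hw, add_sub_cancel_left, smul_smul]
    dsimp only at hvg hvp
    rw [e] at hvg hvp
    by_cases hpg : p ∈ g
    · obtain ⟨x, rfl, hx, c, hc0, -, hc⟩ := exists_of_mem_edgeSeg hg hpg hvg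
      rw [add_sub_cancel_left] at hc
      have hc0 : 0 < c := by
        refine lt_of_le_of_ne hc0 ?_
        rintro rfl
        rw [zero_smul] at hc
        exact hvp (by rw [hc, add_zero])
      refine hray x hx (c⁻¹ * (t * k)) (by positivity) ?_
      rw [mul_smul, hc, smul_smul, inv_mul_cancel₀ hc0.ne', one_smul]
    · exact hfirst (t * k) (by positivity) (by nlinarith) g hg hpg hvg
  -- A vertex visible from `p` would be a neighbor of `p` on the ray, by maximality, which `hray`
  -- excludes.
  have hnP : ∀ x : P, w ≠ x := by
    intro x hx
    have hpx : p ≠ x := by rintro rfl; exact hwp hx.symm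
    refine hray x (hT.adj hP hpx fun v hv g hg _ hvg => ?_) k hk0 (by
      rw [← hx, hw, add_sub_cancel_left])
    exact hfree (hx ▸ hv) (mem_edgeUnion.2 ⟨g, hg, hvg⟩)
  induction f using Sym2.ind with
  | _ y y' =>
  have hadj : T.Adj y y' := hf
  have hwo : w ∈ openSegment ℝ (y : ℂ) y' :=
    mem_openSegment_of_ne_left_right (hnP y).symm (hnP y').symm hkf
  rw [Sym2.mem_iff, not_or] at hpf
  have hne := orient_ne_zero hP hpf.1 hpf.2 hadj.ne
  have main : ∀ {y y' : P}, T.Adj y y' → p ≠ y → p ≠ y' → w ∈ openSegment ℝ (y : ℂ) y' →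
      0 < orient (p : ℂ) y' y → ∃ (k : ℝ) (y y' : P), 0 < k ∧ k ≤ 1 ∧ T.Adj y y' ∧ p ∉ s(y, y') ∧
      (p : ℂ) + k • (z - p) ∈ openSegment ℝ (y : ℂ) y' ∧ 0 < orient (p : ℂ) z y ∧
      0 < -orient (p : ℂ) z y' ∧
      (∃ b, T.Adj p b ∧ 0 < orient (p : ℂ) z b ∧ 0 ≤ orient (p : ℂ) b y) ∧
      ∃ b, T.Adj p b ∧ 0 < -orient (p : ℂ) z b ∧ 0 ≤ -orient (p : ℂ) b y' := by
    intro y y' hadj h1 h2 hwo hpos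
    obtain ⟨t, ⟨ht0, ht1⟩, hwt⟩ := (openSegment_eq_image' ℝ (y : ℂ) y').subset hwo
    dsimp only at hwt
    have hy : 0 < 1 * orient (p : ℂ) w y := by
      rw [one_mul, ← hwt, orient, cr_lerp_left, cr_self, mul_zero, zero_add]
      exact mul_pos ht0 hpos
    have hy' : 0 < (-1) * orient (p : ℂ) w y' := by
      rw [← hwt, orient, cr_lerp_left, cr_self, mul_zero, add_zero, cr_comm]
      have := mul_pos (sub_pos.2 ht1) hpos
      rw [orient] at this
      linarith
    obtain ⟨b, hb, hb1, hb2⟩ := hT.exists_adj_cone hP hadj hwo hfree hy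
    obtain ⟨b', hb', hb1', hb2'⟩ := hT.exists_adj_cone hP hadj.symm
      (by rwa [openSegment_symm]) hfree hy'
    rw [one_mul] at hy hb1 hb2
    rw [neg_one_mul] at hy' hb1' hb2'
    rw [hwz] at hy hb1 hy' hb1'
    rw [← mul_neg] at hy' hb1'
    refine ⟨k, y, y', hk0, hk1, hadj, ?_, hwo, (mul_pos_iff_of_pos_left hk0).1 hy,
      (mul_pos_iff_of_pos_left hk0).1 hy', ⟨b, hb, (mul_pos_iff_of_pos_left hk0).1 hb1, hb2⟩,
      ⟨b', hb', (mul_pos_iff_of_pos_left hk0).1 hb1', hb2'⟩⟩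
    rw [Sym2.mem_iff, not_or]
    exact ⟨h1, h2⟩
  rcases lt_or_gt_of_ne hne with h | h
  · exact main hadj hpf.1 hpf.2 hwo (by rw [orient_swap]; linarith)
  · exact main hadj.symm hpf.2 hpf.1 (by rwa [openSegment_symm]) h

/-- A point with a point of the set in an open half plane has a neighbor in that half plane. -/
theorem IsFullTriangulation.exists_adj_right (hT : IsFullTriangulation T)
    (hP : GeneralPosition P) {c : ℂ} {p x : P} (hx : 0 < cr c ((x : ℂ) - p)) :
    ∃ b, T.Adj p b ∧ 0 < cr c ((b : ℂ) - p) := by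
  have hpx : p ≠ x := by rintro rfl; simp at hx
  by_cases hadj : T.Adj p x
  · exact ⟨x, hadj, hx⟩
  have heq : ∀ {x'}, T.Adj p x' → cr ((x' : ℂ) - p) (x - p) ≠ 0 := fun hx' h =>
    hadj (eq_of_orient_eq_zero hP hx'.ne hpx h ▸ hx')
  have hhit : ∃ v ∈ segment ℝ (p : ℂ) x, ∃ f ∈ T.edgeSet, p ∉ f ∧ v ∈ edgeSeg f := by
    by_contra hcon
    push Not at hcon
    refine hadj (hT.adj hP hpx fun v hv f hf hne hvf => ?_)
    by_cases hpf : p ∈ f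
    · obtain ⟨x', rfl, hx', c, -, -, hc⟩ := exists_of_mem_edgeSeg hf hpf hvf
      refine heq hx' ?_
      obtain ⟨hvp, -⟩ := ne_of_mem_openSegment (Subtype.coe_injective.ne hpx) hv
      have h1 := cr_eq_zero_of_mem_segment (openSegment_subset_segment _ _ _ hv)
      rw [hc, cr_smul_right] at h1
      have hc0 : c ≠ 0 := by
        rintro rfl
        rw [zero_smul, sub_eq_zero] at hc
        exact hvp hc
      rw [cr_comm, (mul_eq_zero.1 h1).resolve_left hc0, neg_zero]
    · exact hcon v (openSegment_subset_segment _ _ _ hv) f hf hpf hvf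
  obtain ⟨k, y, y', hk0, -, -, -, hw, hy, hy', ⟨b, hb, hb1, hb2⟩, ⟨b', hb', hb1', hb2'⟩⟩ :=
    hT.exists_view hP (Subtype.coe_injective.ne hpx.symm) hhit fun x' hx' t _ h => heq hx' (by
      rw [h, cr_smul_left, cr_self, mul_zero])
  have hwc : 0 < cr c ((p : ℂ) + k • ((x : ℂ) - p) - p) := by
    rw [add_sub_cancel_left, cr_smul_right]
    exact mul_pos hk0 hx
  rw [openSegment_eq_image'] at hw
  obtain ⟨t, ⟨ht0, ht1⟩, hwt⟩ := hw
  rw [← hwt, cr_lerp_right] at hwc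
  simp only [orient] at *
  -- The visible edge `yy'` crosses the ray inside the half plane, so one of its ends is inside. The
  -- neighbor provided on that side is in the cone between the ray and this end, hence inside as
  -- well.
  by_cases hyc : 0 < cr c ((y : ℂ) - p)
  · refine ⟨b, hb, pos_of_mul_pos_left (b := cr ((x : ℂ) - p) (y - p)) ?_ hy.le⟩
    rw [cr_plucker]
    have := mul_nonneg hx.le hb2
    have := mul_pos hyc hb1
    linarith
  · have hyc' : 0 < cr c ((y' : ℂ) - p) := by
      by_contra hneg
      push Not at hyc hneg
      have := mul_nonpos_of_nonneg_of_nonpos (sub_pos.2 ht1).le hyc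
      have := mul_nonpos_of_nonneg_of_nonpos ht0.le hneg
      linarith
    refine ⟨b', hb', pos_of_mul_pos_left (b := -cr ((x : ℂ) - p) (y' - p)) ?_ hy'.le⟩
    rw [mul_neg, cr_plucker]
    have := mul_nonneg hx.le hb2'
    have := mul_pos hyc' hb1'
    linarith

end

section

variable {P : Finset ℂ} {G T : SimpleGraph P}

/-! ### Maximal plane graphs are triangulations -/

/-- An edge that leaves a cone at `p` bounded by the edge `pb` passes `b`. -/
theorem exists_crossing_beyond (hG : IsPlane G) {p b y y' : P} (hb : G.Adj p b) (hy : G.Adj y y')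
    (hp : p ∉ s(y, y')) {w : ℂ} (hw : w ∈ segment ℝ (y : ℂ) y') {σ : ℝ}
    (hwy : 0 < σ * cr (w - p) ((y : ℂ) - p)) (hwb : 0 < σ * cr (w - p) ((b : ℂ) - p))
    (hby : 0 ≤ σ * cr ((b : ℂ) - p) ((y : ℂ) - p)) :
    ∃ s τ : ℝ, 0 < s ∧ s ≤ 1 ∧ 1 ≤ τ ∧ w + s • ((y : ℂ) - w) = p + τ • ((b : ℂ) - p) := by
  have hσ : σ ≠ 0 := by rintro rfl; simp at hwy
  set A := σ * cr (w - p) ((b : ℂ) - p)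
  set B := σ * cr ((b : ℂ) - p) ((y : ℂ) - p)
  have hd : 0 < A + B := by linarith
  -- The parameter at which the segment from `w` to `y` meets the line `pb`.
  set s := A / (A + B)
  have hs0 : 0 < s := div_pos hwb hd
  have hs1 : s ≤ 1 := (div_le_one hd).2 (by linarith)
  have hs : s * (A + B) = A := div_mul_cancel₀ A hd.ne'
  have h0 : cr ((b : ℂ) - p) (w + s • ((y : ℂ) - w) - p) = 0 := by
    refine (mul_eq_zero.1 (?_ : σ * _ = 0)).resolve_left hσ
    rw [cr_lerp_right, cr_comm _ (w - p)]
    simp only [A, B] at hs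
    linear_combination hs
  obtain ⟨τ, hτ⟩ := eq_smul_of_cr_eq_zero (coe_sub_ne_zero hb.ne) h0
  have heq : w + s • ((y : ℂ) - w) = p + τ • ((b : ℂ) - p) := by rw [← hτ]; ring
  have hτ0 : 0 < τ := by
    have h1 := cr_lerp_right (w - p) p w y s
    rw [hτ, cr_smul_right, cr_self, mul_zero, zero_add] at h1
    refine pos_of_mul_pos_left (b := A) ?_ hwb.le
    have h2 := mul_pos hs0 hwy
    have h3 := congrArg (fun x => σ * x) h1
    simp only [A]
    linarith
  refine ⟨s, τ, hs0, hs1, ?_, heq⟩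
  by_contra hlt
  push Not at hlt
  refine notMem_of_mem_openSegment hG hb (z := w + s • ((y : ℂ) - w)) ?_ (f := s(y, y')) hy ?_ ?_
  · rw [openSegment_eq_image']
    exact ⟨τ, ⟨hτ0, hlt⟩, heq.symm⟩
  · intro h
    exact hp (h ▸ Sym2.mem_mk_left p b)
  · refine (convex_segment (y : ℂ) y').segment_subset hw (left_mem_segment ℝ _ _) ?_
    rw [segment_eq_image']
    exact ⟨s, ⟨hs0.le, hs1⟩, rfl⟩

theorem Wedge.notMem_of_cone {p a b : P} (hw : Wedge G p a b) {z : ℂ}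
    (h1 : 0 < orient (p : ℂ) a z) (h2 : 0 < orient (p : ℂ) z b) {f : Sym2 P} (hf : f ∈ G.edgeSet)
    (hp : p ∈ f) : z ∉ edgeSeg f := by
  intro hz
  obtain ⟨x, rfl, hx, c, hc0, -, hc⟩ := exists_of_mem_edgeSeg hf hp hz
  rw [orient, hc, cr_smul_right] at h1
  rw [orient, hc, cr_smul_left] at h2
  exact hw.empty x hx (pos_of_mul_pos_right h1 hc0) (pos_of_mul_pos_right h2 hc0)

/-- The triangle spanned by consecutive edges is not entered by other edges. -/
theorem Wedge.eq_of_mem_edgeSeg (hT : IsFullTriangulation T) (hP : GeneralPosition P) {p a b : P}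
    (hw : Wedge T p a b) {z : ℂ} (h1 : 0 < orient (p : ℂ) a z) (h2 : 0 < orient (p : ℂ) z b)
    (h3 : 0 ≤ orient (a : ℂ) b z) {f : Sym2 P} (hf : f ∈ T.edgeSet) (hz : z ∈ edgeSeg f) :
    f = s(a, b) := by
  have hpf : p ∉ f := fun hpf => hw.notMem_of_cone h1 h2 hf hpf hz
  have hzp : z ≠ p := by
    rintro rfl
    simp at h1
  -- Consider the first edge `yy'` seen from `p` in the direction of `z`; it will turn out to be
  -- `ab`.
  obtain ⟨k, y, y', hk0, hk1, hadj, hpy, hwo, hy, hy', ⟨c, hc, hc1, hc2⟩, ⟨c', hc', hc1', hc2'⟩⟩ :=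
    hT.exists_view hP hzp ⟨z, right_mem_segment ℝ _ _, f, hf, hpf, hz⟩ (by
      intro x hx t ht h
      refine hw.empty x hx ?_ ?_
      · rw [orient, h, cr_smul_right]; exact mul_pos ht h1
      · rw [orient, h, cr_smul_left]; exact mul_pos ht h2)
  have hD := hw.pos
  -- If `y` lay inside the wedge, the neighbor of `p` seen between `z` and `y` would too.
  have hby : 0 ≤ cr ((b : ℂ) - p) (y - p) := by
    by_contra hneg
    have hyb : 0 < cr ((y : ℂ) - p) (b - p) := by rw [cr_comm]; linarith
    have k1 : 0 < cr ((c : ℂ) - p) (b - p) := by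
      refine pos_of_mul_pos_right (a := cr (z - p) (y - p)) ?_ hy.le
      have e := cr_plucker (z - p) ((c : ℂ) - p) (y - p) (b - p)
      rw [e]
      exact add_pos_of_pos_of_nonneg (mul_pos hc1 hyb) (mul_nonneg h2.le hc2)
    have k2 : 0 < cr ((a : ℂ) - p) (c - p) := by
      refine pos_of_mul_pos_left (b := cr (z - p) (b - p)) ?_ h2.le
      rw [cr_plucker]
      exact add_pos (mul_pos h1 k1) (mul_pos hD hc1)
    exact hw.empty c hc k2 k1
  have hay : 0 ≤ -cr ((a : ℂ) - p) (y' - p) := by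
    by_contra hneg
    have hay' : 0 < cr ((a : ℂ) - p) (y' - p) := by linarith
    simp only [orient] at hc1' hc2' hy'
    rw [← cr_comm] at hc1' hc2' hy'
    have k1 : 0 < cr ((a : ℂ) - p) (c' - p) := by
      refine pos_of_mul_pos_left (b := cr ((y' : ℂ) - p) (z - p)) ?_ hy'.le
      rw [cr_plucker]
      exact add_pos_of_pos_of_nonneg (mul_pos hay' hc1') (mul_nonneg h1.le hc2')
    have k2 : 0 < cr ((c' : ℂ) - p) (b - p) := by
      refine pos_of_mul_pos_right (a := cr ((a : ℂ) - p) (z - p)) ?_ h1.le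
      rw [cr_plucker]
      exact add_pos (mul_pos k1 h2) (mul_pos hD hc1')
    exact hw.empty c' hc' k1 k2
  set w := (p : ℂ) + k • (z - p) with hwdef
  have hwl : ∀ x : ℂ, cr (w - p) x = k * cr (z - p) x := fun x => by
    rw [hwdef, add_sub_cancel_left, cr_smul_left]
  have hws := openSegment_subset_segment _ _ _ hwo
  -- So `yy'` leaves the wedge on both sides, and it passes beyond `b` and `a` because it cannot
  -- cross the edges `pb` and `pa`.
  obtain ⟨s, τ, hs0, hs1, hτ, heq⟩ := exists_crossing_beyond hT.prop hw.right hadj hpy hws (σ := 1)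
    (by rw [one_mul, hwl]; exact mul_pos hk0 hy) (by rw [one_mul, hwl]; exact mul_pos hk0 h2)
    (by rwa [one_mul])
  obtain ⟨s', τ', hs0', hs1', hτ', heq'⟩ := exists_crossing_beyond hT.prop hw.left hadj.symm
    (by rwa [Sym2.eq_swap]) (by rwa [segment_symm]) (σ := -1)
    (by rw [neg_one_mul, hwl, ← mul_neg]; exact mul_pos hk0 hy')
    (by rw [neg_one_mul, hwl, ← mul_neg, ← cr_comm]; exact mul_pos hk0 h1) (by rwa [neg_one_mul])
  obtain ⟨t, ⟨ht0, ht1⟩, hwt⟩ := (openSegment_eq_image' ℝ (y : ℂ) y').subset hwo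
  dsimp only at hwt
  have hLp : orient (a : ℂ) b p = orient (p : ℂ) a b := (orient_rotate _ _ _).symm
  have hLb : cr ((b : ℂ) - a) ((b : ℂ) - a) = 0 := cr_self _
  have hLa : cr ((b : ℂ) - a) ((a : ℂ) - a) = 0 := by rw [sub_self, cr_zero_right]
  have l1 : orient (a : ℂ) b w = (1 - k) * orient (a : ℂ) b p + k * orient (a : ℂ) b z :=
    cr_lerp_right _ _ _ _ _
  have l2 : (1 - s) * orient (a : ℂ) b w + s * orient (a : ℂ) b y =
      (1 - τ) * orient (a : ℂ) b p := by
    have := congrArg (fun x => cr ((b : ℂ) - a) (x - a)) heq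
    refine (cr_lerp_right _ _ _ _ _).symm.trans (this.trans ?_)
    rw [cr_lerp_right, hLb, mul_zero, add_zero, orient]
  have l3 : (1 - s') * orient (a : ℂ) b w + s' * orient (a : ℂ) b y' =
      (1 - τ') * orient (a : ℂ) b p := by
    have := congrArg (fun x => cr ((b : ℂ) - a) (x - a)) heq'
    refine (cr_lerp_right _ _ _ _ _).symm.trans (this.trans ?_)
    rw [cr_lerp_right, hLa, mul_zero, add_zero, orient]
  have l4 : orient (a : ℂ) b w = (1 - t) * orient (a : ℂ) b y + t * orient (a : ℂ) b y' := by
    conv_lhs => rw [← hwt]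
    exact cr_lerp_right _ _ _ _ _
  rw [← hLp] at hD
  have m1 : 0 ≤ (1 - k) * orient (a : ℂ) b p := mul_nonneg (by linarith) hD.le
  have m2 : 0 ≤ k * orient (a : ℂ) b z := mul_nonneg hk0.le h3
  have hLw : 0 ≤ orient (a : ℂ) b w := by linarith
  -- Relative to the line `ab`, `w` is weakly on the side of `p`, and the points where `yy'` leaves
  -- the wedge are weakly on the other side; so are `y` and `y'`. Since `w` is between `y` and `y'`,
  -- all of them are on the line, which leaves only `a` and `b`.
  have m3 : orient (a : ℂ) b y ≤ 0 := by
    by_contra hpos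
    have := mul_pos hs0 (not_le.1 hpos)
    have := mul_nonneg (sub_nonneg.2 hs1) hLw
    have := mul_nonneg (sub_nonneg.2 hτ) hD.le
    linarith
  have m4 : orient (a : ℂ) b y' ≤ 0 := by
    by_contra hpos
    have := mul_pos hs0' (not_le.1 hpos)
    have := mul_nonneg (sub_nonneg.2 hs1') hLw
    have := mul_nonneg (sub_nonneg.2 hτ') hD.le
    linarith
  have m5 := mul_nonpos_of_nonneg_of_nonpos (sub_pos.2 ht1).le m3
  have m6 := mul_nonpos_of_nonneg_of_nonpos ht0.le m4
  have n1 : orient (a : ℂ) b y = 0 :=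
    (mul_eq_zero.1 (by linarith : (1 - t) * orient (a : ℂ) b y = 0)).resolve_left (by linarith)
  have n2 : orient (a : ℂ) b y' = 0 :=
    (mul_eq_zero.1 (by linarith : t * orient (a : ℂ) b y' = 0)).resolve_left ht0.ne'
  have n3 : k = 1 := by
    have := (mul_eq_zero.1 (by linarith : (1 - k) * orient (a : ℂ) b p = 0)).resolve_right hD.ne'
    linarith
  have hab : a ≠ b := by rintro rfl; simp at hD
  have hzero : ∀ u : P, orient (a : ℂ) b u = 0 → u = a ∨ u = b := by
    intro u h
    by_contra hcon
    push Not at hcon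
    exact orient_ne_zero hP hab hcon.1.symm hcon.2.symm h
  have hyy : s(y, y') = s(a, b) := by
    have := hadj.ne
    rcases hzero y n1 with rfl | rfl <;> rcases hzero y' n2 with rfl | rfl
    · exact absurd rfl this
    · rfl
    · exact Sym2.eq_swap
    · exact absurd rfl this
  rw [← hyy]
  by_contra hne
  refine notMem_of_mem_openSegment hT.prop hadj ?_ hf hne hz
  rwa [hwdef, n3, one_smul, add_sub_cancel] at hwo

theorem Wedge.adj (hT : IsFullTriangulation T) (hP : GeneralPosition P) {p a b : P}
    (hw : Wedge T p a b) : T.Adj a b := by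
  have hab : a ≠ b := by
    rintro rfl
    exact absurd hw.pos (by simp)
  refine hT.adj hP hab fun z hz f hf hne hzf => hne ?_
  have h0 := cr_eq_zero_of_mem_segment (openSegment_subset_segment _ _ _ hz)
  rw [openSegment_eq_image'] at hz
  obtain ⟨t, ⟨ht0, ht1⟩, rfl⟩ := hz
  refine hw.eq_of_mem_edgeSeg hT hP ?_ ?_ h0.ge hf hzf
  · rw [orient, cr_lerp_right, cr_self, mul_zero, zero_add]
    exact mul_pos ht0 hw.pos
  · rw [orient, cr_lerp_left, cr_self, mul_zero, add_zero]
    exact mul_pos (sub_pos.2 ht1) hw.pos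

/-- The open triangle. -/
def triangle (p a b : ℂ) : Set ℂ := {z | 0 < orient p a z ∧ 0 < orient a b z ∧ 0 < orient b p z}

theorem convex_triangle (p a b : ℂ) : Convex ℝ (triangle p a b) := by
  have h : ∀ x y : ℂ, Convex ℝ {z | 0 < orient x y z} := fun x y => by
    simpa [orient] using convex_cr_pos 1 (y - x) x
  exact (h p a).inter ((h a b).inter (h b p))

theorem mem_segment_of_orient {p a b z : ℂ} (h : 0 < orient p a b) (h0 : orient p a z = 0)
    (h1 : 0 ≤ orient a b z) (h2 : 0 ≤ orient b p z) : z ∈ segment ℝ p a := by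
  have hne : a - p ≠ 0 := by
    intro h'
    rw [orient, h'] at h
    simp at h
  obtain ⟨t, ht⟩ := eq_smul_of_cr_eq_zero hne h0
  obtain rfl : z = p + t • (a - p) := by rw [← ht]; ring
  have e1 : orient a b (p + t • (a - p)) = (1 - t) * orient p a b := by
    simp [orient, cr]; ring
  have e2 : orient b p (p + t • (a - p)) = t * orient p a b := by
    simp [orient, cr]; ring
  rw [e1] at h1
  rw [e2] at h2
  rw [segment_eq_image']
  exact ⟨t, ⟨nonneg_of_mul_nonneg_left h2 h, by linarith [nonneg_of_mul_nonneg_left h1 h]⟩, rfl⟩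

theorem closure_triangle_subset {p a b : ℂ} (h : 0 < orient p a b) :
    closure (triangle p a b) ⊆
      triangle p a b ∪ (segment ℝ p a ∪ segment ℝ a b ∪ segment ℝ b p) := by
  intro z hz
  have hc : ∀ x y : ℂ, triangle p a b ⊆ {z | 0 < orient x y z} → 0 ≤ orient x y z := by
    intro x y hxy
    exact closure_minimal (fun w hw => le_of_lt (hxy hw))
      (isClosed_le continuous_const (continuous_orient x y)) hz
  have h1 := hc p a fun w hw => hw.1
  have h2 := hc a b fun w hw => hw.2.1
  have h3 := hc b p fun w hw => hw.2.2
  rcases h1.eq_or_lt with e | k1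
  · exact Or.inr (Or.inl (Or.inl (mem_segment_of_orient h e.symm h2 h3)))
  rcases h2.eq_or_lt with e | k2
  · exact Or.inr (Or.inl (Or.inr (mem_segment_of_orient (by rwa [← orient_rotate]) e.symm h3 h1)))
  rcases h3.eq_or_lt with e | k3
  · exact Or.inr (Or.inr (mem_segment_of_orient (by rwa [orient_rotate]) e.symm h1 h2))
  exact Or.inl ⟨k1, k2, k3⟩

/-- The sides of the triangle are edges and no edge enters it, so the open triangle is a component.
It shares with `r` the points just left of the middle of `pa`. -/
theorem Wedge.eq_triangle (hT : IsFullTriangulation T) (hP : GeneralPosition P) {p a b : P}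
    (hw : Wedge T p a b) {r : Set ℂ} (hr : IsComp T r) (hs : IsSide 1 r p a) :
    r = triangle p a b := by
  have hD := hw.pos
  have hab := hw.adj hT hP
  set m := (p : ℂ) + (1 / 2 : ℝ) • ((a : ℂ) - p) with hm
  have hmo := half_mem_openSegment (p : ℂ) a
  have e1 : orient (a : ℂ) b m = 1 / 2 * orient (p : ℂ) a b := by
    simp [hm, orient, cr]; ring
  have e2 : orient (b : ℂ) p m = 1 / 2 * orient (p : ℂ) a b := by
    simp [hm, orient, cr]; ring
  have hv := cr_I_mul_pos (coe_sub_ne_zero hw.left.ne)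
  set v := Complex.I * ((a : ℂ) - p)
  obtain ⟨ε, ⟨⟨k1, k2⟩, k3⟩, hε⟩ := ((((tendsto_ray m v).eventually
      ((isOpen_lt continuous_const (continuous_orient (a : ℂ) b)).mem_nhds
        (show m ∈ {z | 0 < orient (a : ℂ) b z} by rw [Set.mem_ofPred_eq, e1]; linarith))).and
    ((tendsto_ray m v).eventually
      ((isOpen_lt continuous_const (continuous_orient (b : ℂ) p)).mem_nhds
        (show m ∈ {z | 0 < orient (b : ℂ) p z} by rw [Set.mem_ofPred_eq, e2]; linarith)))).and
    (hs.ger hmo (v := v) (by rwa [one_mul]))).and self_mem_nhdsWithin |>.exists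
  have hε : 0 < ε := hε
  have hmem : m + ε • v ∈ triangle (p : ℂ) a b := by
    refine ⟨?_, k1, k2⟩
    have e : m + ε • v - p = (1 / 2 : ℝ) • ((a : ℂ) - p) + ε • v := by rw [hm]; ring
    rw [orient, e, cr_add_right, cr_smul_right, cr_smul_right, cr_self, mul_zero, zero_add]
    exact mul_pos hε hv
  have hcomp : IsComp T (triangle (p : ℂ) a b) := by
    refine isComp_of_isOpen (isOpen_triangle _ _ _) (convex_triangle _ _ _).isPreconnected
      ⟨_, hmem⟩ ?_ ?_
    · intro z hz hzU
      obtain ⟨f, hf, hzf⟩ := mem_edgeUnion.1 hzU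
      have hfe := hw.eq_of_mem_edgeSeg hT hP hz.1
        (by rw [orient_rotate, orient_rotate]; exact hz.2.2) hz.2.1.le hf hzf
      subst hfe
      exact hz.2.1.ne' (cr_eq_zero_of_mem_segment hzf)
    · rintro z ⟨hz, hzU⟩
      rcases closure_triangle_subset hD hz with h | (h | h) | h
      · exact h
      · exact absurd (mem_edgeUnion.2 ⟨s(p, a), hw.left, h⟩) hzU
      · exact absurd (mem_edgeUnion.2 ⟨s(a, b), hab, h⟩) hzU
      · exact absurd (mem_edgeUnion.2 ⟨s(b, p), hw.right.symm, h⟩) hzU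
  exact hr.eq_of_mem hcomp k3 hmem

/-- If `r` lay on the left of no dart, its boundary would contain no inner point of an edge and so
would be part of `P`. The complement of a finite set in the plane is connected, so `r` would contain
it and be unbounded. -/
theorem IsComp.exists_adj_isSide (hG : IsPlane G) {r : Set ℂ} (hr : IsComp G r)
    (hb : Bornology.IsBounded r) : ∃ p a, G.Adj p a ∧ IsSide 1 r p a := by
  by_contra hcon
  push Not at hcon
  have hfr : ∀ z ∈ closure r, z ∉ r → z ∈ (P : Set ℂ) := by
    intro z hz hzr
    by_contra hzP
    have hzU : z ∈ edgeUnion G := by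
      by_contra hzU
      exact hzr (hr.closure_inter_subset ⟨hz, hzU⟩)
    obtain ⟨e, he, hze⟩ := mem_edgeUnion.1 hzU
    induction e using Sym2.ind with
    | _ p a =>
    have hadj : G.Adj p a := he
    have hzo : z ∈ openSegment ℝ (p : ℂ) a := mem_openSegment_of_ne_left_right
      (by rintro rfl; exact hzP p.2) (by rintro rfl; exact hzP a.2) hze
    obtain ⟨r₁, h₁, hs₁⟩ := exists_isSide hG hadj (one_ne_zero (α := ℝ))
    obtain ⟨r₂, h₂, hs₂⟩ := exists_isSide hG hadj.symm (one_ne_zero (α := ℝ))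
    obtain ⟨w, hwr, ⟨k1, k2⟩, k3⟩ := ((mem_closure_iff_frequently.1 hz).and_eventually
      (((hs₁ z hzo).and (hs₂.swap z hzo)).and
        (eventually_mem_openSegment (coe_ne_of_adj hadj).symm hzo))).exists
    have e := cr_sub_of_mem_segment hze w
    rcases lt_trichotomy (cr ((a : ℂ) - p) (w - p)) 0 with h | h | h
    · rw [← h₂.eq_of_mem hr (k2 (by rw [e]; linarith)) hwr] at hcon
      exact hcon a p hadj.symm hs₂
    · exact hr.subset hwr (mem_edgeUnion.2 ⟨s(p, a), he, openSegment_subset_segment _ _ _ (k3 h)⟩)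
    · rw [← h₁.eq_of_mem hr (k1 (by rw [e]; linarith)) hwr] at hcon
      exact hcon p a hadj hs₁
  have hcount : (P : Set ℂ).Countable := P.countable_toSet
  have hconn := hcount.isConnected_compl_of_one_lt_rank (E := ℂ)
    (by rw [Complex.rank_real_complex]; exact_mod_cast one_lt_two)
  have hsub : (P : Set ℂ)ᶜ ⊆ r := by
    refine hconn.isPreconnected.subset_left_of_subset_union hr.isOpen
      (isClosed_closure (s := r)).isOpen_compl
      (Set.disjoint_compl_right_iff_subset.2 subset_closure) (fun z hz => ?_) ?_
    · by_cases hzc : z ∈ closure r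
      · by_contra h
        rw [Set.mem_union, not_or] at h
        exact hz (hfr z hzc h.1)
      · exact Or.inr hzc
    · rw [Set.inter_comm]
      exact (hcount.dense_compl ℝ).inter_open_nonempty r hr.isOpen hr.nonempty
  refine NormedSpace.unbounded_univ ℝ ℂ ?_
  rw [← Set.union_compl_self (P : Set ℂ)]
  exact P.finite_toSet.isBounded.union (hb.subset hsub)

theorem not_isBounded_halfPlane {p a : ℂ} (hpa : a - p ≠ 0) {r : Set ℂ}
    (h : {z | 0 < orient p a z} ⊆ r) : ¬ Bornology.IsBounded r := by
  intro hb
  obtain ⟨R, hR⟩ := hb.exists_norm_le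
  set v := Complex.I * (a - p)
  have hv : 0 < ‖v‖ := by
    rw [norm_pos_iff]
    exact mul_ne_zero Complex.I_ne_zero hpa
  have hR' : 0 < |R| + ‖p‖ + 1 := by positivity
  set t := (|R| + ‖p‖ + 1) / ‖v‖
  have ht : 0 < t := div_pos hR' hv
  have h1 : p + t • v ∈ r := h (by
    rw [Set.mem_ofPred_eq, orient, add_sub_cancel_left, cr_smul_right]
    exact mul_pos ht (cr_I_mul_pos hpa))
  have h2 := hR _ h1
  have h3 : ‖t • v‖ = |R| + ‖p‖ + 1 := by
    rw [norm_smul, Real.norm_of_nonneg ht.le, div_mul_cancel₀ _ hv.ne']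
  have h4 : ‖t • v‖ ≤ ‖p + t • v‖ + ‖p‖ := by
    have := norm_sub_le (p + t • v) p
    rwa [add_sub_cancel_left] at this
  linarith [le_abs_self R]

/-! ### Full triangulations are full subdivisions of slack zero -/

namespace IsFullTriangulation

/-- An edge crossing a hull edge would have an endpoint outside the hull, so maximality applies. -/
theorem hull_subset (hT : IsFullTriangulation T) (hP : GeneralPosition P) :
    hullEdges P ⊆ T.edgeSet := by
  have key : ∀ {p a : P}, IsHullDart p a → T.Adj p a := by
    intro p a h
    refine hT.adj hP h.1 fun z hz f hf hne hzf => ?_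
    obtain ⟨u, -, hu⟩ := exists_endpoint_side hP h.1 (T.not_isDiag_of_mem_edgeSet hf) hne hz hzf
      one_ne_zero
    linarith [h.2 u]
  intro e he
  induction e using Sym2.ind with
  | _ p a =>
  rcases mem_hullEdges_iff.1 he with h | h
  · exact key h
  · exact (key h).symm

theorem exists_wedge (hT : IsFullTriangulation T) (hP : GeneralPosition P) {r : Set ℂ}
    (hr : r ∈ regions T) : ∃ p a b, Wedge T p a b ∧ IsSide 1 r p a := by
  obtain ⟨p, a, hadj, hs⟩ := IsComp.exists_adj_isSide hT.prop hr.2 hr.1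
  by_cases hx : ∃ x : P, 0 < orient (p : ℂ) a x
  · obtain ⟨x, hx⟩ := hx
    obtain ⟨b, hb, hpos⟩ := hT.exists_adj_right hP hx
    obtain ⟨b', hw⟩ := exists_wedge_left hadj hb hpos
    exact ⟨p, a, b', hw, hs⟩
  -- To the left of a hull dart is a whole half plane without edges, so this component is unbounded.
  · exfalso
    push Not at hx
    have hd : IsHullDart p a := ⟨hadj.ne, hx⟩
    have hne := coe_sub_ne_zero hadj.ne
    refine not_isBounded_halfPlane hne (?_ : {z | 0 < orient (p : ℂ) a z} ⊆ r) hr.1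
    have hm := half_mem_openSegment (p : ℂ) a
    have hv := cr_I_mul_pos hne
    obtain ⟨ε, hε, hεr⟩ := (hs.ger hm (v := Complex.I * ((a : ℂ) - p)) (by rwa [one_mul])).exists
    have hconv : Convex ℝ {z | 0 < orient (p : ℂ) a z} := by
      simpa [orient] using convex_cr_pos 1 ((a : ℂ) - p) p
    refine IsComp.subset_of_isPreconnected hr.2 hconv.isPreconnected ?_ ?_ hεr
    · intro z hz hzU
      obtain ⟨f, hf, hzf⟩ := mem_edgeUnion.1 hzU
      have hzh : z ∈ hull P := by
        induction f using Sym2.ind with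
        | _ u v => exact convex_hull.segment_subset (mem_hull u) (mem_hull v) hzf
      exact absurd hz (not_lt.2 (hd.orient_le hzh))
    · rw [Set.mem_ofPred_eq, orient]
      have e : (p : ℂ) + (1 / 2 : ℝ) • ((a : ℂ) - p) + ε • (Complex.I * ((a : ℂ) - p)) - p =
        (1 / 2 : ℝ) • ((a : ℂ) - p) + ε • (Complex.I * ((a : ℂ) - p)) := by ring
      rw [e, cr_add_right, cr_smul_right, cr_smul_right, cr_self, mul_zero, zero_add]
      exact mul_pos hε hv

theorem isFullSubdivision (hT : IsFullTriangulation T) (hP : GeneralPosition P)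
    (hn : 3 ≤ P.card) : IsFullSubdivision T := by
  refine ⟨hT.prop, ?_, hT.hull_subset hP, fun r hr => ?_⟩
  · obtain ⟨c, hc⟩ := exists_generic P
    exact connected_of_exists_adj_right (Finset.card_pos.1 (by omega)) hc
      fun p x hx => hT.exists_adj_right hP hx
  · obtain ⟨p, a, b, hw, hs⟩ := hT.exists_wedge hP hr
    rw [hw.eq_triangle hT hP hr.2 hs]
    exact convex_triangle _ _ _

theorem corners_eq (hT : IsFullTriangulation T) (hP : GeneralPosition P)
    (hn : 3 ≤ P.card) {r : Set ℂ} (hr : r ∈ regions T) : corners r = 3 := by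
  have hS := hT.isFullSubdivision hP hn
  refine le_antisymm ?_ (hS.three_le_corners hP hr)
  obtain ⟨p, a, b, hw, hs⟩ := hT.exists_wedge hP hr
  have hrt := hw.eq_triangle hT hP hr.2 hs
  have hsub : Set.extremePoints ℝ (closure r) ⊆ {(p : ℂ), (a : ℂ), (b : ℂ)} := by
    intro z hz
    obtain ⟨q, q', rfl, hq⟩ :=
      IsComp.exists_eq_of_mem_extremePoints hr.2 (hS.convex r hr) hT.prop hz
    have hqr : (q : ℂ) ∉ triangle (p : ℂ) a b := fun h =>
      IsComp.subset hr.2 (hrt ▸ h) (mem_edgeUnion_of_adj hq)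
    have hzc := hz.1
    rw [hrt] at hzc
    have key : ∀ {u v : P}, T.Adj u v → (q : ℂ) ∈ segment ℝ (u : ℂ) v → q = u ∨ q = v :=
      fun h hm => Sym2.mem_iff.1 (mem_edge_of_mem_edgeSeg hP (G := T) (e := s(_, _)) h hm)
    rcases closure_triangle_subset hw.pos hzc with h | (h | h) | h
    · exact absurd h hqr
    · rcases key hw.left h with rfl | rfl <;> simp
    · rcases key (hw.adj hT hP) h with rfl | rfl <;> simp
    · rcases key hw.right.symm h with rfl | rfl <;> simp
  exact (Set.ncard_le_ncard hsub (Set.toFinite _)).trans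
    ((Set.ncard_insert_le _ _).trans (Nat.succ_le_succ ((Set.ncard_insert_le _ _).trans
      (by rw [Set.ncard_singleton]))))

theorem slack_eq_zero (hT : IsFullTriangulation T) (hP : GeneralPosition P) (hn : 3 ≤ P.card) :
    slack T = 0 := by
  refine finsum_mem_eq_zero_of_forall_eq_zero fun r hr => ?_
  rw [regionSlack, hT.corners_eq hP hn hr]
  norm_num

end IsFullTriangulation

end

end

end PlanarSubdivision

/-! ### The theorem -/

theorem lemmal (P : Finset ℂ) (hP : GeneralPosition P) (hn : 3 ≤ P.card) :
    -- Unoriented Edges Lemma, first part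
    (∀ S : SimpleGraph P, IsFullSubdivision S → ∀ O : PartialOrientation S,
      (∀ q p, O.dir q p → s(q, p) ∈ innerEdges S → p ∉ extPts P) →
      (∀ i, 4 ≤ i → O.innerCount i = 0) →
        (O.unorientedInner.ncard : ℤ) =
          (P.card : ℤ) - 3 - O.innerCount 3 - slack S + (O.innerCount 1 + 2 * O.innerCount 0) ∧
        (P.card : ℤ) - 3 - O.innerCount 3 - slack S + (O.innerCount 1 + 2 * O.innerCount 0) ≥
          (P.card : ℤ) - 3 - O.innerCount 3 - slack S ∧
        (P.card : ℤ) - 3 - O.innerCount 3 - slack S ≥ (extNum P : ℤ) - 3 - slack S) ∧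
    -- Unoriented Edges Lemma, second part
    (∀ S : SimpleGraph P, IsFullSubdivision S → ∀ O : PartialOrientation S, O.WellOriented →
        (O.unorientedInner.ncard : ℝ) ≥
          (P.card : ℝ) / 2 - 2 - ((slack S : ℝ) + (refinedSlack S : ℝ)) / 2 ∧
        (P.card : ℝ) / 2 - 2 - ((slack S : ℝ) + (refinedSlack S : ℝ)) / 2 ≥
          (P.card : ℝ) / 2 - 2 - (slack S : ℝ)) ∧
    -- the maximal subdivisions are those with all inner edges locked
    (∀ S : SimpleGraph P, IsFullSubdivision S →
      (IsMaximalSubdivision S ↔ ∀ e ∈ innerEdges S, Locked S e)) ∧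
    -- Coarsening Lemma
    (∀ S : SimpleGraph P, IsMaximalSubdivision S →
      (slack S : ℝ) ≥ max ((P.card : ℝ) / 2 - 2) ((extNum P : ℝ) - 3)) ∧
    -- number of flippable edges
    (∀ T : SimpleGraph P, IsFullTriangulation T →
      ({e | Flippable T e}.ncard : ℝ) ≥ max ((P.card : ℝ) / 2 - 2) ((extNum P : ℝ) - 3)) ∧
    -- number of edges compatible with a given flippable edge
    (∀ T : SimpleGraph P, IsFullTriangulation T → ∀ e, Flippable T e →
      ({f | f ∈ T.edgeSet ∧ Compatible T e f}.ncard : ℝ) ≥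
        max ((P.card : ℝ) / 2 - 3) ((extNum P : ℝ) - 4)) := by
  exact ⟨fun S hS O hO h4 => unoriented_edges_first hP hn hS O hO h4,
    fun S hS O hO => unoriented_edges_second hP hn hS O hO,
    fun S hS => hS.isMaximalSubdivision_iff hP hn,
    fun S hS => hS.le_slack hP hn,
    fun T hT => (hT.isFullSubdivision hP hn).le_ncard_flippable hP hn (hT.slack_eq_zero hP hn),
    fun T hT _ he => (hT.isFullSubdivision hP hn).le_ncard_compatible hP hn
      (hT.slack_eq_zero hP hn) he⟩
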